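/- **Setting.** Let $C=(Y,Z,A)$ take values in $\mathcal Y\times\mathcal Z\times\mathcal A$ (measurable spaces with $\sigma$-finite reference measures, written $dy,dz,da$) and have true density $q_c$; put $X=(Y,Z)$, $B=(Y,A)$. Densities $q_x,q_y,q_b$ and $q_{z|y}=q_x/q_y$ are the corresponding marginal and conditional densities. A parametric model consists of densities $p_c(c;\beta)$, $\beta=(\theta,\varphi)\in\mathcal B\subset\mathbb R^{d+f}$, whose $X$-marginal $p_x(x;\theta)=\int p_c(y,z,a;\beta)\,da$ depends on $\beta$ only through $\theta$; put $p_b(b;\beta)=\int p_c(y,z,a;\beta)\,dz$, $p_y(y;\theta)=\int p_x(y,z;\theta)\,dz$, $p_{z|y}=p_x/p_y$. Let $C_1,C_2,\dots$ be i.i.d. copies of $C$, of which only $B_i=(Y_i,A_i)$ is observed, $\ell_b(\beta)=\frac1n\sum_{i\le n}\log p_b(B_i;\beta)$, $\ell_y(\theta)=\frac1n\sum_{i\le n}\log p_y(Y_i;\theta)$, and let $\hat\beta_b=(\hat\theta_b,\hat\varphi_b)$ be a (measurable) maximizer of $\ell_b$ over $\mathcal B$. Put $$\mathcal L_x(\theta)=-\int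 q_x(x)\log p_x(x;\theta)\,dx,\qquad \mathcal R_x(\hat\theta_b)=E[\mathcal L_x(\hat\theta_b)],\qquad C(q_x)=\int q_x(x)\log q_{z|y}(z|y)\,dx .$$ Let $\bar\beta=(\bar\theta,\bar\varphi)$ be the maximizer of $\int q_b\log p_b(\beta)\,db$ over $\mathcal B$, and with $\nabla=\partial/\partial\beta$ let $$I_r=-E[\nabla^2\log p_r(\bar\beta)]\ (r=b,x,y,z|y),\quad J_b=E[\nabla\log p_b(\bar\beta)\nabla^\top\log p_b(\bar\beta)],\quad K_{b,y}=E[\nabla\log p_b(\bar\beta)\nabla^\top\log p_y(\bar\theta)],$$ $$\widehat{\mathrm{risk}}_{x;b}=-2n\ell_y(\hat\theta_b)+2\,\mathrm{tr}(I_b^{-1}K_{b,y})+\mathrm{tr}(I_{z|y}I_b^{-1}J_bI_b^{-1}).$$ **Regularity.** $\mathcal B$ is compact; $\bar\beta$ is the unique maximizer and is interior to $\mathcal B$; $I_b$ is nonsingular. For each of the families $p_b,p_y,p_x$, regarded as families in $\beta$: the support does not depend on $\beta\in\mathcal B$; $\log p$ (set to $0$ off the support) is continuous in $\beta\in\mathcal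 B$ and twice continuously differentiable in a neighbourhood of $\bar\beta$; $\sup_{\beta\in\mathcal B}|\log p|$ and, for $\beta$ near $\bar\beta$, the first and second partial derivatives of $\log p$ are dominated by functions that are square integrable under the true distribution (for $p_x$, integrable suffices for $\log p_x$ and its second derivatives). Finally, near $\bar\beta$ the second partial derivatives of $p_b(b;\beta)$ are dominated by a $db$-integrable function. **Theorem.** Suppose that $q_c=p_c(\beta_0)$ (almost everywhere) for some $\beta_0\in\mathcal B$. Then $$J_b=I_b,\qquad K_{b,y}=I_y,$$ and $\widehat{\mathrm{risk}}_{x;b}$ equals $$\mathrm{AIC}_{x;b}=-2n\ell_y(\hat\theta_b)+\mathrm{tr}(I_xI_b^{-1})+\mathrm{tr}(I_yI_b^{-1}).$$ The integral $C(q_x)$ converges absolutely, $\mathrm{AIC}_{x;b}$ and $\mathcal L_x(\hat\theta_b)$ are integrable for every $n$, and $$E[\mathrm{AIC}_{x;b}]=2n\mathcal R_x(\hat\theta_b)+2nC(q_x)+o(1)\qquad(n\to\infty).$$ Moreover: if $B=Y$ ($\mathcal A$ is a single point of mass one and $f=0$), then $\hat\theta_b$ maximizes $\ell_y$ over $\Theta=\{\theta:(\theta,\varphi)\in\mathcal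 B\}$ and $\mathrm{AIC}_{x;b}=\mathrm{AIC}_{x;y}=-2n\ell_y(\hat\theta_b)+\mathrm{tr}(I_xI_y^{-1})+d$; if $X=Y$ ($\mathcal Z$ is a single point of mass one), then $\mathrm{AIC}_{x;b}=-2n\ell_y(\hat\theta_b)+2\,\mathrm{tr}(I_yI_b^{-1})$; and if $X=Y=B$, then $\mathrm{AIC}_{x;b}=-2n\ell_y(\hat\theta_b)+2d$, the original AIC. -/

import Mathlib

open MeasureTheory ProbabilityTheory Filter Topology

noncomputable section

namespace AuxIC

/-! Calculus in coordinates on `ℝ^ι`. -/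

/-- The partial derivatives `∂F/∂β_i` at `β`. -/
def grad {ι : Type} [Fintype ι] [DecidableEq ι] (F : (ι → ℝ) → ℝ) (β : ι → ℝ) : ι → ℝ :=
  fun i => fderiv ℝ F β (Pi.single i 1)

/-- The matrix of second partial derivatives `∂²F/∂β_i∂β_j` at `β`. -/
def hess {ι : Type} [Fintype ι] [DecidableEq ι] (F : (ι → ℝ) → ℝ) (β : ι → ℝ) :
    Matrix ι ι ℝ :=
  Matrix.of fun i j => fderiv ℝ (fun b => grad F b j) β (Pi.single i 1)

/-- `g` is a probability density with respect to `μ`. -/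
structure IsDensity {U : Type*} [MeasurableSpace U] (μ : Measure U) (g : U → ℝ) : Prop where
  measurable : Measurable g
  nonneg : ∀ u, 0 ≤ g u
  integrable : Integrable g μ
  integral_eq_one : ∫ u, g u ∂μ = 1

section Truth

variable {Y Z A : Type*} [MeasurableSpace Y] [MeasurableSpace Z] [MeasurableSpace A]

/-- The observable part `b = (y, a)` of `c = (y, z, a)`. -/
def obs (c : Y × Z × A) : Y × A := (c.1, c.2.2)

/-- The primary part `x = (y, z)` of `c = (y, z, a)`. -/
def prim (c : Y × Z × A) : Y × Z := (c.1, c.2.1)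

/-- The law of `C` with density `q`. -/
def law (μY : Measure Y) (μZ : Measure Z) (μA : Measure A) (q : Y × Z × A → ℝ) :
    Measure (Y × Z × A) :=
  (μY.prod (μZ.prod μA)).withDensity fun c => ENNReal.ofReal (q c)

/-- The marginal density of `X = (Y, Z)` for a density `q` of `C`. -/
def margX (μA : Measure A) (q : Y × Z × A → ℝ) (x : Y × Z) : ℝ := ∫ a, q (x.1, x.2, a) ∂μA

/-- The marginal density of `B = (Y, A)` for a density `q` of `C`. -/
def margB (μZ : Measure Z) (q : Y × Z × A → ℝ) (b : Y × A) : ℝ := ∫ z, q (b.1, z, b.2) ∂μZ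

/-- The marginal density of `Y` for a density `r` of `X = (Y, Z)`. -/
def margY (μZ : Measure Z) (r : Y × Z → ℝ) (y : Y) : ℝ := ∫ z, r (y, z) ∂μZ

/-- The conditional density `r(z | y)` for a density `r` of `X = (Y, Z)`. -/
def condZ (μZ : Measure Z) (r : Y × Z → ℝ) (x : Y × Z) : ℝ := r x / margY μZ r x.1

/-- The integrand `q_x(x) log q_{z|y}(z|y)` of `C(q_x)`. -/
def constIntegrand (μZ : Measure Z) (μA : Measure A) (q : Y × Z × A → ℝ) (x : Y × Z) : ℝ :=
  margX μA q x * Real.log (condZ μZ (margX μA q) x)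

/-- `C(q_x) = ∫ q_x(x) log q_{z|y}(z|y) dx`. -/
def constC (μY : Measure Y) (μZ : Measure Z) (μA : Measure A) (q : Y × Z × A → ℝ) : ℝ :=
  ∫ x, constIntegrand μZ μA q x ∂(μY.prod μZ)

end Truth

/-- A parametric model `p_c(β)`, `β = (θ, φ) ∈ 𝓑 ⊆ ℝ^{d+f}`, of densities of `C = (Y, Z, A)`
whose marginal density of `X = (Y, Z)` depends on `β` only through `θ`. -/
structure Model {Y Z A : Type*} [MeasurableSpace Y] [MeasurableSpace Z] [MeasurableSpace A]
    (μY : Measure Y) (μZ : Measure Z) (μA : Measure A) (d f : ℕ) where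
  /-- the parameter space `𝓑` -/
  space : Set (Fin d ⊕ Fin f → ℝ)
  /-- the densities `p_c(c; β)` -/
  pc : (Fin d ⊕ Fin f → ℝ) → Y × Z × A → ℝ
  /-- the densities `p_x(x; θ)` -/
  px : (Fin d → ℝ) → Y × Z → ℝ
  isDensity : ∀ β ∈ space, IsDensity (μY.prod (μZ.prod μA)) (pc β)
  px_eq : ∀ β ∈ space, ∀ x, px (fun i => β (Sum.inl i)) x = margX μA (pc β) x

/-- The component `θ` of `β = (θ, φ)`. -/
def theta {d f : ℕ} (β : Fin d ⊕ Fin f → ℝ) : Fin d → ℝ := fun i => β (Sum.inl i)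

namespace Model

variable {Y Z A : Type*} [MeasurableSpace Y] [MeasurableSpace Z] [MeasurableSpace A]
  {μY : Measure Y} {μZ : Measure Z} {μA : Measure A} {d f : ℕ}

/-- `Θ = {θ | (θ, φ) ∈ 𝓑 for some φ}`. -/
def thetaSpace (M : Model μY μZ μA d f) : Set (Fin d → ℝ) := theta '' M.space

/-- `p_b(b; β)`. -/
def pb (M : Model μY μZ μA d f) (β : Fin d ⊕ Fin f → ℝ) : Y × A → ℝ := margB μZ (M.pc β)

/-- `p_y(y; θ)`. -/
def py (M : Model μY μZ μA d f) (θ : Fin d → ℝ) : Y → ℝ := margY μZ (M.px θ)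

/-- `p_{z|y}(z|y; θ)`. -/
def pzy (M : Model μY μZ μA d f) (θ : Fin d → ℝ) : Y × Z → ℝ := condZ μZ (M.px θ)

/-- `ℓ_b(β)`, the log-likelihood divided by `n`. -/
def ellB (M : Model μY μZ μA d f) {n : ℕ} (bs : Fin n → Y × A) (β : Fin d ⊕ Fin f → ℝ) : ℝ :=
  (1 / n : ℝ) * ∑ i, Real.log (M.pb β (bs i))

/-- `ℓ_y(θ)`, the log-likelihood of the `y`-part of the data divided by `n`. -/
def ellY (M : Model μY μZ μA d f) {n : ℕ} (bs : Fin n → Y × A) (θ : Fin d → ℝ) : ℝ :=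
  (1 / n : ℝ) * ∑ i, Real.log (M.py θ (bs i).1)

/-- `β̂_b`, for every sample size a measurable function of the data, is the maximum likelihood
estimator over `𝓑`. -/
def IsMLE (M : Model μY μZ μA d f)
    (βhat : (n : ℕ) → (Fin n → Y × A) → (Fin d ⊕ Fin f → ℝ)) : Prop :=
  ∀ n, Measurable (βhat n) ∧
    ∀ bs, βhat n bs ∈ M.space ∧ ∀ β ∈ M.space, M.ellB bs β ≤ M.ellB bs (βhat n bs)

/-- `β̄` is the unique maximizer over `𝓑` of `∫ q_b(b) log p_b(b; β) db`. -/
def IsOptimal (M : Model μY μZ μA d f) (q : Y × Z × A → ℝ) (βbar : Fin d ⊕ Fin f → ℝ) : Prop :=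
  βbar ∈ M.space ∧ ∀ β ∈ M.space, β ≠ βbar →
    ∫ b, margB μZ q b * Real.log (M.pb β b) ∂(μY.prod μA) <
      ∫ b, margB μZ q b * Real.log (M.pb βbar b) ∂(μY.prod μA)

/-- `𝓛_x(θ) = - ∫ q_x(x) log p_x(x; θ) dx`. -/
def lossX (M : Model μY μZ μA d f) (q : Y × Z × A → ℝ) (θ : Fin d → ℝ) : ℝ :=
  -∫ x, margX μA q x * Real.log (M.px θ x) ∂(μY.prod μZ)

/-- `I_b = -E[∇² log p_b(b; β̄)]`. -/
def Ib (M : Model μY μZ μA d f) (q : Y × Z × A → ℝ) (βbar : Fin d ⊕ Fin f → ℝ) :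
    Matrix (Fin d ⊕ Fin f) (Fin d ⊕ Fin f) ℝ :=
  Matrix.of fun i j =>
    -∫ c, hess (fun β => Real.log (M.pb β (obs c))) βbar i j ∂(law μY μZ μA q)

/-- `J_b = E[∇ log p_b(b; β̄) ∇ᵀ log p_b(b; β̄)]`. -/
def Jb (M : Model μY μZ μA d f) (q : Y × Z × A → ℝ) (βbar : Fin d ⊕ Fin f → ℝ) :
    Matrix (Fin d ⊕ Fin f) (Fin d ⊕ Fin f) ℝ :=
  Matrix.of fun i j =>
    ∫ c, grad (fun β => Real.log (M.pb β (obs c))) βbar i *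
      grad (fun β => Real.log (M.pb β (obs c))) βbar j ∂(law μY μZ μA q)

/-- `K_{b,y} = E[∇ log p_b(b; β̄) ∇ᵀ log p_y(y; θ̄)]`. -/
def Kby (M : Model μY μZ μA d f) (q : Y × Z × A → ℝ) (βbar : Fin d ⊕ Fin f → ℝ) :
    Matrix (Fin d ⊕ Fin f) (Fin d ⊕ Fin f) ℝ :=
  Matrix.of fun i j =>
    ∫ c, grad (fun β => Real.log (M.pb β (obs c))) βbar i *
      grad (fun β => Real.log (M.py (theta β) c.1)) βbar j ∂(law μY μZ μA q)

/-- `I_x = -E[∇² log p_x(x; θ̄)]`, derivatives with respect to `β`. -/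
def Ix (M : Model μY μZ μA d f) (q : Y × Z × A → ℝ) (βbar : Fin d ⊕ Fin f → ℝ) :
    Matrix (Fin d ⊕ Fin f) (Fin d ⊕ Fin f) ℝ :=
  Matrix.of fun i j =>
    -∫ c, hess (fun β => Real.log (M.px (theta β) (prim c))) βbar i j ∂(law μY μZ μA q)

/-- `I_y = -E[∇² log p_y(y; θ̄)]`, derivatives with respect to `β`. -/
def Iy (M : Model μY μZ μA d f) (q : Y × Z × A → ℝ) (βbar : Fin d ⊕ Fin f → ℝ) :
    Matrix (Fin d ⊕ Fin f) (Fin d ⊕ Fin f) ℝ :=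
  Matrix.of fun i j =>
    -∫ c, hess (fun β => Real.log (M.py (theta β) c.1)) βbar i j ∂(law μY μZ μA q)

/-- `I_{z|y} = -E[∇² log p_{z|y}(z|y; θ̄)]`, derivatives with respect to `β`. -/
def Izy (M : Model μY μZ μA d f) (q : Y × Z × A → ℝ) (βbar : Fin d ⊕ Fin f → ℝ) :
    Matrix (Fin d ⊕ Fin f) (Fin d ⊕ Fin f) ℝ :=
  Matrix.of fun i j =>
    -∫ c, hess (fun β => Real.log (M.pzy (theta β) (prim c))) βbar i j ∂(law μY μZ μA q)

/-- The general criterion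
`-2n ℓ_y(θ̂) + 2 tr(I_b⁻¹ K_{b,y}) + tr(I_{z|y} I_b⁻¹ J_b I_b⁻¹)`. -/
def riskHat (M : Model μY μZ μA d f) (q : Y × Z × A → ℝ) (βbar : Fin d ⊕ Fin f → ℝ)
    {n : ℕ} (bs : Fin n → Y × A) (θ : Fin d → ℝ) : ℝ :=
  -2 * n * M.ellY bs θ + 2 * ((M.Ib q βbar)⁻¹ * M.Kby q βbar).trace
    + (M.Izy q βbar * (M.Ib q βbar)⁻¹ * M.Jb q βbar * (M.Ib q βbar)⁻¹).trace

/-- `AIC_{x;b} = -2n ℓ_y(θ̂) + tr(I_x I_b⁻¹) + tr(I_y I_b⁻¹)`. -/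
def aicXB (M : Model μY μZ μA d f) (q : Y × Z × A → ℝ) (βbar : Fin d ⊕ Fin f → ℝ)
    {n : ℕ} (bs : Fin n → Y × A) (θ : Fin d → ℝ) : ℝ :=
  -2 * n * M.ellY bs θ + (M.Ix q βbar * (M.Ib q βbar)⁻¹).trace
    + (M.Iy q βbar * (M.Ib q βbar)⁻¹).trace

end Model

/-- Regularity of a family `g(u; β)`, `β ∈ S`, of densities under the true law `Q` of `u`:
common support; `log g` continuous on `S` with an envelope in `L^r(Q)`; near `β̄`, `log g` twice
continuously differentiable, with an envelope in `L²(Q)` for the first and one in `L^r(Q)` for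
the second derivatives. -/
structure Regular {ι : Type} [Fintype ι] [DecidableEq ι] {U : Type*} [MeasurableSpace U]
    (S : Set (ι → ℝ)) (βbar : ι → ℝ) (Q : Measure U) (r : ENNReal)
    (g : (ι → ℝ) → U → ℝ) : Prop where
  support : ∀ u, ∀ β ∈ S, ∀ β' ∈ S, g β u = 0 → g β' u = 0
  continuousOn : ∀ u, ContinuousOn (fun β => Real.log (g β u)) S
  envelope : ∃ m : U → ℝ, MemLp m r Q ∧ ∀ u, ∀ β ∈ S, |Real.log (g β u)| ≤ m u
  smooth : ∃ N : Set (ι → ℝ), IsOpen N ∧ βbar ∈ N ∧ N ⊆ S ∧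
    (∀ u, ContDiffOn ℝ 2 (fun β => Real.log (g β u)) N) ∧
    (∃ m : U → ℝ, MemLp m 2 Q ∧ ∀ u, ∀ β ∈ N, ∀ i,
      |grad (fun β => Real.log (g β u)) β i| ≤ m u) ∧
    (∃ m : U → ℝ, MemLp m r Q ∧ ∀ u, ∀ β ∈ N, ∀ i j,
      |hess (fun β => Real.log (g β u)) β i j| ≤ m u)

/-- Near `β̄` the second derivatives of the densities `g(u; β)` in `β` have an envelope that is
integrable with respect to the reference measure `μ`. -/
def DominatedHess {ι : Type} [Fintype ι] [DecidableEq ι] {U : Type*} [MeasurableSpace U]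
    (βbar : ι → ℝ) (μ : Measure U) (g : (ι → ℝ) → U → ℝ) : Prop :=
  ∃ N : Set (ι → ℝ), IsOpen N ∧ βbar ∈ N ∧
    ∃ D : U → ℝ, Integrable D μ ∧ ∀ u, ∀ β ∈ N, ∀ i j, |hess (fun β => g β u) β i j| ≤ D u

/-- The standing regularity conditions on the model: compact parameter space, regular families
`p_b`, `p_y` and `p_x`, dominated second derivatives of `p_b`, and nonsingular `I_b`. -/
structure Model.IsRegular {Y Z A : Type*} [MeasurableSpace Y] [MeasurableSpace Z]
    [MeasurableSpace A] {μY : Measure Y} {μZ : Measure Z} {μA : Measure A} {d f : ℕ}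
    (M : Model μY μZ μA d f) (q : Y × Z × A → ℝ) (βbar : Fin d ⊕ Fin f → ℝ) : Prop where
  isCompact : IsCompact M.space
  regularB : Regular M.space βbar ((law μY μZ μA q).map obs) 2 M.pb
  regularY : Regular M.space βbar ((law μY μZ μA q).map Prod.fst) 2 fun β => M.py (theta β)
  regularX : Regular M.space βbar ((law μY μZ μA q).map prim) 1 fun β => M.px (theta β)
  dominated : DominatedHess βbar (μY.prod μA) M.pb
  nonsingular : IsUnit (M.Ib q βbar).det

end AuxIC

end

/-! Correct specification forces $q_c = p_c(\bar\beta)$ almost everywhere: by Gibbs' inequality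
$\beta_0$ maximizes $\int q_b \log p_b$, and $\bar\beta$ is the only maximizer
(`Model.IsOptimal.ae_eq`). The identities then hold for classical reasons. Second differences in
$\beta$ of a density integrate to zero; dividing by $t^2$ and letting $t \to 0$ gives $E[\nabla\log
p\,\nabla^\top\log p + \nabla^2\log p] = 0$ (`Regular.info_eq`), hence $J_b = I_b$, and the same for
$p_y$. The score of $Y$ is the conditional mean given $Y$ of the score of $B$
(`integral_score_section`), so $K_{b,y}$ is the second moment of the $Y$-score, which is $I_y$.
Together with $I_{z|y} = I_x - I_y$ this turns the general criterion into $\mathrm{AIC}_{x;b}$.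

For the bias, $C(q_x) = -\mathcal L_x(\bar\theta) - E\,\ell_y(\bar\theta)$, so the claim becomes $n
E[\ell_y(\hat\theta) - \ell_y(\bar\theta) + \mathcal L_x(\hat\theta) - \mathcal L_x(\bar\theta)] \to
\frac12 \mathrm{tr}((I_x + I_y) I_b^{-1})$. Let $s_b, s_y$ be the sample means of the scores at
$\bar\beta$. To leading order $\hat\beta - \bar\beta$ is $h = I_b^{-1} s_b$, and the bracket is
$s_y^\top h + \frac12 h^\top (I_x - I_y) h$; the loss has no linear term because $\bar\theta$
minimizes it. The expectation of this quadratic form times $n$ is the same for every $n \ge 1$: it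
is a combination of covariances of scores, equal to $\mathrm{tr}(I_y I_b^{-1}) +
\frac12\mathrm{tr}((I_x - I_y) I_b^{-1})$.

The difficulty is that expectations must converge under second moments only. The expansions hold off
exceptional events on which the bracket is merely controlled by an envelope, so these events must
have probability $o(1/n)$ (`Negligible`). Chebyshev's inequality gives only $O(1/n)$; the gain comes
from the uniform integrability of $n$ times a squared centred sample mean
(`IID.tendsto_setIntegral_sq`). Consistency at this rate is `Regular.negligible_argmax`, the uniform
expansion is `Regular.sampleMean_expansion`, the deterministic comparison of the estimator with $h$
is `exists_quadratic_comparison`, and `tendsto_mul_integral_increment` combines them. -/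

open MeasureTheory ProbabilityTheory Filter Topology

noncomputable section

namespace AuxIC

set_option linter.unusedSectionVars false

/-! ### Moments of sample means of i.i.d. observations -/

section Empirical

variable {Ω V : Type*} [MeasurableSpace Ω] [MeasurableSpace V]

/-- The random elements `X 0, X 1, …` are independent with common law `Q`. -/
structure IID (P : Measure Ω) (Q : Measure V) (X : ℕ → Ω → V) : Prop where
  measurable : ∀ i, Measurable (X i)
  indep : iIndepFun X P
  law : ∀ i, P.map (X i) = Q

/-- The sample mean of `φ` over the first `n` observations. -/
def sampleMean (X : ℕ → Ω → V) (φ : V → ℝ) (n : ℕ) (ω : Ω) : ℝ :=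
  (1 / n : ℝ) * ∑ i ∈ Finset.range n, φ (X i ω)

/-- Events of probability `o(1/n)`. -/
def Negligible (P : Measure Ω) (A : ℕ → Set Ω) : Prop :=
  Tendsto (fun n : ℕ => n * P.real (A n)) atTop (𝓝 0)

variable {P : Measure Ω} [IsProbabilityMeasure P] {Q : Measure V} {X : ℕ → Ω → V}

namespace IID

lemma measurePreserving (h : IID P Q X) (i : ℕ) : MeasurePreserving (X i) P Q :=
  ⟨h.measurable i, h.law i⟩

lemma isProbabilityMeasure (h : IID P Q X) : IsProbabilityMeasure Q := by
  rw [← h.law 0]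
  exact Measure.isProbabilityMeasure_map (h.measurable 0).aemeasurable

lemma integral_comp (h : IID P Q X) {φ : V → ℝ} (hφ : AEStronglyMeasurable φ Q) (i : ℕ) :
    ∫ ω, φ (X i ω) ∂P = ∫ v, φ v ∂Q := by
  rw [← h.law i, integral_map (h.measurable i).aemeasurable (by rwa [h.law i])]

lemma memLp_comp (h : IID P Q X) {φ : V → ℝ} {p : ENNReal} (hφ : MemLp φ p Q) (i : ℕ) :
    MemLp (fun ω => φ (X i ω)) p P :=
  hφ.comp_measurePreserving (h.measurePreserving i)

lemma memLp_sampleMean (h : IID P Q X) {φ : V → ℝ} {p : ENNReal} (hφ : MemLp φ p Q) (n : ℕ) :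
    MemLp (sampleMean X φ n) p P := by
  have h1 : MemLp (fun ω => ∑ i ∈ Finset.range n, φ (X i ω)) p P :=
    memLp_finsetSum _ fun i _ => h.memLp_comp hφ i
  exact h1.const_mul (1 / n : ℝ)

lemma integral_sampleMean (h : IID P Q X) {φ : V → ℝ} (hφ : Integrable φ Q) {n : ℕ} (hn : n ≠ 0) :
    ∫ ω, sampleMean X φ n ω ∂P = ∫ v, φ v ∂Q := by
  unfold sampleMean
  rw [integral_const_mul, integral_finsetSum _ fun i _ =>
    memLp_one_iff_integrable.1 (h.memLp_comp (memLp_one_iff_integrable.2 hφ) i)]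
  simp_rw [h.integral_comp hφ.1]
  simp
  field_simp

lemma sampleMean_congr (h : IID P Q X) {φ ψ : V → ℝ} (hφ : φ =ᵐ[Q] ψ) (n : ℕ) :
    sampleMean X φ n =ᵐ[P] sampleMean X ψ n := by
  have h1 : ∀ i, ∀ᵐ ω ∂P, φ (X i ω) = ψ (X i ω) := fun i =>
    (h.measurePreserving i).quasiMeasurePreserving.ae hφ
  filter_upwards [ae_all_iff.2 h1] with ω hω
  simp [sampleMean, hω]

/-- Off the diagonal independence factors the expectation, and one centred factor suffices to make
it vanish; `ψ` need not be centred. -/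
lemma integral_sum_mul_sum (h : IID P Q X) {φ ψ : V → ℝ} (mφ : Measurable φ) (mψ : Measurable ψ)
    (hφ : MemLp φ 2 Q) (hψ : MemLp ψ 2 Q) (h0 : ∫ v, φ v ∂Q = 0) (n : ℕ) :
    ∫ ω, (∑ i ∈ Finset.range n, φ (X i ω)) * (∑ i ∈ Finset.range n, ψ (X i ω)) ∂P =
      n * ∫ v, φ v * ψ v ∂Q := by
  have hint : ∀ i j, Integrable (fun ω => φ (X i ω) * ψ (X j ω)) P := fun i j =>
    (h.memLp_comp hφ i).integrable_mul (h.memLp_comp hψ j)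
  simp_rw [Finset.sum_mul_sum]
  rw [integral_finsetSum _ fun i _ => integrable_finsetSum _ fun j _ => hint i j]
  have : ∀ i ∈ Finset.range n,
      ∫ ω, ∑ j ∈ Finset.range n, φ (X i ω) * ψ (X j ω) ∂P = ∫ v, φ v * ψ v ∂Q := by
    intro i hi
    rw [integral_finsetSum _ fun j _ => hint i j, Finset.sum_eq_single_of_mem i hi]
    · exact h.integral_comp (φ := fun v => φ v * ψ v) (mφ.mul mψ).aestronglyMeasurable i
    · intro j _ hj
      have := ((h.indep.indepFun hj.symm).comp mφ mψ).integral_fun_mul_eq_mul_integral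
        (h.memLp_comp hφ i).1 (h.memLp_comp hψ j).1
      simp only [Function.comp_def] at this
      rw [this, h.integral_comp hφ.1, h0, zero_mul]
  rw [Finset.sum_congr rfl this]
  simp

/-- An exact identity for every nonempty sample. It is the source of the constants in the bias: no
limit theorem for the scores is needed. -/
lemma integral_sampleMean_mul (h : IID P Q X) {φ ψ : V → ℝ} (mφ : Measurable φ)
    (mψ : Measurable ψ) (hφ : MemLp φ 2 Q) (hψ : MemLp ψ 2 Q) (h0 : ∫ v, φ v ∂Q = 0)
    {n : ℕ} (hn : n ≠ 0) :
    n * ∫ ω, sampleMean X φ n ω * sampleMean X ψ n ω ∂P = ∫ v, φ v * ψ v ∂Q := by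
  have : ∀ ω, sampleMean X φ n ω * sampleMean X ψ n ω = (1 / n : ℝ) ^ 2 *
      ((∑ i ∈ Finset.range n, φ (X i ω)) * (∑ i ∈ Finset.range n, ψ (X i ω))) := by
    intro ω; unfold sampleMean; ring
  simp_rw [this]
  rw [integral_const_mul, h.integral_sum_mul_sum mφ mψ hφ hψ h0]
  field_simp

/-- Induction on `n`, expanding the fourth power of the partial sum plus the next term: the two
summands containing a first power have mean zero, and the square-times-square summand contributes at
most `6 n K ^ 4`. -/
lemma integral_sum_pow_four_le (h : IID P Q X) {φ : V → ℝ} (mφ : Measurable φ) {K : ℝ}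
    (hK : ∀ v, |φ v| ≤ K) (h0 : ∫ v, φ v ∂Q = 0) (n : ℕ) :
    ∫ ω, (∑ i ∈ Finset.range n, φ (X i ω)) ^ 4 ∂P ≤ 3 * K ^ 4 * n ^ 2 := by
  have := h.isProbabilityMeasure
  have hK0 : 0 ≤ K := by
    obtain ⟨v⟩ := nonempty_of_isProbabilityMeasure Q
    exact (abs_nonneg _).trans (hK v)
  have hφ : MemLp φ 2 Q := MemLp.of_bound mφ.aestronglyMeasurable K (ae_of_all _ hK)
  have msum : ∀ n, Measurable fun ω => ∑ i ∈ Finset.range n, φ (X i ω) := fun n =>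
    Finset.measurable_fun_sum _ fun i _ => mφ.comp (h.measurable i)
  have bsum : ∀ n ω, |∑ i ∈ Finset.range n, φ (X i ω)| ≤ n * K := by
    intro n ω
    refine (Finset.abs_sum_le_sum_abs _ _).trans ((Finset.sum_le_sum fun i _ => hK _).trans ?_)
    simp
  have hint : ∀ n a b, Integrable
      (fun ω => (∑ i ∈ Finset.range n, φ (X i ω)) ^ a * φ (X n ω) ^ b) P := by
    intro n a b
    refine Integrable.of_bound (C := (n * K) ^ a * K ^ b)
      (((msum n).pow_const a).mul ((mφ.comp (h.measurable n)).pow_const b)).aestronglyMeasurable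
      (ae_of_all _ fun ω => ?_)
    rw [Real.norm_eq_abs, abs_mul, abs_pow, abs_pow]
    have := bsum n ω
    have := hK (X n ω)
    gcongr
  have hprod : ∀ n a b, ∫ ω, (∑ i ∈ Finset.range n, φ (X i ω)) ^ a * φ (X n ω) ^ b ∂P =
      (∫ ω, (∑ i ∈ Finset.range n, φ (X i ω)) ^ a ∂P) * ∫ v, φ v ^ b ∂Q := by
    intro n a b
    have hi : IndepFun (fun ω => ∑ i ∈ Finset.range n, φ (X i ω)) (fun ω => φ (X n ω)) P := by
      have := (h.indep.comp (fun _ => φ) fun _ => mφ).indepFun_finsetSum_of_notMem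
        (fun i => mφ.comp (h.measurable i)) (s := Finset.range n) (i := n) (by simp)
      convert this using 1
      · ext ω
        simp only [Finset.sum_apply, Function.comp_apply]
      · rfl
    have := (hi.comp (measurable_id.pow_const a) (measurable_id.pow_const b)
      ).integral_fun_mul_eq_mul_integral ((msum n).pow_const a).aestronglyMeasurable
        ((mφ.comp (h.measurable n)).pow_const b).aestronglyMeasurable
    simp only [Function.comp_def, id] at this
    rw [this]
    congr 1
    exact h.integral_comp (φ := fun v => φ v ^ b) (mφ.pow_const b).aestronglyMeasurable n
  have hmom : ∀ b, ∫ v, φ v ^ b ∂Q ≤ K ^ b := by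
    intro b
    have : ∫ v, φ v ^ b ∂Q ≤ ∫ v, K ^ b ∂Q := by
      refine integral_mono (Integrable.of_bound (C := K ^ b) (mφ.pow_const b).aestronglyMeasurable
        (ae_of_all _ fun v => ?_)) (integrable_const _) fun v => ?_
      · rw [Real.norm_eq_abs, abs_pow]
        exact pow_le_pow_left₀ (abs_nonneg _) (hK v) b
      · refine (le_abs_self _).trans ?_
        rw [abs_pow]
        exact pow_le_pow_left₀ (abs_nonneg _) (hK v) b
    simpa using this
  have hs1 : ∀ n, ∫ ω, (∑ i ∈ Finset.range n, φ (X i ω)) ∂P = 0 := by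
    intro n
    rw [integral_finsetSum _ fun i _ =>
      (h.memLp_comp hφ i).integrable (by norm_num)]
    simp [h.integral_comp hφ.1, h0]
  induction n with
  | zero => simp
  | succ n ih =>
    -- The exponents 0 and 1 are kept so that all five summands are instances of `hint` and `hprod`.
    have hexp : ∀ ω, (∑ i ∈ Finset.range (n + 1), φ (X i ω)) ^ 4 =
        (∑ i ∈ Finset.range n, φ (X i ω)) ^ 4 * φ (X n ω) ^ 0
        + 4 * ((∑ i ∈ Finset.range n, φ (X i ω)) ^ 3 * φ (X n ω) ^ 1)
        + 6 * ((∑ i ∈ Finset.range n, φ (X i ω)) ^ 2 * φ (X n ω) ^ 2)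
        + 4 * ((∑ i ∈ Finset.range n, φ (X i ω)) ^ 1 * φ (X n ω) ^ 3)
        + (∑ i ∈ Finset.range n, φ (X i ω)) ^ 0 * φ (X n ω) ^ 4 := by
      intro ω; rw [Finset.sum_range_succ]; ring
    simp_rw [hexp]
    have I := hint n
    rw [integral_add, integral_add, integral_add, integral_add]
    rotate_left
    · exact I 4 0
    · exact (I 3 1).const_mul 4
    · exact (I 4 0).add ((I 3 1).const_mul 4)
    · exact (I 2 2).const_mul 6
    · exact ((I 4 0).add ((I 3 1).const_mul 4)).add ((I 2 2).const_mul 6)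
    · exact (I 1 3).const_mul 4
    · exact (((I 4 0).add ((I 3 1).const_mul 4)).add ((I 2 2).const_mul 6)).add
        ((I 1 3).const_mul 4)
    · exact I 0 4
    simp_rw [integral_const_mul, hprod]
    have h2 : ∫ ω, (∑ i ∈ Finset.range n, φ (X i ω)) ^ 2 ∂P = n * ∫ v, φ v ^ 2 ∂Q := by
      have := h.integral_sum_mul_sum mφ mφ hφ hφ h0 n
      simpa [sq] using this
    simp only [pow_one, hs1, h0, h2, pow_zero, integral_const, probReal_univ, smul_eq_mul]
    have h2' : 0 ≤ ∫ v, φ v ^ 2 ∂Q := integral_nonneg fun v => sq_nonneg _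
    have h4 := hmom 4
    have h22 : (∫ v, φ v ^ 2 ∂Q) * ∫ v, φ v ^ 2 ∂Q ≤ K ^ 2 * K ^ 2 :=
      mul_le_mul (hmom 2) (hmom 2) h2' (by positivity)
    have h22' : (n : ℝ) * ((∫ v, φ v ^ 2 ∂Q) * ∫ v, φ v ^ 2 ∂Q) ≤ n * (K ^ 2 * K ^ 2) := by
      gcongr
    -- The induction closes because `3 n ^ 2 + 6 n + 1 ≤ 3 (n + 1) ^ 2`.
    push_cast
    have : 0 ≤ K ^ 4 := by positivity
    nlinarith

end IID

end Empirical

/-! ### Uniform integrability and events of probability o(1/n) -/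

section Negligible

variable {Ω V : Type*} [MeasurableSpace Ω] [MeasurableSpace V]
variable {P : Measure Ω} [IsProbabilityMeasure P] {Q : Measure V} {X : ℕ → Ω → V}

/-- Truncation: the tail of `φ` above a level has small second moment by dominated convergence. It
makes fourth moments available for the bounded part while the rest has small variance. -/
lemma exists_bounded_add_small {Q : Measure V} [IsProbabilityMeasure Q] {φ : V → ℝ}
    (mφ : Measurable φ) (hφ : MemLp φ 2 Q) (h0 : ∫ v, φ v ∂Q = 0) {ε : ℝ} (hε : 0 < ε) :
    ∃ ψ χ : V → ℝ, ∃ K : ℝ, (∀ v, φ v = ψ v + χ v) ∧ Measurable ψ ∧ Measurable χ ∧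
      (∀ v, |ψ v| ≤ K) ∧ MemLp χ 2 Q ∧ ∫ v, ψ v ∂Q = 0 ∧ ∫ v, χ v ∂Q = 0 ∧
      ∫ v, χ v ^ 2 ∂Q ≤ ε := by
  have mset : ∀ k : ℕ, MeasurableSet {v | (k : ℝ) < |φ v|} := fun k =>
    measurableSet_lt measurable_const (measurable_norm.comp mφ)
  set u : ℕ → V → ℝ := fun k => {v | (k : ℝ) < |φ v|}.indicator φ with hu
  have mu : ∀ k, Measurable (u k) := fun k => mφ.indicator (mset k)
  have lu : ∀ k, MemLp (u k) 2 Q := fun k => hφ.indicator (mset k)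
  have lim : Tendsto (fun k => ∫ v, u k v ^ 2 ∂Q) atTop (𝓝 (∫ _, (0 : ℝ) ∂Q)) := by
    refine tendsto_integral_of_dominated_convergence (fun v => φ v ^ 2)
      (fun k => ((mu k).pow_const 2).aestronglyMeasurable) hφ.integrable_sq
      (fun k => ae_of_all _ fun v => ?_) (ae_of_all _ fun v => ?_)
    · by_cases hv : (k : ℝ) < |φ v| <;> simp [hu, hv, sq_nonneg]
    · obtain ⟨N, hN⟩ := exists_nat_ge |φ v|
      refine tendsto_const_nhds.congr' ?_
      filter_upwards [eventually_ge_atTop N] with k hk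
      have : ¬ (k : ℝ) < |φ v| := not_lt.2 (hN.trans (by exact_mod_cast hk))
      simp [hu, this]
  rw [integral_zero] at lim
  obtain ⟨k, hk⟩ := (lim.eventually (gt_mem_nhds hε)).exists
  set c := ∫ v, u k v ∂Q with hc
  have iu : Integrable (u k) Q := (lu k).integrable (by norm_num)
  have iφ : Integrable φ Q := hφ.integrable (by norm_num)
  -- Shifting both pieces by the mean `c` of the tail centres them; this raises the bound from `k`
  -- to `k + |c|` and can only lower the second moment of the tail.
  refine ⟨fun v => φ v - u k v + c, fun v => u k v - c, k + |c|, fun v => by ring,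
    (mφ.sub (mu k)).add_const c, (mu k).sub_const c, fun v => ?_,
    (lu k).sub (memLp_const c), ?_, ?_, ?_⟩
  · refine (abs_add_le _ _).trans (add_le_add_left ?_ _)
    by_cases hv : (k : ℝ) < |φ v|
    · simp [hu, hv]
    · have hv' : u k v = 0 := by simp [hu, hv]
      rw [hv', sub_zero]
      exact not_lt.1 hv
  · change ∫ v, (φ v - u k v) + c ∂Q = 0
    rw [integral_add (f := fun v => φ v - u k v) (iφ.sub iu) (integrable_const c),
      integral_sub iφ iu]
    simp [h0, ← hc]
  · rw [integral_sub iu (integrable_const c)]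
    simp [← hc]
  · have h1 := variance_le_expectation_sq (μ := Q) (mu k).aestronglyMeasurable
    rw [variance_eq_integral (mu k).aemeasurable] at h1
    exact h1.trans hk.le

/-- Uniform integrability of `n` times the squared mean. The bounded part has bounded scaled fourth
moment, the remaining part has uniformly small scaled second moment. -/
lemma IID.tendsto_setIntegral_sq (h : IID P Q X) {φ : V → ℝ} (mφ : Measurable φ)
    (hφ : MemLp φ 2 Q) (h0 : ∫ v, φ v ∂Q = 0) {A : ℕ → Set Ω} (mA : ∀ n, MeasurableSet (A n))
    (hA : Tendsto (fun n => P.real (A n)) atTop (𝓝 0)) :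
    Tendsto (fun n : ℕ => n * ∫ ω in A n, sampleMean X φ n ω ^ 2 ∂P) atTop (𝓝 0) := by
  have := h.isProbabilityMeasure
  rw [Metric.tendsto_atTop]
  intro ε hε
  obtain ⟨ψ, χ, K, hsum, mψ, mχ, hK, lχ, ψ0, χ0, hχ⟩ :=
    exists_bounded_add_small mφ hφ h0 (ε := ε / 8) (by positivity)
  have lψ : ∀ p, MemLp ψ p Q := fun p => MemLp.of_bound mψ.aestronglyMeasurable K (ae_of_all _ hK)
  -- With this level the fourth-moment term `2 / T * (3 * K ^ 4)` is at most `ε / 4`. The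
  -- small-variance term is at most `ε / 4`, and so, for large `n`, is `2 * T * P.real (A n)`.
  set T : ℝ := 24 * (K ^ 4 + 1) / ε with hT
  have hT0 : 0 < T := by positivity
  have hA' : Tendsto (fun n => 2 * T * P.real (A n)) atTop (𝓝 0) := by
    simpa using hA.const_mul (2 * T)
  obtain ⟨N, hN⟩ := Metric.tendsto_atTop.1 hA' (ε / 4) (by positivity)
  refine ⟨max N 1, fun n hn => ?_⟩
  have hn0 : n ≠ 0 := by have := le_of_max_le_right hn; omega
  have hnpos : (0 : ℝ) < n := by positivity
  have hbound : ∀ ω, n * sampleMean X φ n ω ^ 2 ≤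
      2 * T + 2 / T * (n ^ 2 * sampleMean X ψ n ω ^ 4) + 2 * (n * sampleMean X χ n ω ^ 2) := by
    intro ω
    have e : sampleMean X φ n ω = sampleMean X ψ n ω + sampleMean X χ n ω := by
      simp only [sampleMean, hsum, Finset.sum_add_distrib]
      ring
    rw [e]
    set a := sampleMean X ψ n ω
    set b := sampleMean X χ n ω
    -- For `x = n a ^ 2 ≥ 0`, the inequality `(x - T) ^ 2 / T ≥ 0` gives `2 x ≤ T + x ^ 2 / T`.
    have h1 : n * a ^ 2 ≤ T + 1 / T * (n ^ 2 * a ^ 4) := by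
      have h2 : 0 ≤ (n * a ^ 2 - T) ^ 2 / T := by positivity
      have h3 : (n * a ^ 2 - T) ^ 2 / T = 1 / T * (n ^ 2 * a ^ 4) - 2 * (n * a ^ 2) + T := by
        field_simp
        ring
      have : 0 ≤ n * a ^ 2 := by positivity
      linarith
    have h2 : 0 ≤ n * (a - b) ^ 2 := by positivity
    have e2 : 2 / T * (n ^ 2 * a ^ 4) = 2 * (1 / T * (n ^ 2 * a ^ 4)) := by ring
    rw [e2]
    nlinarith
  have hbound' : ∀ ω, (A n).indicator (fun ω => n * sampleMean X φ n ω ^ 2) ω ≤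
      (A n).indicator (fun _ => 2 * T) ω + 2 / T * (n ^ 2 * sampleMean X ψ n ω ^ 4)
        + 2 * (n * sampleMean X χ n ω ^ 2) := by
    intro ω
    have := hbound ω
    by_cases hω : ω ∈ A n
    · simpa [hω] using this
    · simp only [hω, not_false_eq_true, Set.indicator_of_notMem, zero_add]
      positivity
  have mψn : Measurable (sampleMean X ψ n) := (Finset.measurable_fun_sum _ fun i _ =>
    mψ.comp (h.measurable i)).const_mul _
  have i4 : Integrable (fun ω => 2 / T * (n ^ 2 * sampleMean X ψ n ω ^ 4)) P := by
    refine Integrable.const_mul (Integrable.const_mul ?_ _) _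
    refine Integrable.of_bound (C := K ^ 4) (mψn.pow_const 4).aestronglyMeasurable
      (ae_of_all _ fun ω => ?_)
    rw [Real.norm_eq_abs, abs_pow]
    refine pow_le_pow_left₀ (abs_nonneg _) ?_ 4
    rw [sampleMean, abs_mul, abs_of_nonneg (by positivity : (0 : ℝ) ≤ 1 / n)]
    refine (mul_le_mul_of_nonneg_left ((Finset.abs_sum_le_sum_abs _ _).trans
      (Finset.sum_le_sum fun i _ => hK _)) (by positivity)).trans ?_
    simp
    field_simp
    exact le_refl _
  have i2 : Integrable (fun ω => 2 * (n * sampleMean X χ n ω ^ 2)) P :=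
    ((h.memLp_sampleMean lχ n).integrable_sq.const_mul _).const_mul _
  have i2' : Integrable (fun ω => n * sampleMean X φ n ω ^ 2) P :=
    (h.memLp_sampleMean hφ n).integrable_sq.const_mul _
  have iA : Integrable ((A n).indicator fun _ => 2 * T) P :=
    (integrable_const _).indicator (mA n)
  have key := integral_mono (i2'.indicator (mA n)) ((iA.add i4).add i2) hbound'
  have e4 : ∫ ω, sampleMean X ψ n ω ^ 4 ∂P =
      (1 / n : ℝ) ^ 4 * ∫ ω, (∑ i ∈ Finset.range n, ψ (X i ω)) ^ 4 ∂P := by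
    simp only [sampleMean, mul_pow]
    rw [integral_const_mul]
  have e2 : n * ∫ ω, sampleMean X χ n ω ^ 2 ∂P = ∫ v, χ v ^ 2 ∂Q := by
    have := h.integral_sampleMean_mul mχ mχ lχ lχ χ0 hn0
    simpa [sq] using this
  have b4 : n ^ 2 * ∫ ω, sampleMean X ψ n ω ^ 4 ∂P ≤ 3 * K ^ 4 := by
    rw [e4]
    have := h.integral_sum_pow_four_le mψ hK ψ0 n
    calc (n : ℝ) ^ 2 * ((1 / n : ℝ) ^ 4 * ∫ ω, (∑ i ∈ Finset.range n, ψ (X i ω)) ^ 4 ∂P)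
        ≤ (n : ℝ) ^ 2 * ((1 / n : ℝ) ^ 4 * (3 * K ^ 4 * n ^ 2)) := by gcongr
      _ = 3 * K ^ 4 := by field_simp
  rw [integral_indicator (mA n), integral_const_mul] at key
  have rhs : ∫ ω, ((A n).indicator (fun _ => 2 * T) ω +
      2 / T * (n ^ 2 * sampleMean X ψ n ω ^ 4) + 2 * (n * sampleMean X χ n ω ^ 2)) ∂P =
      2 * T * P.real (A n) + 2 / T * (n ^ 2 * ∫ ω, sampleMean X ψ n ω ^ 4 ∂P)
        + 2 * (n * ∫ ω, sampleMean X χ n ω ^ 2 ∂P) := by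
    rw [integral_add, integral_add, integral_indicator (mA n)]
    rotate_left
    · exact iA
    · exact i4
    · exact iA.add i4
    · exact i2
    simp only [integral_const_mul, setIntegral_const, smul_eq_mul]
    ring
  have key2 := key.trans_eq rhs
  rw [e2] at key2
  have b4' : 2 / T * (n ^ 2 * ∫ ω, sampleMean X ψ n ω ^ 4 ∂P) ≤ ε / 4 := by
    calc 2 / T * (n ^ 2 * ∫ ω, sampleMean X ψ n ω ^ 4 ∂P) ≤ 2 / T * (3 * K ^ 4) := by gcongr
      _ ≤ 2 / T * (3 * (K ^ 4 + 1)) := by gcongr; linarith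
      _ = ε / 4 := by
        rw [hT]
        field_simp
        norm_num
  have hN' := hN n (le_of_max_le_left hn)
  rw [Real.dist_eq, sub_zero] at hN' ⊢
  have hN'' := (le_abs_self _).trans_lt hN'
  rw [abs_of_nonneg (mul_nonneg hnpos.le (integral_nonneg fun ω => sq_nonneg _))]
  linarith

lemma Negligible.mono {A B : ℕ → Set Ω} (hB : Negligible P B) (hAB : ∀ n, A n ⊆ B n) :
    Negligible P A := by
  refine squeeze_zero (fun n => by positivity) (fun n => ?_) hB
  exact mul_le_mul_of_nonneg_left (measureReal_mono (hAB n)) (Nat.cast_nonneg n)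

lemma Negligible.union {A B : ℕ → Set Ω} (hA : Negligible P A) (hB : Negligible P B) :
    Negligible P fun n => A n ∪ B n := by
  refine squeeze_zero (fun n => by positivity) (fun n => ?_) (by simpa using hA.add hB)
  rw [← mul_add]
  exact mul_le_mul_of_nonneg_left (measureReal_union_le _ _) (Nat.cast_nonneg n)

lemma Negligible.empty : Negligible P fun _ => (∅ : Set Ω) := by
  simp [Negligible]

lemma Negligible.biUnion {κ : Type*} (s : Finset κ) {A : κ → ℕ → Set Ω}
    (hA : ∀ k ∈ s, Negligible P (A k)) : Negligible P fun n => ⋃ k ∈ s, A k n := by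
  classical
  induction s using Finset.induction_on with
  | empty => simpa using Negligible.empty
  | insert a s _ ih =>
    simp only [Finset.set_biUnion_insert]
    exact (hA a (by simp)).union (ih fun k hk => hA k (by simp [hk]))

lemma Negligible.iUnion {κ : Type*} [Fintype κ] {A : κ → ℕ → Set Ω}
    (hA : ∀ k, Negligible P (A k)) : Negligible P fun n => ⋃ k, A k n := by
  have := Negligible.biUnion Finset.univ (A := A) fun k _ => hA k
  simpa using this

/-- Exceptional events are built with unions and inclusions without regard to measurability; a
measurable hull of the same measure is taken before integrating over them. -/
lemma Negligible.exists_measurable {A : ℕ → Set Ω} (hA : Negligible P A) :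
    ∃ B : ℕ → Set Ω, (∀ n, MeasurableSet (B n)) ∧ (∀ n, A n ⊆ B n) ∧ Negligible P B := by
  refine ⟨fun n => toMeasurable P (A n), fun n => measurableSet_toMeasurable _ _,
    fun n => subset_toMeasurable _ _, ?_⟩
  simpa [Negligible, measureReal_def, measure_toMeasurable] using hA

lemma Negligible.tendsto_zero {A : ℕ → Set Ω} (hA : Negligible P A) :
    Tendsto (fun n => P.real (A n)) atTop (𝓝 0) := by
  refine squeeze_zero' (Eventually.of_forall fun n => measureReal_nonneg) ?_ hA
  filter_upwards [eventually_ge_atTop 1] with n hn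
  have : (1 : ℝ) ≤ n := by exact_mod_cast hn
  nlinarith [measureReal_nonneg (μ := P) (s := A n)]

/-- Chebyshev's inequality is used twice. The first use gives probability `O(1/n)`, hence
convergence to zero; the second keeps the integral restricted to the event, where uniform
integrability makes the scaled second moment vanish. -/
lemma IID.negligible_sampleMean (h : IID P Q X) {φ : V → ℝ} (mφ : Measurable φ)
    (hφ : MemLp φ 2 Q) {κ : ℝ} (hκ : 0 < κ) :
    Negligible P fun n => {ω | κ ≤ |sampleMean X φ n ω - ∫ v, φ v ∂Q|} := by
  have := h.isProbabilityMeasure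
  set c := ∫ v, φ v ∂Q with hc
  set ψ : V → ℝ := fun v => φ v - c with hψ
  have mψ : Measurable ψ := mφ.sub_const c
  have lψ : MemLp ψ 2 Q := hφ.sub (memLp_const c)
  have ψ0 : ∫ v, ψ v ∂Q = 0 := by
    rw [hψ, integral_sub (hφ.integrable (by norm_num)) (integrable_const c)]
    simp [← hc]
  set A : ℕ → Set Ω := fun n => {ω | κ ≤ |sampleMean X ψ n ω|} with hA
  have mψn : ∀ n, Measurable (sampleMean X ψ n) := fun n => (Finset.measurable_fun_sum _ fun i _ =>
    mψ.comp (h.measurable i)).const_mul _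
  have mA : ∀ n, MeasurableSet (A n) := fun n =>
    measurableSet_le measurable_const (measurable_norm.comp (mψn n))
  have isq : ∀ n, Integrable (fun ω => sampleMean X ψ n ω ^ 2) P := fun n =>
    (h.memLp_sampleMean lψ n).integrable_sq
  have cheb : ∀ n, κ ^ 2 * P.real (A n) ≤ ∫ ω in A n, sampleMean X ψ n ω ^ 2 ∂P := by
    intro n
    have := setIntegral_mono_on (μ := P) (s := A n) (f := fun _ => κ ^ 2)
      (g := fun ω => sampleMean X ψ n ω ^ 2) (by simp) (isq n).integrableOn (mA n)
      fun ω hω => by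
        rw [← sq_abs (sampleMean X ψ n ω)]
        exact pow_le_pow_left₀ hκ.le hω 2
    simpa [mul_comm] using this
  have lim0 : Tendsto (fun n => P.real (A n)) atTop (𝓝 0) := by
    have l1 : Tendsto (fun n : ℕ => (∫ v, ψ v ^ 2 ∂Q) / κ ^ 2 / n) atTop (𝓝 0) :=
      tendsto_const_div_atTop_nhds_zero_nat _
    refine squeeze_zero' (Eventually.of_forall fun n => measureReal_nonneg) ?_ l1
    filter_upwards [eventually_ne_atTop 0] with n hn
    have e2 : n * ∫ ω, sampleMean X ψ n ω ^ 2 ∂P = ∫ v, ψ v ^ 2 ∂Q := by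
      have := h.integral_sampleMean_mul mψ mψ lψ lψ ψ0 hn
      simpa [sq] using this
    have h1 : ∫ ω in A n, sampleMean X ψ n ω ^ 2 ∂P ≤ ∫ ω, sampleMean X ψ n ω ^ 2 ∂P :=
      setIntegral_le_integral (isq n) (ae_of_all _ fun ω => sq_nonneg _)
    have hnpos : (0 : ℝ) < n := by positivity
    rw [le_div_iff₀ hnpos, le_div_iff₀ (by positivity), ← e2]
    have := (cheb n).trans h1
    nlinarith
  have hNeg : Negligible P A := by
    have l2 := (h.tendsto_setIntegral_sq mψ lψ ψ0 mA lim0).const_mul (1 / κ ^ 2)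
    rw [mul_zero] at l2
    refine squeeze_zero (fun n => by positivity) (fun n => ?_) l2
    have := cheb n
    calc n * P.real (A n) = 1 / κ ^ 2 * (n * (κ ^ 2 * P.real (A n))) := by field_simp
      _ ≤ _ := by gcongr
  -- The empty sample mean is 0, so centring commutes with averaging only for `n ≠ 0`.
  have hmean : ∀ n, n ≠ 0 → ∀ ω, sampleMean X ψ n ω = sampleMean X φ n ω - c := by
    intro n hn ω
    simp only [sampleMean, hψ, Finset.sum_sub_distrib]
    simp
    field_simp
  refine Tendsto.congr' ?_ hNeg
  filter_upwards [eventually_ne_atTop 0] with n hn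
  simp only [hA, hmean n hn]

/-- Without centring, the absolute mean is at most a constant plus the squared centred mean: the
constant is handled by `n * P.real (A n) → 0`, the square by uniform integrability. -/
lemma IID.tendsto_setIntegral_abs (h : IID P Q X) {φ : V → ℝ} (mφ : Measurable φ)
    (hφ : MemLp φ 2 Q) {A : ℕ → Set Ω} (mA : ∀ n, MeasurableSet (A n)) (hA : Negligible P A) :
    Tendsto (fun n : ℕ => n * ∫ ω in A n, |sampleMean X φ n ω| ∂P) atTop (𝓝 0) := by
  have := h.isProbabilityMeasure
  set c := ∫ v, φ v ∂Q with hc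
  set ψ : V → ℝ := fun v => φ v - c with hψ
  have mψ : Measurable ψ := mφ.sub_const c
  have lψ : MemLp ψ 2 Q := hφ.sub (memLp_const c)
  have ψ0 : ∫ v, ψ v ∂Q = 0 := by
    rw [hψ, integral_sub (hφ.integrable (by norm_num)) (integrable_const c)]
    simp [← hc]
  have l1 := (hA.const_mul (|c| + 1)).add
    (h.tendsto_setIntegral_sq mψ lψ ψ0 mA hA.tendsto_zero)
  rw [mul_zero, add_zero] at l1
  refine squeeze_zero' (Eventually.of_forall fun n => by positivity) ?_ l1
  filter_upwards [eventually_ne_atTop 0] with n hn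
  have isq : Integrable (fun ω => sampleMean X ψ n ω ^ 2) P :=
    (h.memLp_sampleMean lψ n).integrable_sq
  have iabs : Integrable (fun ω => |sampleMean X φ n ω|) P :=
    ((h.memLp_sampleMean hφ n).integrable (by norm_num)).abs
  have hmono : ∫ ω in A n, |sampleMean X φ n ω| ∂P ≤
      ∫ ω in A n, ((|c| + 1) + sampleMean X ψ n ω ^ 2) ∂P := by
    refine integral_mono iabs.integrableOn ((integrable_const _).add isq.integrableOn) fun ω => ?_
    have hmean : sampleMean X φ n ω = sampleMean X ψ n ω + c := by
      simp only [sampleMean, hψ, Finset.sum_sub_distrib]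
      simp
      field_simp
      ring
    simp only [hmean]
    have h1 := abs_add_le (sampleMean X ψ n ω) c
    have h2 : |sampleMean X ψ n ω| ≤ 1 + sampleMean X ψ n ω ^ 2 := by
      rw [← sq_abs]
      nlinarith [sq_nonneg (|sampleMean X ψ n ω| - 1), abs_nonneg (sampleMean X ψ n ω)]
    linarith
  rw [integral_add (integrable_const _) isq.integrableOn] at hmono
  simp only [setIntegral_const, smul_eq_mul] at hmono
  have := mul_le_mul_of_nonneg_left hmono (Nat.cast_nonneg (α := ℝ) n)
  linarith

end Negligible

/-! ### Taylor's formula and measurability of derivatives -/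

section Calculus

open Matrix

variable {ι : Type} [Fintype ι] [DecidableEq ι]

lemma fderiv_apply_eq_grad_dotProduct (F : (ι → ℝ) → ℝ) (β δ : ι → ℝ) :
    fderiv ℝ F β δ = grad F β ⬝ᵥ δ := by
  conv_lhs => rw [pi_eq_sum_univ' δ]
  simp [grad, dotProduct, map_sum, mul_comm]

lemma differentiableAt_of_contDiffOn_two {F : (ι → ℝ) → ℝ} {N : Set (ι → ℝ)} (hN : IsOpen N)
    (hF : ContDiffOn ℝ 2 F N) {β : ι → ℝ} (hβ : β ∈ N) : DifferentiableAt ℝ F β :=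
  (hF.contDiffAt (hN.mem_nhds hβ)).differentiableAt (by norm_num)

lemma contDiffOn_grad {F : (ι → ℝ) → ℝ} {N : Set (ι → ℝ)} (hN : IsOpen N)
    (hF : ContDiffOn ℝ 2 F N) (j : ι) : ContDiffOn ℝ 1 (fun b => grad F b j) N :=
  (hF.fderiv_of_isOpen hN (m := 1) (by norm_num)).clm_apply contDiffOn_const

lemma continuousOn_hess {F : (ι → ℝ) → ℝ} {N : Set (ι → ℝ)} (hN : IsOpen N)
    (hF : ContDiffOn ℝ 2 F N) (i j : ι) : ContinuousOn (fun b => hess F b i j) N :=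
  ((contDiffOn_grad hN hF j).continuousOn_fderiv_of_isOpen hN le_rfl).clm_apply continuousOn_const

lemma hess_isSymm {F : (ι → ℝ) → ℝ} {N : Set (ι → ℝ)} (hN : IsOpen N)
    (hF : ContDiffOn ℝ 2 F N) {β : ι → ℝ} (hβ : β ∈ N) : (hess F β).IsSymm := by
  have h1 : DifferentiableAt ℝ (fderiv ℝ F) β :=
    ((hF.fderiv_of_isOpen hN (m := 1) (by norm_num)).contDiffAt (hN.mem_nhds hβ)).differentiableAt
      (by norm_num)
  have h2 : ∀ i j, hess F β i j = fderiv ℝ (fderiv ℝ F) β (Pi.single i 1) (Pi.single j 1) := by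
    intro i j
    simp only [hess, grad, Matrix.of_apply]
    rw [fderiv_clm_apply h1 (differentiableAt_const _)]
    simp
  have h3 := (hF.contDiffAt (hN.mem_nhds hβ)).isSymmSndFDerivAt (by simp)
  ext i j
  rw [transpose_apply, h2, h2]
  exact h3 _ _

/-- Taylor's formula of second order with Lagrange remainder. -/
lemma exists_taylor_two {F : (ι → ℝ) → ℝ} {β δ : ι → ℝ} {ρ : ℝ}
    (hF : ContDiffOn ℝ 2 F (Metric.ball β ρ)) (hδ : ‖δ‖ < ρ) :
    ∃ ξ ∈ Metric.ball β ρ, F (β + δ) - F β - grad F β ⬝ᵥ δ =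
      1 / 2 * (δ ⬝ᵥ (hess F ξ *ᵥ δ)) := by
  have hopen : IsOpen (Metric.ball β ρ) := Metric.isOpen_ball
  have hmem : ∀ t ∈ Set.Icc (0 : ℝ) 1, β + t • δ ∈ Metric.ball β ρ := by
    intro t ht
    rw [mem_ball_iff_norm, add_sub_cancel_left, norm_smul, Real.norm_of_nonneg ht.1]
    exact (mul_le_of_le_one_left (norm_nonneg _) ht.2).trans_lt hδ
  have hline : ∀ t : ℝ, HasDerivAt (fun t : ℝ => β + t • δ) δ t := by
    intro t
    simpa using ((hasDerivAt_id t).smul_const δ).const_add β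
  have h1 : ∀ t ∈ Set.Icc (0 : ℝ) 1,
      HasDerivAt (fun t : ℝ => F (β + t • δ)) (grad F (β + t • δ) ⬝ᵥ δ) t := by
    intro t ht
    rw [← fderiv_apply_eq_grad_dotProduct]
    exact (differentiableAt_of_contDiffOn_two hopen hF (hmem t ht)).hasFDerivAt.comp_hasDerivAt t
      (hline t)
  have h2 : ∀ t ∈ Set.Icc (0 : ℝ) 1, HasDerivAt (fun t : ℝ => grad F (β + t • δ) ⬝ᵥ δ)
      (δ ⬝ᵥ (hess F (β + t • δ) *ᵥ δ)) t := by
    intro t ht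
    have hj : ∀ j, HasDerivAt (fun t : ℝ => grad F (β + t • δ) j)
        ((δ ᵥ* hess F (β + t • δ)) j) t := by
      intro j
      have hd : DifferentiableAt ℝ (fun b => grad F b j) (β + t • δ) :=
        ((contDiffOn_grad hopen hF j).contDiffAt (hopen.mem_nhds (hmem t ht))).differentiableAt
          (by norm_num)
      have := hd.hasFDerivAt.comp_hasDerivAt t (hline t)
      rw [fderiv_apply_eq_grad_dotProduct, dotProduct_comm] at this
      exact this
    rw [dotProduct_mulVec]
    simp only [dotProduct]
    exact HasDerivAt.fun_sum fun j _ => (hj j).mul_const (δ j)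
  -- This is the first-order Taylor polynomial based at `β + t • δ`, evaluated at `β + δ`. In its
  -- derivative the first-order terms cancel; Cauchy's mean value theorem against `(1 - t) ^ 2` then
  -- yields the remainder.
  have hf : ∀ t ∈ Set.Icc (0 : ℝ) 1, HasDerivAt
      (fun t : ℝ => F (β + t • δ) + (1 - t) * (grad F (β + t • δ) ⬝ᵥ δ))
      ((1 - t) * (δ ⬝ᵥ (hess F (β + t • δ) *ᵥ δ))) t := by
    intro t ht
    have h3 : HasDerivAt (fun t : ℝ => 1 - t) (-1) t := by
      simpa using (hasDerivAt_id t).const_sub 1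
    refine ((h1 t ht).add (h3.mul (h2 t ht))).congr_deriv ?_
    ring
  have hg : ∀ t : ℝ, HasDerivAt (fun t : ℝ => (1 - t) ^ 2) (-(2 * (1 - t))) t := by
    intro t
    have h3 : HasDerivAt (fun t : ℝ => 1 - t) (-1) t := by
      simpa using (hasDerivAt_id t).const_sub 1
    refine (h3.pow 2).congr_deriv ?_
    simp
  obtain ⟨c, hc, hcc⟩ := exists_ratio_hasDerivAt_eq_ratio_slope
    (fun t : ℝ => F (β + t • δ) + (1 - t) * (grad F (β + t • δ) ⬝ᵥ δ))
    (fun t => (1 - t) * (δ ⬝ᵥ (hess F (β + t • δ) *ᵥ δ))) zero_lt_one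
    (fun t ht => (hf t ht).continuousAt.continuousWithinAt)
    (fun t ht => hf t (Set.Ioo_subset_Icc_self ht))
    (fun t : ℝ => (1 - t) ^ 2) (fun t => -(2 * (1 - t)))
    (fun t ht => (hg t).continuousAt.continuousWithinAt) (fun t ht => hg t)
  refine ⟨β + c • δ, hmem c (Set.Ioo_subset_Icc_self hc), ?_⟩
  have hc1 : (1 - c) ≠ 0 := sub_ne_zero.2 hc.2.ne'
  simp only [sub_self, zero_mul, add_zero, one_smul, zero_smul, sub_zero, one_mul, one_pow] at hcc
  have : (1 - c) * (F (β + δ) - F β - grad F β ⬝ᵥ δ) =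
      (1 - c) * (1 / 2 * (δ ⬝ᵥ (hess F (β + c • δ) *ᵥ δ))) := by
    linear_combination hcc / 2
  exact mul_left_cancel₀ hc1 this

lemma abs_dotProduct_mulVec_le (A : Matrix ι ι ℝ) (δ : ι → ℝ) :
    |δ ⬝ᵥ (A *ᵥ δ)| ≤ (∑ i, ∑ j, |A i j|) * ‖δ‖ ^ 2 := by
  simp only [dotProduct, mulVec, Finset.mul_sum, Finset.sum_mul]
  refine (Finset.abs_sum_le_sum_abs _ _).trans (Finset.sum_le_sum fun i _ => ?_)
  refine (Finset.abs_sum_le_sum_abs _ _).trans (Finset.sum_le_sum fun j _ => ?_)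
  rw [abs_mul, abs_mul]
  have h1 : |δ i| ≤ ‖δ‖ := norm_le_pi_norm δ i
  have h2 : |δ j| ≤ ‖δ‖ := norm_le_pi_norm δ j
  calc |δ i| * (|A i j| * |δ j|) ≤ ‖δ‖ * (|A i j| * ‖δ‖) := by gcongr
    _ = _ := by ring

/-- A partial derivative is a pointwise limit of difference quotients along a sequence; steps of
length at most `ε / 2` keep the points in `N`, where measurability is known. -/
lemma measurable_grad {U : Type*} [MeasurableSpace U] {F : (ι → ℝ) → U → ℝ} {N : Set (ι → ℝ)}
    (hN : IsOpen N) {β : ι → ℝ} (hβ : β ∈ N) (hm : ∀ b ∈ N, Measurable (F b))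
    (hd : ∀ u, DifferentiableAt ℝ (fun b => F b u) β) (i : ι) :
    Measurable fun u => grad (fun b => F b u) β i := by
  obtain ⟨ε, hε, hball⟩ := Metric.isOpen_iff.1 hN β hβ
  set t : ℕ → ℝ := fun n => ε / 2 * (1 / ((n : ℝ) + 1)) with ht
  have ht0 : ∀ n, 0 < t n := fun n => by positivity
  have htlim : Tendsto t atTop (𝓝 0) := by
    simpa [ht] using tendsto_one_div_add_atTop_nhds_zero_nat.const_mul (ε / 2)
  have hmem : ∀ n, β + t n • Pi.single i (1 : ℝ) ∈ N := by
    intro n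
    apply hball
    rw [mem_ball_iff_norm, add_sub_cancel_left, norm_smul, Real.norm_of_nonneg (ht0 n).le,
      Pi.norm_single, norm_one, mul_one]
    have : 1 / ((n : ℝ) + 1) ≤ 1 := by
      rw [div_le_one (by positivity)]
      linarith [(Nat.cast_nonneg n : (0 : ℝ) ≤ n)]
    have : t n ≤ ε / 2 := by
      simp only [ht]
      nlinarith
    linarith
  refine measurable_of_tendsto_metrizable
    (f := fun n u => (t n)⁻¹ * (F (β + t n • Pi.single i (1 : ℝ)) u - F β u))
    (fun n => ((hm _ (hmem n)).sub (hm _ hβ)).const_mul _) ?_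
  rw [tendsto_pi_nhds]
  intro u
  have hline : HasDerivAt (fun s : ℝ => β + s • (Pi.single i (1 : ℝ) : ι → ℝ))
      (Pi.single i (1 : ℝ)) 0 := by
    simpa using ((hasDerivAt_id (0 : ℝ)).smul_const (Pi.single i (1 : ℝ) : ι → ℝ)).const_add β
  have hder : HasDerivAt (fun s : ℝ => F (β + s • (Pi.single i (1 : ℝ) : ι → ℝ)) u)
      (grad (fun b => F b u) β i) 0 := by
    have hF : HasFDerivAt (fun b => F b u) (fderiv ℝ (fun b => F b u) β)
        (β + (0 : ℝ) • (Pi.single i (1 : ℝ) : ι → ℝ)) := by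
      simpa using (hd u).hasFDerivAt
    exact hF.comp_hasDerivAt (0 : ℝ) hline
  rw [hasDerivAt_iff_tendsto_slope] at hder
  have h3 : Tendsto t atTop (𝓝[≠] 0) :=
    tendsto_nhdsWithin_iff.2 ⟨htlim, Eventually.of_forall fun n => (ht0 n).ne'⟩
  have := hder.comp h3
  simpa [Function.comp_def, slope, vsub_eq_sub] using this

lemma measurable_hess {U : Type*} [MeasurableSpace U] {F : (ι → ℝ) → U → ℝ} {N : Set (ι → ℝ)}
    (hN : IsOpen N) {β : ι → ℝ} (hβ : β ∈ N) (hm : ∀ b ∈ N, Measurable (F b))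
    (hd : ∀ u, ContDiffOn ℝ 2 (fun b => F b u) N) (i j : ι) :
    Measurable fun u => hess (fun b => F b u) β i j := by
  refine measurable_grad (F := fun b u => grad (fun b => F b u) b j) hN hβ
    (fun b hb => measurable_grad hN hb hm
      (fun u => differentiableAt_of_contDiffOn_two hN (hd u) hb) j) (fun u => ?_) i
  exact ((contDiffOn_grad hN (hd u) j).contDiffAt (hN.mem_nhds hβ)).differentiableAt (by norm_num)

end Calculus

/-- A measurable version of the supremum of a continuous family of measurable functions. -/
lemma exists_measurable_iSup {T U : Type*} [TopologicalSpace T]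
    [TopologicalSpace.SeparableSpace T] [Nonempty T] [MeasurableSpace U] {f : T → U → ℝ}
    (hf : ∀ t, Measurable (f t)) (hc : ∀ u, Continuous fun t => f t u)
    (hb : ∀ u, ∃ c, ∀ t, f t u ≤ c) :
    ∃ w : U → ℝ, Measurable w ∧ (∀ u t, f t u ≤ w u) ∧ ∀ u c, (∀ t, f t u ≤ c) → w u ≤ c := by
  -- A countable supremum is measurable, and by continuity a supremum over a dense sequence
  -- dominates every value.
  refine ⟨fun u => ⨆ n : ℕ, f (TopologicalSpace.denseSeq T n) u, Measurable.iSup fun n => hf _,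
    fun u t => ?_, fun u c h => ciSup_le fun n => h _⟩
  have hbdd : BddAbove (Set.range fun n : ℕ => f (TopologicalSpace.denseSeq T n) u) := by
    obtain ⟨c, hc⟩ := hb u
    exact ⟨c, by rintro _ ⟨n, rfl⟩; exact hc _⟩
  have hcl : IsClosed {t | f t u ≤ ⨆ n : ℕ, f (TopologicalSpace.denseSeq T n) u} :=
    isClosed_le (hc u) continuous_const
  have : closure (Set.range (TopologicalSpace.denseSeq T)) ⊆
      {t | f t u ≤ ⨆ n : ℕ, f (TopologicalSpace.denseSeq T n) u} :=
    hcl.closure_subset_iff.2 (by rintro _ ⟨n, rfl⟩; exact le_ciSup hbdd n)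
  exact this (TopologicalSpace.denseRange_denseSeq T t)

/-! ### Second-order expansion of log-densities and of their means -/

section Expansion

open Matrix

variable {ι : Type} [Fintype ι] [DecidableEq ι] {U : Type*} [MeasurableSpace U]
  {S : Set (ι → ℝ)} {βbar : ι → ℝ} {Q : Measure U} {r : ENNReal} {g : (ι → ℝ) → U → ℝ}

lemma Regular.mem (hR : Regular S βbar Q r g) : βbar ∈ S := by
  obtain ⟨N, -, h, h', -⟩ := hR.smooth
  exact h' h

lemma Regular.measurable_grad (hR : Regular S βbar Q r g) (hg : ∀ β ∈ S, Measurable (g β))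
    (i : ι) : Measurable fun u => grad (fun β => Real.log (g β u)) βbar i := by
  obtain ⟨N, hN, h, h', hs, -⟩ := hR.smooth
  exact AuxIC.measurable_grad (F := fun β u => Real.log (g β u)) hN h
    (fun b hb => (hg b (h' hb)).log)
    (fun u => differentiableAt_of_contDiffOn_two hN (hs u) h) i

lemma Regular.measurable_hess (hR : Regular S βbar Q r g) (hg : ∀ β ∈ S, Measurable (g β))
    (i j : ι) : Measurable fun u => hess (fun β => Real.log (g β u)) βbar i j := by
  obtain ⟨N, hN, h, h', hs, -⟩ := hR.smooth
  exact AuxIC.measurable_hess (F := fun β u => Real.log (g β u)) hN h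
    (fun b hb => (hg b (h' hb)).log) hs i j

lemma Regular.memLp_grad (hR : Regular S βbar Q r g) (hg : ∀ β ∈ S, Measurable (g β))
    (i : ι) : MemLp (fun u => grad (fun β => Real.log (g β u)) βbar i) 2 Q := by
  have hm := hR.measurable_grad hg i
  obtain ⟨N, hN, h, h', hs, ⟨m, lm, hb⟩, -⟩ := hR.smooth
  exact lm.mono hm.aestronglyMeasurable
    (ae_of_all _ fun u => (hb u βbar h i).trans (le_abs_self _))

lemma Regular.memLp_hess (hR : Regular S βbar Q r g) (hg : ∀ β ∈ S, Measurable (g β))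
    (i j : ι) : MemLp (fun u => hess (fun β => Real.log (g β u)) βbar i j) r Q := by
  have hm := hR.measurable_hess hg i j
  obtain ⟨N, hN, h, h', hs, -, ⟨m, lm, hb⟩⟩ := hR.smooth
  exact lm.mono hm.aestronglyMeasurable
    (ae_of_all _ fun u => (hb u βbar h i j).trans (le_abs_self _))

lemma Regular.memLp_log (hR : Regular S βbar Q r g) (hg : ∀ β ∈ S, Measurable (g β))
    {β : ι → ℝ} (hβ : β ∈ S) : MemLp (fun u => Real.log (g β u)) r Q := by
  obtain ⟨m, lm, hb⟩ := hR.envelope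
  exact lm.mono (hg β hβ).log.aestronglyMeasurable
    (ae_of_all _ fun u => (hb u β hβ).trans (le_abs_self _))

lemma Regular.isSymm_hess (hR : Regular S βbar Q r g) (u : U) :
    (hess (fun β => Real.log (g β u)) βbar).IsSymm := by
  obtain ⟨N, hN, h, h', hs, -⟩ := hR.smooth
  exact hess_isSymm hN (hs u) h

/-- The log-density has a second order expansion at `β̄` whose relative remainder has a small
mean. -/
lemma Regular.exists_expansion [IsFiniteMeasure Q] (hR : Regular S βbar Q r g)
    (hg : ∀ β ∈ S, Measurable (g β)) (hr : 1 ≤ r) {η : ℝ} (hη : 0 < η) :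
    ∃ ρ > 0, Metric.ball βbar ρ ⊆ S ∧ ∃ w : U → ℝ, Measurable w ∧ MemLp w r Q ∧ (∀ u, 0 ≤ w u) ∧
      ∫ u, w u ∂Q < η ∧ ∀ u δ, ‖δ‖ < ρ →
        |Real.log (g (βbar + δ) u) - Real.log (g βbar u)
          - grad (fun β => Real.log (g β u)) βbar ⬝ᵥ δ
          - 1 / 2 * (δ ⬝ᵥ (hess (fun β => Real.log (g β u)) βbar *ᵥ δ))| ≤ w u * ‖δ‖ ^ 2 := by
  obtain ⟨N, hN, h, h', hs, -, ⟨m, lm, hb⟩⟩ := hR.smooth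
  obtain ⟨ρ₀, hρ₀, hball⟩ := Metric.isOpen_iff.1 hN βbar h
  set c : ℝ := ∑ _i : ι, ∑ _j : ι, (2 : ℝ) with hc
  set ρ : ℕ → ℝ := fun k => ρ₀ * (1 / ((k : ℝ) + 1)) with hρ
  have ρpos : ∀ k, 0 < ρ k := fun k => by positivity
  have ρlim : Tendsto ρ atTop (𝓝 0) := by
    simpa [hρ] using tendsto_one_div_add_atTop_nhds_zero_nat.const_mul ρ₀
  have ρle : ∀ k, ρ k ≤ ρ₀ := by
    intro k
    have : 1 / ((k : ℝ) + 1) ≤ 1 := by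
      rw [div_le_one (by positivity)]
      linarith [(Nat.cast_nonneg k : (0 : ℝ) ≤ k)]
    simp only [hρ]
    nlinarith
  have hsub : ∀ k, Metric.ball βbar (ρ k) ⊆ N := fun k =>
    (Metric.ball_subset_ball (ρle k)).trans hball
  -- The oscillation of the Hessian about `βbar`. Its supremum over a ball serves as the relative
  -- remainder `w`; the triangle inequality bounds it by `c * m`, one factor 2 for each entry.
  let f : (ι → ℝ) → U → ℝ := fun β u => ∑ i, ∑ j,
    |hess (fun β => Real.log (g β u)) β i j - hess (fun β => Real.log (g β u)) βbar i j|
  have mlog : ∀ b ∈ N, Measurable fun u => Real.log (g b u) := fun b hb => (hg b (h' hb)).log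
  have mf : ∀ β ∈ N, Measurable (f β) := by
    intro β hβ
    refine Finset.measurable_fun_sum _ fun i _ => Finset.measurable_fun_sum _ fun j _ => ?_
    exact measurable_norm.comp
      ((AuxIC.measurable_hess (F := fun β u => Real.log (g β u)) hN hβ mlog hs i j).sub
        (hR.measurable_hess hg i j))
  have cf : ∀ u, ContinuousOn (fun β => f β u) N := by
    intro u
    refine continuousOn_finsetSum _ fun i _ => continuousOn_finsetSum _ fun j _ => ?_
    exact ((continuousOn_hess hN (hs u) i j).sub continuousOn_const).abs
  have bf : ∀ u, ∀ β ∈ N, f β u ≤ c * m u := by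
    intro u β hβ
    simp only [f, hc, Finset.sum_mul]
    refine Finset.sum_le_sum fun i _ => Finset.sum_le_sum fun j _ => ?_
    have h1 := hb u β hβ i j
    have h2 := hb u βbar h i j
    have h3 := abs_sub (hess (fun β => Real.log (g β u)) β i j)
      (hess (fun β => Real.log (g β u)) βbar i j)
    linarith
  have hw : ∀ k, ∃ w : U → ℝ, Measurable w ∧
      (∀ u (t : Metric.ball βbar (ρ k)), f t u ≤ w u) ∧
      ∀ u c, (∀ t : Metric.ball βbar (ρ k), f t u ≤ c) → w u ≤ c := by
    intro k
    have : Nonempty (Metric.ball βbar (ρ k)) := ⟨βbar, Metric.mem_ball_self (ρpos k)⟩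
    exact exists_measurable_iSup (T := Metric.ball βbar (ρ k)) (f := fun t u => f t u)
      (fun t => mf t (hsub k t.2))
      (fun u => (continuousOn_iff_continuous_domRestrict.1 ((cf u).mono (hsub k))))
      fun u => ⟨c * m u, fun t => bf u t (hsub k t.2)⟩
  choose w mw wge wle using hw
  have f0 : ∀ u, f βbar u = 0 := fun u => by simp [f]
  have w0 : ∀ k u, 0 ≤ w k u := fun k u => by
    rw [← f0 u]
    exact wge k u ⟨βbar, Metric.mem_ball_self (ρpos k)⟩
  have wb : ∀ k u, w k u ≤ c * m u := fun k u => wle k u _ fun t => bf u t (hsub k t.2)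
  have lcm : MemLp (fun u => c * m u) r Q := lm.const_mul c
  have lw : ∀ k, MemLp (w k) r Q := fun k => lcm.mono (mw k).aestronglyMeasurable
    (ae_of_all _ fun u => by
      rw [Real.norm_of_nonneg (w0 k u)]
      exact (wb k u).trans (le_abs_self _))
  -- Continuity of the Hessian makes the suprema over shrinking balls tend to zero pointwise, and `c
  -- * m` dominates them.
  have lim : Tendsto (fun k => ∫ u, w k u ∂Q) atTop (𝓝 (∫ _, (0 : ℝ) ∂Q)) := by
    refine tendsto_integral_of_dominated_convergence (fun u => c * m u)
      (fun k => (mw k).aestronglyMeasurable) (lcm.integrable hr)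
      (fun k => ae_of_all _ fun u => by rw [Real.norm_of_nonneg (w0 k u)]; exact wb k u)
      (ae_of_all _ fun u => ?_)
    rw [Metric.tendsto_atTop]
    intro ε hε
    have hcont : ContinuousAt (fun β => f β u) βbar := (cf u).continuousAt (hN.mem_nhds h)
    obtain ⟨d, hd, hfd⟩ := Metric.continuousAt_iff.1 hcont (ε / 2) (by positivity)
    obtain ⟨K, hK⟩ := (ρlim.eventually (gt_mem_nhds hd)).exists_forall_of_atTop
    refine ⟨K, fun k hk => ?_⟩
    have : w k u ≤ ε / 2 := by
      refine wle k u _ fun t => ?_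
      have h1 := hfd (t.2.trans (hK k hk))
      rw [Real.dist_eq, f0, sub_zero] at h1
      exact (le_abs_self _).trans h1.le
    rw [Real.dist_eq, sub_zero, abs_of_nonneg (w0 k u)]
    linarith
  rw [integral_zero] at lim
  obtain ⟨k, hk⟩ := (lim.eventually (gt_mem_nhds hη)).exists
  refine ⟨ρ k, ρpos k, (hsub k).trans h', w k, mw k, lw k, w0 k, hk, fun u δ hδ => ?_⟩
  obtain ⟨ξ, hξ, e⟩ := exists_taylor_two ((hs u).mono (hsub k)) hδ
  rw [e, ← mul_sub, ← dotProduct_sub, ← sub_mulVec, abs_mul]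
  have h1 := abs_dotProduct_mulVec_le (hess (fun β => Real.log (g β u)) ξ -
    hess (fun β => Real.log (g β u)) βbar) δ
  have h2 : (∑ i, ∑ j, |(hess (fun β => Real.log (g β u)) ξ -
    hess (fun β => Real.log (g β u)) βbar) i j|) ≤ w k u := wge k u ⟨ξ, hξ⟩
  have h3 : (0 : ℝ) ≤ ‖δ‖ ^ 2 := by positivity
  have h4 : |(1 / 2 : ℝ)| = 1 / 2 := by norm_num
  rw [h4]
  have h5 := mul_le_mul_of_nonneg_right h2 h3
  have h6 := abs_nonneg (δ ⬝ᵥ ((hess (fun β => Real.log (g β u)) ξ -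
    hess (fun β => Real.log (g β u)) βbar) *ᵥ δ))
  linarith

lemma integral_dotProduct {G : U → ι → ℝ} (hG : ∀ i, Integrable (fun u => G u i) Q) (δ : ι → ℝ) :
    Integrable (fun u => G u ⬝ᵥ δ) Q ∧
      ∫ u, G u ⬝ᵥ δ ∂Q = (fun i => ∫ u, G u i ∂Q) ⬝ᵥ δ := by
  have h1 : ∀ i ∈ Finset.univ, Integrable (fun u => G u i * δ i) Q := fun i _ =>
    (hG i).mul_const _
  refine ⟨integrable_finsetSum _ h1, ?_⟩
  simp only [dotProduct]
  rw [integral_finsetSum _ h1]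
  simp [integral_mul_const]

lemma integral_dotProduct_mulVec {H : U → Matrix ι ι ℝ}
    (hH : ∀ i j, Integrable (fun u => H u i j) Q) (δ : ι → ℝ) :
    Integrable (fun u => δ ⬝ᵥ (H u *ᵥ δ)) Q ∧
      ∫ u, δ ⬝ᵥ (H u *ᵥ δ) ∂Q = δ ⬝ᵥ ((Matrix.of fun i j => ∫ u, H u i j ∂Q) *ᵥ δ) := by
  have h1 : ∀ i, Integrable (fun u => (H u *ᵥ δ) i) Q ∧ _ := fun i =>
    integral_dotProduct (G := fun u => H u i) (hH i) δ
  have h2 := integral_dotProduct (G := fun u => H u *ᵥ δ) (fun i => (h1 i).1) δ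
  simp_rw [dotProduct_comm δ]
  refine ⟨h2.1, h2.2.trans ?_⟩
  congr 1
  ext i
  exact (h1 i).2

/-- The mean of the gradient of the log-density at `β̄`. -/
def meanGrad (Q : Measure U) (g : (ι → ℝ) → U → ℝ) (βbar : ι → ℝ) : ι → ℝ :=
  fun i => ∫ u, grad (fun β => Real.log (g β u)) βbar i ∂Q

/-- The information matrix of a family of densities at `β̄`. -/
def info (Q : Measure U) (g : (ι → ℝ) → U → ℝ) (βbar : ι → ℝ) : Matrix ι ι ℝ :=
  Matrix.of fun i j => -∫ u, hess (fun β => Real.log (g β u)) βbar i j ∂Q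

lemma Regular.mean_expansion [IsFiniteMeasure Q] (hR : Regular S βbar Q r g)
    (hg : ∀ β ∈ S, Measurable (g β)) (hr : 1 ≤ r) {η : ℝ} (hη : 0 < η) :
    ∃ ρ > 0, Metric.ball βbar ρ ⊆ S ∧ ∀ δ, ‖δ‖ < ρ →
      |∫ u, Real.log (g (βbar + δ) u) ∂Q - ∫ u, Real.log (g βbar u) ∂Q
          - meanGrad Q g βbar ⬝ᵥ δ + 1 / 2 * (δ ⬝ᵥ (info Q g βbar *ᵥ δ))| ≤ η * ‖δ‖ ^ 2 := by
  obtain ⟨ρ, hρ, hsub, w, mw, lw, w0, hw, hexp⟩ := hR.exists_expansion hg hr hη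
  refine ⟨ρ, hρ, hsub, fun δ hδ => ?_⟩
  have hmem : βbar + δ ∈ S := hsub (by simpa [mem_ball_iff_norm] using hδ)
  have i1 := (hR.memLp_log hg hmem).integrable hr
  have i2 := (hR.memLp_log hg hR.mem).integrable hr
  obtain ⟨i3, e3⟩ := integral_dotProduct
    (fun i => (hR.memLp_grad hg i).integrable (by norm_num)) δ
  obtain ⟨i4, e4⟩ := integral_dotProduct_mulVec
    (fun i j => (hR.memLp_hess hg i j).integrable hr) δ
  have e4' : ∫ u, δ ⬝ᵥ (hess (fun β => Real.log (g β u)) βbar *ᵥ δ) ∂Q =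
      -(δ ⬝ᵥ (info Q g βbar *ᵥ δ)) := by
    rw [e4, ← dotProduct_neg, ← neg_mulVec]
    congr 2
    ext i j
    simp [info]
  have e : ∫ u, Real.log (g (βbar + δ) u) ∂Q - ∫ u, Real.log (g βbar u) ∂Q
          - meanGrad Q g βbar ⬝ᵥ δ + 1 / 2 * (δ ⬝ᵥ (info Q g βbar *ᵥ δ)) =
      ∫ u, (Real.log (g (βbar + δ) u) - Real.log (g βbar u)
          - grad (fun β => Real.log (g β u)) βbar ⬝ᵥ δ
          - 1 / 2 * (δ ⬝ᵥ (hess (fun β => Real.log (g β u)) βbar *ᵥ δ))) ∂Q := by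
    rw [integral_sub, integral_sub, integral_sub i1 i2, integral_const_mul, e4', e3]
    · unfold meanGrad
      ring
    · exact i1.sub i2
    · exact i3
    · exact (i1.sub i2).sub i3
    · exact i4.const_mul _
  rw [e]
  refine (abs_integral_le_integral_abs).trans ?_
  refine (integral_mono (((i1.sub i2).sub i3).sub (i4.const_mul _)).abs
    ((lw.integrable hr).mul_const _) fun u => hexp u δ hδ).trans ?_
  rw [integral_mul_const]
  gcongr

lemma info_isSymm (hR : Regular S βbar Q r g) : (info Q g βbar).IsSymm := by
  ext i j
  simp only [info, transpose_apply, of_apply]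
  congr 2
  ext u
  exact (hR.isSymm_hess u).apply j i |>.symm

/-- At an interior maximum of the mean log-density, its gradient vanishes and the information
matrix is positive semidefinite. -/
lemma Regular.stationary [IsFiniteMeasure Q] (hR : Regular S βbar Q r g)
    (hg : ∀ β ∈ S, Measurable (g β)) (hr : 1 ≤ r)
    (hmax : ∀ β ∈ S, ∫ u, Real.log (g β u) ∂Q ≤ ∫ u, Real.log (g βbar u) ∂Q) :
    meanGrad Q g βbar = 0 ∧ ∀ δ, 0 ≤ δ ⬝ᵥ (info Q g βbar *ᵥ δ) := by
  -- The mean expansion along `t • δ`, combined with maximality. Dividing by a small `t > 0` bounds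
  -- the first-order term above by zero; once the gradient vanishes, the sign of the quadratic term
  -- remains.
  have key : ∀ η > 0, ∀ δ, ∃ t₀ > 0, ∀ t : ℝ, |t| < t₀ →
      t * (meanGrad Q g βbar ⬝ᵥ δ) ≤
        t ^ 2 * (1 / 2 * (δ ⬝ᵥ (info Q g βbar *ᵥ δ)) + η * ‖δ‖ ^ 2) := by
    intro η hη δ
    obtain ⟨ρ, hρ, hsub, hexp⟩ := hR.mean_expansion hg hr hη
    refine ⟨ρ / (‖δ‖ + 1), by positivity, fun t ht => ?_⟩
    rw [lt_div_iff₀ (by positivity)] at ht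
    have hlt : ‖t • δ‖ < ρ := by
      rw [norm_smul, Real.norm_eq_abs]
      nlinarith [abs_nonneg t]
    have h1 := hexp (t • δ) hlt
    have h2 := hmax (βbar + t • δ) (hsub (by simpa [mem_ball_iff_norm] using hlt))
    have h3 := (abs_le.1 h1).1
    rw [norm_smul, mul_pow, Real.norm_eq_abs, sq_abs, mulVec_smul, dotProduct_smul,
      dotProduct_smul, smul_dotProduct] at h3
    simp only [smul_eq_mul] at h3
    linarith
  have hgrad : ∀ δ, meanGrad Q g βbar ⬝ᵥ δ ≤ 0 := by
    intro δ
    obtain ⟨t₀, ht₀, h1⟩ := key 1 one_pos δ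
    set B := 1 / 2 * (δ ⬝ᵥ (info Q g βbar *ᵥ δ)) + 1 * ‖δ‖ ^ 2 with hB
    have lim : Tendsto (fun t : ℝ => t * B) (𝓝[>] 0) (𝓝 0) := by
      have : Tendsto (fun t : ℝ => t * B) (𝓝 0) (𝓝 (0 * B)) := tendsto_id.mul_const B
      rw [zero_mul] at this
      exact this.mono_left nhdsWithin_le_nhds
    refine ge_of_tendsto lim ?_
    filter_upwards [Ioo_mem_nhdsGT ht₀] with t ht
    have h2 := h1 t (by rw [abs_of_pos ht.1]; exact ht.2)
    have h3 : t * (meanGrad Q g βbar ⬝ᵥ δ) ≤ t * (t * B) := by linarith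
    exact le_of_mul_le_mul_left h3 ht.1
  have hzero : meanGrad Q g βbar = 0 := by
    ext i
    have h1 := hgrad (Pi.single i 1)
    have h2 := hgrad (-Pi.single i 1)
    simp at h1 h2
    exact le_antisymm h1 h2
  refine ⟨hzero, fun δ => ?_⟩
  by_contra hneg
  push Not at hneg
  set q := δ ⬝ᵥ (info Q g βbar *ᵥ δ) with hq
  -- The remainder is then at most `-q / 4`, too small to compensate the negative quantity `q / 2`.
  obtain ⟨t₀, ht₀, h1⟩ := key (-q / (4 * (‖δ‖ ^ 2 + 1))) (by
    apply div_pos <;> [linarith; positivity]) δ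
  have h2 := h1 (t₀ / 2) (by rw [abs_of_pos (by positivity)]; linarith)
  rw [hzero, zero_dotProduct, mul_zero] at h2
  have h3 : 0 ≤ 1 / 2 * q + -q / (4 * (‖δ‖ ^ 2 + 1)) * ‖δ‖ ^ 2 :=
    nonneg_of_mul_nonneg_right h2 (by positivity)
  have h4 : -q / (4 * (‖δ‖ ^ 2 + 1)) * ‖δ‖ ^ 2 ≤ -q / 4 := by
    rw [div_mul_eq_mul_div, div_le_iff₀ (by positivity)]
    nlinarith [sq_nonneg ‖δ‖]
  linarith

end Expansion

/-! ### Densities, marginals and Gibbs' inequality -/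

section Densities

variable {U T : Type*} [MeasurableSpace U] [MeasurableSpace T]

/-- The measure with real density `p` with respect to `μ`. -/
def densMeasure (μ : Measure U) (p : U → ℝ) : Measure U :=
  μ.withDensity fun u => ENNReal.ofReal (p u)

lemma IsDensity.integrable_densMeasure_iff {μ : Measure U} {p : U → ℝ} (hp : IsDensity μ p)
    {φ : U → ℝ} : Integrable φ (densMeasure μ p) ↔ Integrable (fun u => p u * φ u) μ := by
  rw [densMeasure, integrable_withDensity_iff_integrable_smul' hp.measurable.ennreal_ofReal
    (ae_of_all _ fun u => ENNReal.ofReal_lt_top)]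
  simp [ENNReal.toReal_ofReal (hp.nonneg _)]

lemma IsDensity.integral_densMeasure {μ : Measure U} {p : U → ℝ} (hp : IsDensity μ p)
    (φ : U → ℝ) : ∫ u, φ u ∂(densMeasure μ p) = ∫ u, p u * φ u ∂μ := by
  rw [densMeasure, integral_withDensity_eq_integral_toReal_smul hp.measurable.ennreal_ofReal
    (ae_of_all _ fun u => ENNReal.ofReal_lt_top)]
  simp [ENNReal.toReal_ofReal (hp.nonneg _)]

lemma IsDensity.isProbabilityMeasure {μ : Measure U} {p : U → ℝ} (hp : IsDensity μ p) :
    IsProbabilityMeasure (densMeasure μ p) := by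
  refine ⟨?_⟩
  rw [densMeasure, withDensity_apply _ MeasurableSet.univ, setLIntegral_univ,
    ← ofReal_integral_eq_lintegral_ofReal hp.integrable (ae_of_all _ hp.nonneg),
    hp.integral_eq_one, ENNReal.ofReal_one]

lemma densMeasure_congr {μ : Measure U} {p p' : U → ℝ} (h : p =ᵐ[μ] p') :
    densMeasure μ p = densMeasure μ p' :=
  withDensity_congr_ae (h.mono fun u hu => by simp only [hu])

lemma IsDensity.ae_pos {μ : Measure U} {p : U → ℝ} (hp : IsDensity μ p) :
    ∀ᵐ u ∂(densMeasure μ p), 0 < p u := by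
  rw [densMeasure, ae_withDensity_iff hp.measurable.ennreal_ofReal]
  filter_upwards with u hu
  simpa using hu

lemma IsDensity.marginal {μ : Measure U} {ν : Measure T} [SigmaFinite μ] [SigmaFinite ν]
    {q : U × T → ℝ} (hq : IsDensity (μ.prod ν) q) : IsDensity μ fun u => ∫ t, q (u, t) ∂ν where
  measurable := (hq.measurable.stronglyMeasurable.integral_prod_right').measurable
  nonneg u := integral_nonneg fun t => hq.nonneg _
  integrable := hq.integrable.integral_prod_left
  integral_eq_one := by rw [← hq.integral_eq_one, integral_prod _ hq.integrable]

lemma IsDensity.map_fst {μ : Measure U} {ν : Measure T} [SigmaFinite μ] [SigmaFinite ν]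
    {q : U × T → ℝ} (hq : IsDensity (μ.prod ν) q) :
    (densMeasure (μ.prod ν) q).map Prod.fst = densMeasure μ fun u => ∫ t, q (u, t) ∂ν := by
  ext s hs
  have mq : Measurable fun c => ENNReal.ofReal (q c) := hq.measurable.ennreal_ofReal
  rw [Measure.map_apply measurable_fst hs, densMeasure, densMeasure,
    withDensity_apply _ (measurable_fst hs), withDensity_apply _ hs,
    ← lintegral_indicator (measurable_fst hs), ← lintegral_indicator hs,
    lintegral_prod _ (mq.indicator (measurable_fst hs)).aemeasurable]
  refine lintegral_congr_ae ?_
  filter_upwards [hq.integrable.prod_right_ae] with u hu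
  by_cases h : u ∈ s
  · simp only [h, Set.mem_preimage, Set.indicator, if_true]
    rw [ofReal_integral_eq_lintegral_ofReal hu (ae_of_all _ fun t => hq.nonneg _)]
  · simp [h, Set.indicator]

lemma IsDensity.comp_measurePreserving {μ : Measure U} {ν : Measure T} {q : U → ℝ}
    (hq : IsDensity μ q) (e : T ≃ᵐ U) (he : MeasurePreserving e ν μ) :
    IsDensity ν (q ∘ e) ∧ (densMeasure ν (q ∘ e)).map e = densMeasure μ q := by
  refine ⟨⟨hq.measurable.comp e.measurable, fun u => hq.nonneg _,
    (he.integrable_comp_emb e.measurableEmbedding).2 hq.integrable, ?_⟩, ?_⟩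
  · rw [← hq.integral_eq_one]
    exact he.integral_comp e.measurableEmbedding q
  · ext s hs
    rw [Measure.map_apply e.measurable hs, densMeasure, densMeasure,
      withDensity_apply _ (e.measurable hs), withDensity_apply _ hs]
    exact he.setLIntegral_comp_preimage hs hq.measurable.ennreal_ofReal

/-- Gibbs' inequality for densities with the same support. -/
lemma gibbs {μ : Measure U} {p p' : U → ℝ} (hp : IsDensity μ p) (hp' : IsDensity μ p')
    (hsupp : ∀ u, p' u = 0 → p u = 0)
    (i : Integrable (fun u => Real.log (p u)) (densMeasure μ p))
    (i' : Integrable (fun u => Real.log (p' u)) (densMeasure μ p)) :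
    ∫ u, Real.log (p' u) ∂(densMeasure μ p) ≤ ∫ u, Real.log (p u) ∂(densMeasure μ p) := by
  rw [hp.integral_densMeasure, hp.integral_densMeasure]
  rw [hp.integrable_densMeasure_iff] at i i'
  -- This is `log t ≤ t - 1` with `t = p' / p`, multiplied by `p`. Where `p` vanishes the left
  -- integrand is zero; where `p` is positive so is `p'`, by the support hypothesis. The right-hand
  -- side is `1 - 1`.
  have h1 : ∫ u, (p u * Real.log (p' u) - p u * Real.log (p u)) ∂μ ≤ ∫ u, (p' u - p u) ∂μ := by
    refine integral_mono (i'.sub i) (hp'.integrable.sub hp.integrable) fun u => ?_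
    change p u * Real.log (p' u) - p u * Real.log (p u) ≤ p' u - p u
    rcases (hp.nonneg u).eq_or_lt with h0 | h0
    · rw [← h0]
      simpa using hp'.nonneg u
    · have h0' : 0 < p' u := (hp'.nonneg u).lt_of_ne fun h => h0.ne' (hsupp u h.symm)
      have := Real.log_le_sub_one_of_pos (div_pos h0' h0)
      rw [Real.log_div h0'.ne' h0.ne'] at this
      have h2 := mul_le_mul_of_nonneg_left this h0.le
      have h3 : p u * (p' u / p u - 1) = p' u - p u := by field_simp
      linarith
  rw [integral_sub i' i, integral_sub hp'.integrable hp.integrable, hp'.integral_eq_one,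
    hp.integral_eq_one] at h1
  linarith

end Densities

/-! ### The information identity -/

section Fisher

open Matrix

variable {ι : Type} [Fintype ι] [DecidableEq ι]

/-- The common support leaves two cases: `p` vanishes identically in the parameter, or it is
positive throughout and equals `exp (log p)`. -/
lemma contDiffOn_of_log {p : (ι → ℝ) → ℝ} {N S : Set (ι → ℝ)} (hNS : N ⊆ S)
    (hnn : ∀ β ∈ S, 0 ≤ p β) (hsupp : ∀ β ∈ S, ∀ β' ∈ S, p β = 0 → p β' = 0)
    (hlog : ContDiffOn ℝ 2 (fun β => Real.log (p β)) N) : ContDiffOn ℝ 2 p N := by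
  by_cases h0 : ∃ β ∈ S, p β = 0
  · obtain ⟨β, hβ, hz⟩ := h0
    exact (contDiffOn_const (c := (0 : ℝ))).congr fun b hb => hsupp β hβ b (hNS hb) hz
  · push Not at h0
    refine hlog.exp.congr fun b hb => ?_
    rw [Real.exp_log ((hnn b (hNS hb)).lt_of_ne (h0 b (hNS hb)).symm)]

/-- No positivity is needed: if `p β = 0`, then `p` vanishes near `β` and both sides are zero. -/
lemma grad_eq_mul_grad_log {p : (ι → ℝ) → ℝ} {N S : Set (ι → ℝ)} (hN : IsOpen N) (hNS : N ⊆ S)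
    (hsupp : ∀ β ∈ S, ∀ β' ∈ S, p β = 0 → p β' = 0)
    (hp : ContDiffOn ℝ 2 p N) {β : ι → ℝ} (hβ : β ∈ N) (i : ι) :
    grad p β i = p β * grad (fun β => Real.log (p β)) β i := by
  by_cases h0 : p β = 0
  · have : p =ᶠ[𝓝 β] fun _ => 0 := by
      filter_upwards [hN.mem_nhds hβ] with b hb
      exact hsupp β (hNS hβ) b (hNS hb) h0
    simp [grad, this.fderiv_eq, h0]
  · simp only [grad]
    rw [fderiv.log (differentiableAt_of_contDiffOn_two hN hp hβ) h0]
    simp [h0]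

lemma hess_eq_mul_hess_log {p : (ι → ℝ) → ℝ} {N S : Set (ι → ℝ)} (hN : IsOpen N) (hNS : N ⊆ S)
    (hsupp : ∀ β ∈ S, ∀ β' ∈ S, p β = 0 → p β' = 0)
    (hp : ContDiffOn ℝ 2 p N) (hlog : ContDiffOn ℝ 2 (fun β => Real.log (p β)) N)
    {β : ι → ℝ} (hβ : β ∈ N) (i j : ι) :
    hess p β i j = p β * (grad (fun β => Real.log (p β)) β i * grad (fun β => Real.log (p β)) β j
      + hess (fun β => Real.log (p β)) β i j) := by
  have h1 : (fun b => grad p b j) =ᶠ[𝓝 β] fun b => p b * grad (fun β => Real.log (p β)) b j := by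
    filter_upwards [hN.mem_nhds hβ] with b hb
    exact grad_eq_mul_grad_log hN hNS hsupp hp hb j
  simp only [hess, Matrix.of_apply]
  rw [h1.fderiv_eq, fderiv_fun_mul (differentiableAt_of_contDiffOn_two hN hp hβ)
    (((contDiffOn_grad hN hlog j).contDiffAt (hN.mem_nhds hβ)).differentiableAt (by norm_num))]
  have h2 := grad_eq_mul_grad_log hN hNS hsupp hp hβ i
  simp only [grad] at h2
  simp only [_root_.add_apply, _root_.smul_apply, smul_eq_mul, h2, grad]
  ring

lemma exists_seq_norm_smul_lt (v : ι → ℝ) {ρ : ℝ} (hρ : 0 < ρ) :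
    ∃ t : ℕ → ℝ, (∀ n, 0 < t n) ∧ Tendsto t atTop (𝓝 0) ∧ ∀ n, ‖t n • v‖ < ρ := by
  set c := ρ / (2 * (‖v‖ + 1)) with hc
  have hcpos : 0 < c := by positivity
  have tpos : ∀ n : ℕ, 0 < c * (1 / ((n : ℝ) + 1)) := fun n => by positivity
  refine ⟨fun n => c * (1 / ((n : ℝ) + 1)), tpos, ?_, fun n => ?_⟩
  · simpa using tendsto_one_div_add_atTop_nhds_zero_nat.const_mul c
  · have h1 : 1 / ((n : ℝ) + 1) ≤ 1 := by
      rw [div_le_one (by positivity)]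
      linarith [(Nat.cast_nonneg n : (0 : ℝ) ≤ n)]
    have h2 : c * (1 / ((n : ℝ) + 1)) ≤ c := by nlinarith
    rw [norm_smul, Real.norm_of_nonneg (tpos n).le]
    calc c * (1 / ((n : ℝ) + 1)) * ‖v‖ ≤ c * ‖v‖ := by gcongr
      _ < c * (2 * (‖v‖ + 1)) := by
        apply mul_lt_mul_of_pos_left _ hcpos
        linarith [norm_nonneg v]
      _ = ρ := by rw [hc]; field_simp

lemma tendsto_hess_segment {p : (ι → ℝ) → ℝ} {N : Set (ι → ℝ)} (hN : IsOpen N)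
    (hp : ContDiffOn ℝ 2 p N) {β : ι → ℝ} (hβ : β ∈ N) (v : ι → ℝ) {t : ℕ → ℝ}
    (ht0 : ∀ n, t n ≠ 0) (ht : Tendsto t atTop (𝓝 0)) :
    Tendsto (fun n => (p (β + t n • v) - p β - grad p β ⬝ᵥ (t n • v)) / t n ^ 2) atTop
      (𝓝 (1 / 2 * (v ⬝ᵥ (hess p β *ᵥ v)))) := by
  have hc : ContinuousAt (fun b => 1 / 2 * (v ⬝ᵥ (hess p b *ᵥ v))) β := by
    refine ContinuousOn.continuousAt (s := N) ?_ (hN.mem_nhds hβ)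
    simp only [dotProduct, mulVec]
    refine continuousOn_const.mul (continuousOn_finsetSum _ fun i _ => continuousOn_const.mul
      (continuousOn_finsetSum _ fun j _ => (continuousOn_hess hN hp i j).mul continuousOn_const))
  rw [Metric.tendsto_atTop]
  intro ε hε
  obtain ⟨d, hd, hcd⟩ := Metric.continuousAt_iff.1 hc ε hε
  obtain ⟨ρ, hρ, hball⟩ := Metric.isOpen_iff.1 hN β hβ
  have hlim : Tendsto (fun n => ‖t n • v‖) atTop (𝓝 0) := by
    simpa using (ht.smul_const v).norm
  obtain ⟨K, hK⟩ := (hlim.eventually (gt_mem_nhds (lt_min hd hρ))).exists_forall_of_atTop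
  refine ⟨K, fun n hn => ?_⟩
  obtain ⟨ξ, hξ, e⟩ := exists_taylor_two (hp.mono
    ((Metric.ball_subset_ball (min_le_right d ρ)).trans hball)) (hK n hn)
  have e2 : (p (β + t n • v) - p β - grad p β ⬝ᵥ (t n • v)) / t n ^ 2 =
      1 / 2 * (v ⬝ᵥ (hess p ξ *ᵥ v)) := by
    rw [e, mulVec_smul, dotProduct_smul, smul_dotProduct]
    have := ht0 n
    simp only [smul_eq_mul]
    field_simp
  rw [e2]
  exact hcd (lt_of_lt_of_le hξ (min_le_left d ρ))

/-- The one-sided expansions along `t` and `-t` are added, which cancels the gradient. -/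
lemma tendsto_second_difference {p : (ι → ℝ) → ℝ} {N : Set (ι → ℝ)} (hN : IsOpen N)
    (hp : ContDiffOn ℝ 2 p N) {β : ι → ℝ} (hβ : β ∈ N) (v : ι → ℝ) {t : ℕ → ℝ}
    (ht0 : ∀ n, t n ≠ 0) (ht : Tendsto t atTop (𝓝 0)) :
    Tendsto (fun n => (p (β + t n • v) + p (β - t n • v) - 2 * p β) / t n ^ 2) atTop
      (𝓝 (v ⬝ᵥ (hess p β *ᵥ v))) := by
  have h1 := tendsto_hess_segment hN hp hβ v ht0 ht
  have h2 := tendsto_hess_segment hN hp hβ v (t := fun n => -t n) (fun n => neg_ne_zero.2 (ht0 n))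
    (by simpa using ht.neg)
  have h3 := h1.add h2
  have e : 1 / 2 * (v ⬝ᵥ (hess p β *ᵥ v)) + 1 / 2 * (v ⬝ᵥ (hess p β *ᵥ v)) =
    v ⬝ᵥ (hess p β *ᵥ v) := by ring
  rw [e] at h3
  refine h3.congr fun n => ?_
  rw [neg_sq, ← add_div, neg_smul, dotProduct_neg, ← sub_eq_add_neg]
  congr 1
  ring

/-- Polarization on the vectors of the standard basis and their pairwise sums. -/
lemma eq_zero_of_dotProduct_mulVec {A : Matrix ι ι ℝ} (hA : A.IsSymm)
    (h : ∀ v, v ⬝ᵥ (A *ᵥ v) = 0) : A = 0 := by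
  ext i j
  have h1 := h (Pi.single i 1)
  have h2 := h (Pi.single j 1)
  have h3 := h (Pi.single i 1 + Pi.single j 1)
  have h4 := hA.apply i j
  simp [mulVec_add, add_dotProduct, dotProduct_add] at h1 h2 h3
  rw [Matrix.zero_apply]
  linarith

/-- The second differences of the family `g` at `β̄` are dominated by an integrable function. -/
def DominatedDiff {U : Type*} [MeasurableSpace U] (βbar : ι → ℝ) (μ : Measure U)
    (g : (ι → ℝ) → U → ℝ) : Prop :=
  ∃ ρ > 0, ∃ D : U → ℝ, Integrable D μ ∧ ∀ δ, ‖δ‖ < ρ →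
    ∀ᵐ u ∂μ, |g (βbar + δ) u + g (βbar - δ) u - 2 * g βbar u| ≤ D u * ‖δ‖ ^ 2

variable {U : Type*} [MeasurableSpace U] {S : Set (ι → ℝ)} {βbar : ι → ℝ} {μ : Measure U}
  {r : ENNReal} {g : (ι → ℝ) → U → ℝ}

/-- The information identity `E[∇ log g ∇ᵀ log g] = -E[∇² log g]`. -/
lemma Regular.info_eq (hdens : ∀ β ∈ S, IsDensity μ (g β))
    (hR : Regular S βbar (densMeasure μ (g βbar)) r g) (hr : 1 ≤ r)
    (hD : DominatedDiff βbar μ g) (i j : ι) :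
    ∫ u, grad (fun β => Real.log (g β u)) βbar i * grad (fun β => Real.log (g β u)) βbar j
      ∂(densMeasure μ (g βbar)) = info (densMeasure μ (g βbar)) g βbar i j := by
  set Q := densMeasure μ (g βbar) with hQ
  have hg : ∀ β ∈ S, Measurable (g β) := fun β hβ => (hdens β hβ).measurable
  have hbar := hR.mem
  have hp := hdens βbar hbar
  have : IsProbabilityMeasure Q := hp.isProbabilityMeasure
  have iJ : ∀ i j, Integrable (fun u => grad (fun β => Real.log (g β u)) βbar i *
      grad (fun β => Real.log (g β u)) βbar j) Q := fun i j =>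
    (hR.memLp_grad hg i).integrable_mul (hR.memLp_grad hg j)
  have iH : ∀ i j, Integrable (fun u => hess (fun β => Real.log (g β u)) βbar i j) Q := fun i j =>
    (hR.memLp_hess hg i j).integrable hr
  set A : U → Matrix ι ι ℝ := fun u => Matrix.of fun i j =>
    grad (fun β => Real.log (g β u)) βbar i * grad (fun β => Real.log (g β u)) βbar j +
      hess (fun β => Real.log (g β u)) βbar i j with hA
  have iA : ∀ i j, Integrable (fun u => A u i j) Q := fun i j => (iJ i j).add (iH i j)
  have hzero : (Matrix.of fun i j => ∫ u, A u i j ∂Q) = 0 := by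
    refine eq_zero_of_dotProduct_mulVec ?_ fun v => ?_
    · ext i j
      simp only [transpose_apply, of_apply]
      congr 1
      ext u
      simp only [hA, of_apply]
      rw [(hR.isSymm_hess u).apply i j, mul_comm]
    rw [← (integral_dotProduct_mulVec iA v).2, hp.integral_densMeasure]
    obtain ⟨N, hN, hβN, hNS, hlog, -⟩ := hR.smooth
    obtain ⟨ρ₁, hρ₁, D, iD, hdom⟩ := hD
    obtain ⟨ρ₂, hρ₂, hball⟩ := Metric.isOpen_iff.1 hN βbar hβN
    obtain ⟨t, tpos, tlim, tv⟩ := exists_seq_norm_smul_lt v (lt_min hρ₁ hρ₂)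
    have hplus : ∀ n, βbar + t n • v ∈ S := fun n => hNS (hball (by
      simpa [mem_ball_iff_norm] using (tv n).trans_le (min_le_right _ _)))
    have hminus : ∀ n, βbar - t n • v ∈ S := fun n => hNS (hball (by
      rw [mem_ball_iff_norm, sub_sub_cancel_left, norm_neg]
      exact (tv n).trans_le (min_le_right _ _)))
    have hCD : ∀ u, ContDiffOn ℝ 2 (fun β => g β u) N := fun u =>
      contDiffOn_of_log hNS (fun β hβ => (hdens β hβ).nonneg u) (hR.support u) (hlog u)
    -- The Hessian of `g` is `g` times the sum of the score product and the Hessian of `log g`, also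
    -- where `g` is zero.
    have hpt : ∀ u, v ⬝ᵥ (hess (fun β => g β u) βbar *ᵥ v) = g βbar u * (v ⬝ᵥ (A u *ᵥ v)) := by
      intro u
      have : hess (fun β => g β u) βbar = g βbar u • A u := by
        ext i j
        rw [hess_eq_mul_hess_log hN hNS (hR.support u) (hCD u) (hlog u) hβN]
        simp [hA]
      rw [this, smul_mulVec, dotProduct_smul, smul_eq_mul]
    set f : ℕ → U → ℝ := fun n u =>
      (g (βbar + t n • v) u + g (βbar - t n • v) u - 2 * g βbar u) / t n ^ 2 with hf
    -- All three densities have total mass one, and `1 + 1 - 2 = 0`.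
    have if0 : ∀ n, ∫ u, f n u ∂μ = 0 := by
      intro n
      have d1 := hdens _ (hplus n)
      have d2 := hdens _ (hminus n)
      simp only [hf]
      rw [integral_div, integral_sub
        (f := fun u => g (βbar + t n • v) u + g (βbar - t n • v) u) (d1.integrable.add d2.integrable)
        (hp.integrable.const_mul 2), integral_add d1.integrable d2.integrable,
        integral_const_mul, d1.integral_eq_one, d2.integral_eq_one, hp.integral_eq_one]
      norm_num
    have lim : Tendsto (fun n => ∫ u, f n u ∂μ) atTop
        (𝓝 (∫ u, g βbar u * (v ⬝ᵥ (A u *ᵥ v)) ∂μ)) := by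
      refine tendsto_integral_of_dominated_convergence (fun u => D u * ‖v‖ ^ 2) (fun n => ?_)
        (iD.mul_const _) (fun n => ?_) (ae_of_all _ fun u => ?_)
      · exact ((((hg _ (hplus n)).add (hg _ (hminus n))).sub
          ((hg _ hbar).const_mul 2)).div_const _).aestronglyMeasurable
      · filter_upwards [hdom _ ((tv n).trans_le (min_le_left _ _))] with u hu
        rw [Real.norm_eq_abs, hf, abs_div, abs_of_pos (pow_pos (tpos n) 2),
          div_le_iff₀ (pow_pos (tpos n) 2)]
        refine hu.trans_eq ?_
        rw [norm_smul, Real.norm_of_nonneg (tpos n).le]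
        ring
      · rw [← hpt]
        exact tendsto_second_difference hN (hCD u) hβN v (fun n => (tpos n).ne') tlim
    simp only [if0] at lim
    exact (tendsto_nhds_unique lim tendsto_const_nhds)
  have h1 := congrFun (congrFun hzero i) j
  simp only [of_apply, Matrix.zero_apply, hA] at h1
  rw [integral_add (iJ i j) (iH i j)] at h1
  simp only [info, of_apply]
  linarith

end Fisher

/-! ### Marginal families: inherited domination and conditional scores -/

section Cross

open Matrix

variable {ι : Type} [Fintype ι] [DecidableEq ι]
variable {U T : Type*} [MeasurableSpace U] [MeasurableSpace T] {S : Set (ι → ℝ)} {βbar : ι → ℝ}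
  {μ : Measure U} {ν : Measure T} {r s : ENNReal}

lemma Regular.contDiffOn_density {Q : Measure U} {g : (ι → ℝ) → U → ℝ}
    (hnn : ∀ β ∈ S, ∀ u, 0 ≤ g β u) (hR : Regular S βbar Q r g) :
    ∃ N : Set (ι → ℝ), IsOpen N ∧ βbar ∈ N ∧ N ⊆ S ∧
      (∀ u, ContDiffOn ℝ 2 (fun β => Real.log (g β u)) N) ∧
      ∀ u, ContDiffOn ℝ 2 (fun β => g β u) N := by
  obtain ⟨N, hN, hβN, hNS, hlog, -⟩ := hR.smooth
  exact ⟨N, hN, hβN, hNS, hlog, fun u =>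
    contDiffOn_of_log hNS (fun β hβ => hnn β hβ u) (hR.support u) (hlog u)⟩

/-- Lagrange's remainder, with the dominating function evaluated uniformly over the ball. It
justifies both second differences and differentiation under the integral sign. -/
lemma DominatedHess.exists_taylor_bound {Q : Measure U} {g : (ι → ℝ) → U → ℝ}
    (hnn : ∀ β ∈ S, ∀ u, 0 ≤ g β u) (hR : Regular S βbar Q r g) (hD : DominatedHess βbar μ g) :
    ∃ ρ > 0, Metric.ball βbar ρ ⊆ S ∧ ∃ D : U → ℝ, Integrable D μ ∧ ∀ u δ, ‖δ‖ < ρ →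
      |g (βbar + δ) u - g βbar u - grad (fun β => g β u) βbar ⬝ᵥ δ| ≤ D u * ‖δ‖ ^ 2 := by
  obtain ⟨N, hN, hβN, hNS, -, hCD⟩ := hR.contDiffOn_density hnn
  obtain ⟨N', hN', hβN', D, iD, hDb⟩ := hD
  obtain ⟨ρ, hρ, hball⟩ := Metric.isOpen_iff.1 (hN.inter hN') βbar ⟨hβN, hβN'⟩
  refine ⟨ρ, hρ, fun b hb => hNS (hball hb).1, fun u => (∑ _i : ι, ∑ _j : ι, 1 / 2 * D u),
    integrable_finsetSum _ fun i _ => integrable_finsetSum _ fun j _ => iD.const_mul _,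
    fun u δ hδ => ?_⟩
  obtain ⟨ξ, hξ, e⟩ := exists_taylor_two ((hCD u).mono fun b hb => (hball hb).1) hδ
  rw [e, abs_mul]
  have h1 := abs_dotProduct_mulVec_le (hess (fun β => g β u) ξ) δ
  have h2 : (∑ i, ∑ j, |hess (fun β => g β u) ξ i j|) ≤ ∑ _i : ι, ∑ _j : ι, D u :=
    Finset.sum_le_sum fun i _ => Finset.sum_le_sum fun j _ => hDb u ξ (hball hξ).2 i j
  have h3 : (∑ _i : ι, ∑ _j : ι, 1 / 2 * D u) = 1 / 2 * ∑ _i : ι, ∑ _j : ι, D u := by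
    simp only [Finset.mul_sum]
  have h4 : |(1 / 2 : ℝ)| = 1 / 2 := by norm_num
  beta_reduce
  rw [h3, h4, mul_assoc]
  exact mul_le_mul_of_nonneg_left
    (h1.trans (mul_le_mul_of_nonneg_right h2 (by positivity))) (by norm_num)

/-- The Taylor bounds at `δ` and `-δ` add up and their gradients cancel. The resulting condition no
longer mentions derivatives, so it can pass to marginals. -/
lemma DominatedHess.dominatedDiff {Q : Measure U} {g : (ι → ℝ) → U → ℝ}
    (hnn : ∀ β ∈ S, ∀ u, 0 ≤ g β u) (hR : Regular S βbar Q r g) (hD : DominatedHess βbar μ g) :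
    DominatedDiff βbar μ g := by
  obtain ⟨ρ, hρ, -, D, iD, hb⟩ := hD.exists_taylor_bound hnn hR
  refine ⟨ρ, hρ, fun u => 2 * D u, iD.const_mul 2, fun δ hδ => ae_of_all _ fun u => ?_⟩
  have h1 := abs_le.1 (hb u δ hδ)
  have h2 := abs_le.1 (hb u (-δ) (by rwa [norm_neg]))
  rw [dotProduct_neg, norm_neg, ← sub_eq_add_neg] at h2
  rw [abs_le]
  constructor <;> linarith [h1.1, h1.2, h2.1, h2.2]

variable [SigmaFinite μ] [SigmaFinite ν] {g : (ι → ℝ) → U × T → ℝ} {h : (ι → ℝ) → U → ℝ}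

/-- A bound on second differences can simply be integrated over the discarded variable. Marginals
agree with the integrals only almost everywhere, with a null set depending on `δ`, which the
definition of `DominatedDiff` allows. -/
lemma DominatedDiff.marginal (hS : S ∈ 𝓝 βbar) (hdens : ∀ β ∈ S, IsDensity (μ.prod ν) (g β))
    (hmarg : ∀ β ∈ S, ∀ᵐ u ∂μ, h β u = ∫ t, g β (u, t) ∂ν)
    (hD : DominatedDiff βbar (μ.prod ν) g) : DominatedDiff βbar μ h := by
  obtain ⟨ρ₁, hρ₁, D, iD, hb⟩ := hD
  obtain ⟨ρ₂, hρ₂, hball⟩ := Metric.mem_nhds_iff.1 hS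
  refine ⟨min ρ₁ ρ₂, lt_min hρ₁ hρ₂, fun u => ∫ t, D (u, t) ∂ν, iD.integral_prod_left,
    fun δ hδ => ?_⟩
  have m1 : βbar + δ ∈ S := hball (by
    simpa [mem_ball_iff_norm] using hδ.trans_le (min_le_right _ _))
  have m2 : βbar - δ ∈ S := hball (by
    rw [mem_ball_iff_norm, sub_sub_cancel_left, norm_neg]
    exact hδ.trans_le (min_le_right _ _))
  have m3 : βbar ∈ S := mem_of_mem_nhds hS
  filter_upwards [hmarg _ m1, hmarg _ m2, hmarg _ m3, (hdens _ m1).integrable.prod_right_ae,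
    (hdens _ m2).integrable.prod_right_ae, (hdens _ m3).integrable.prod_right_ae,
    iD.prod_right_ae, Measure.ae_ae_of_ae_prod (hb δ (hδ.trans_le (min_le_left _ _)))]
    with u e1 e2 e3 i1 i2 i3 i4 hbu
  have e : h (βbar + δ) u + h (βbar - δ) u - 2 * h βbar u = ∫ t, (g (βbar + δ) (u, t) +
      g (βbar - δ) (u, t) - 2 * g βbar (u, t)) ∂ν := by
    rw [integral_sub (f := fun t => g (βbar + δ) (u, t) + g (βbar - δ) (u, t)) (i1.add i2)
      (i3.const_mul 2), integral_add i1 i2, integral_const_mul, e1, e2, e3]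
  rw [e, ← integral_mul_const]
  exact abs_integral_le_integral_abs.trans
    (integral_mono_ae ((i1.add i2).sub (i3.const_mul 2)).abs (i4.mul_const _) hbu)

/-- Differentiation under the integral on almost every section: both sides are limits of the same
difference quotients of the marginal. After division by the marginal this says that the marginal
score is a conditional mean. -/
lemma integral_score_section (hdens : ∀ β ∈ S, IsDensity (μ.prod ν) (g β))
    (hmarg : ∀ β ∈ S, ∀ᵐ u ∂μ, h β u = ∫ t, g β (u, t) ∂ν) (hnn : ∀ β ∈ S, ∀ u, 0 ≤ h β u)
    (hg : Regular S βbar (densMeasure (μ.prod ν) (g βbar)) r g) {Q : Measure U}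
    (hh : Regular S βbar Q s h) (hD : DominatedHess βbar (μ.prod ν) g) (i : ι) :
    ∀ᵐ u ∂μ, ∫ t, g βbar (u, t) * grad (fun β => Real.log (g β (u, t))) βbar i ∂ν =
      h βbar u * grad (fun β => Real.log (h β u)) βbar i := by
  have gnn : ∀ β ∈ S, ∀ u, 0 ≤ g β u := fun β hβ => (hdens β hβ).nonneg
  obtain ⟨ρ, hρ, hball, D, iD, hb⟩ := hD.exists_taylor_bound gnn hg
  obtain ⟨N, hN, hβN, hNS, -, hCD⟩ := hg.contDiffOn_density gnn
  obtain ⟨N', hN', hβN', hNS', -, hCD'⟩ := hh.contDiffOn_density hnn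
  have hbar := hg.mem
  set v : ι → ℝ := Pi.single i 1 with hv
  have hv1 : ‖v‖ = 1 := by simp [hv, Pi.norm_single]
  obtain ⟨t, tpos, tlim, tv⟩ := exists_seq_norm_smul_lt v (lt_min hρ one_pos)
  have hmem : ∀ n, βbar + t n • v ∈ S := fun n => hball (by
    simpa [mem_ball_iff_norm] using (tv n).trans_le (min_le_left _ _))
  -- First-order convergence is read off from the second-order limit, multiplied by `t n → 0`.
  have hquot : ∀ {p : (ι → ℝ) → ℝ} {N : Set (ι → ℝ)}, IsOpen N → ContDiffOn ℝ 2 p N → βbar ∈ N →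
      Tendsto (fun n => (p (βbar + t n • v) - p βbar) / t n) atTop (𝓝 (grad p βbar i)) := by
    intro p N hN hp hβ
    have h1 := tendsto_hess_segment hN hp hβ v (fun n => (tpos n).ne') tlim
    have h2 := (h1.mul tlim).add_const (grad p βbar i)
    rw [mul_zero, zero_add] at h2
    refine h2.congr fun n => ?_
    have h3 : grad p βbar ⬝ᵥ (t n • v) = t n * grad p βbar i := by
      rw [dotProduct_smul, hv, dotProduct_single_one, smul_eq_mul]
    have := (tpos n).ne'
    rw [h3]
    field_simp
    ring
  have iG : Integrable (fun c => g βbar c * grad (fun β => Real.log (g β c)) βbar i)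
      (μ.prod ν) := by
    have := (hdens _ hbar).isProbabilityMeasure
    exact (hdens _ hbar).integrable_densMeasure_iff.1
      ((hg.memLp_grad (fun β hβ => (hdens β hβ).measurable) i).integrable (by norm_num))
  -- Only countably many parameters occur along the sequence, so their exceptional null sets can be
  -- united.
  have hall := ae_all_iff.2 fun n => hmarg _ (hmem n)
  have hint := ae_all_iff.2 fun n => (hdens _ (hmem n)).integrable.prod_right_ae
  filter_upwards [hall, hint, hmarg _ hbar, (hdens _ hbar).integrable.prod_right_ae,
    iD.prod_right_ae, iG.prod_right_ae] with u e1 i1 e0 i0 iDu iGu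
  have hgrad : ∀ x, grad (fun β => g β (u, x)) βbar i =
      g βbar (u, x) * grad (fun β => Real.log (g β (u, x))) βbar i := fun x =>
    grad_eq_mul_grad_log hN hNS (hg.support _) (hCD _) hβN i
  have lim1 : Tendsto (fun n => ∫ x, (g (βbar + t n • v) (u, x) - g βbar (u, x)) / t n ∂ν) atTop
      (𝓝 (∫ x, g βbar (u, x) * grad (fun β => Real.log (g β (u, x))) βbar i ∂ν)) := by
    refine tendsto_integral_of_dominated_convergence
      (fun x => |g βbar (u, x) * grad (fun β => Real.log (g β (u, x))) βbar i| + |D (u, x)|)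
      (fun n => ((i1 n).sub i0).aestronglyMeasurable.mul_const (t n)⁻¹)
      (iGu.abs.add iDu.abs)
      (fun n => ae_of_all _ fun x => ?_) (ae_of_all _ fun x => ?_)
    · have h1 := hb (u, x) (t n • v) ((tv n).trans_le (min_le_left _ _))
      have h2 : t n < 1 := by
        have := (tv n).trans_le (min_le_right _ _)
        rwa [norm_smul, hv1, mul_one, Real.norm_of_nonneg (tpos n).le] at this
      rw [norm_smul, hv1, mul_one, Real.norm_of_nonneg (tpos n).le, dotProduct_smul, hv,
        dotProduct_single_one, smul_eq_mul, hgrad] at h1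
      rw [Real.norm_eq_abs, abs_div, abs_of_pos (tpos n), div_le_iff₀ (tpos n)]
      set a := g βbar (u, x) * grad (fun β => Real.log (g β (u, x))) βbar i
      have h3 : D (u, x) * t n ^ 2 ≤ |D (u, x)| * t n := by
        have h5 : t n ^ 2 ≤ t n := by nlinarith [tpos n]
        exact (mul_le_mul_of_nonneg_right (le_abs_self _) (by positivity)).trans
          (mul_le_mul_of_nonneg_left h5 (abs_nonneg _))
      have h6 : |t n * a| = |a| * t n := by rw [abs_mul, abs_of_pos (tpos n), mul_comm]
      have h7 := abs_add_le (g (βbar + t n • v) (u, x) - g βbar (u, x) - t n * a) (t n * a)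
      rw [sub_add_cancel, h6] at h7
      linarith
    · rw [← hgrad]
      exact hquot hN (hCD (u, x)) hβN
  have lim2 : Tendsto (fun n => (h (βbar + t n • v) u - h βbar u) / t n) atTop
      (𝓝 (h βbar u * grad (fun β => Real.log (h β u)) βbar i)) := by
    rw [← grad_eq_mul_grad_log hN' hNS' (hh.support u) (hCD' u) hβN' i]
    exact hquot hN' (hCD' u) hβN'
  refine tendsto_nhds_unique lim1 (lim2.congr fun n => ?_)
  rw [integral_div, integral_sub (i1 n) i0, e1 n, e0]

/-- The score of a marginal is the conditional mean of the score. -/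
lemma integral_score_mul_score (hdens : ∀ β ∈ S, IsDensity (μ.prod ν) (g β))
    (hdens' : ∀ β ∈ S, IsDensity μ (h β))
    (hmarg : ∀ β ∈ S, ∀ᵐ u ∂μ, h β u = ∫ t, g β (u, t) ∂ν)
    (hg : Regular S βbar (densMeasure (μ.prod ν) (g βbar)) r g)
    (hh : Regular S βbar (densMeasure μ (h βbar)) s h)
    (hD : DominatedHess βbar (μ.prod ν) g) (i j : ι) :
    ∫ c, grad (fun β => Real.log (g β c)) βbar i * grad (fun β => Real.log (h β c.1)) βbar j
        ∂(densMeasure (μ.prod ν) (g βbar)) =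
      ∫ u, grad (fun β => Real.log (h β u)) βbar i * grad (fun β => Real.log (h β u)) βbar j
        ∂(densMeasure μ (h βbar)) := by
  have hbar := hg.mem
  have hp := hdens _ hbar
  have hmap : (densMeasure (μ.prod ν) (g βbar)).map Prod.fst = densMeasure μ (h βbar) := by
    rw [hp.map_fst]
    exact densMeasure_congr ((hmarg _ hbar).mono fun u hu => hu.symm)
  have lj : MemLp (fun c : U × T => grad (fun β => Real.log (h β c.1)) βbar j) 2
      (densMeasure (μ.prod ν) (g βbar)) :=
    (hh.memLp_grad (fun β hβ => (hdens' β hβ).measurable) j).comp_measurePreserving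
      ⟨measurable_fst, hmap⟩
  have li := hg.memLp_grad (fun β hβ => (hdens β hβ).measurable) i
  have hi := hp.integrable_densMeasure_iff.1 (li.integrable_mul lj)
  rw [hp.integral_densMeasure, (hdens' _ hbar).integral_densMeasure]
  refine (integral_prod _ hi).trans ?_
  refine integral_congr_ae ?_
  filter_upwards [integral_score_section hdens hmarg (fun β hβ => (hdens' β hβ).nonneg)
    hg hh hD i] with u hu
  simp only [Pi.mul_apply]
  simp_rw [← mul_assoc]
  rw [integral_mul_const, hu]

end Cross

/-! ### Consistency and uniform expansion of the log-likelihood -/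

section Uniform

open Matrix

variable {ι : Type} [Fintype ι] [DecidableEq ι] {Ω U : Type*} [MeasurableSpace Ω]
  [MeasurableSpace U] {P : Measure Ω} [IsProbabilityMeasure P] {S : Set (ι → ℝ)} {βbar : ι → ℝ}
  {Q : Measure U} {X : ℕ → Ω → U} {g : (ι → ℝ) → U → ℝ}

lemma sampleMean_mono {φ ψ : U → ℝ} (h : ∀ u, φ u ≤ ψ u) (n : ℕ) (ω : Ω) :
    sampleMean X φ n ω ≤ sampleMean X ψ n ω :=
  mul_le_mul_of_nonneg_left (Finset.sum_le_sum fun _ _ => h _) (by positivity)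

lemma sampleMean_sub (φ ψ : U → ℝ) (n : ℕ) (ω : Ω) :
    sampleMean X (fun u => φ u - ψ u) n ω = sampleMean X φ n ω - sampleMean X ψ n ω := by
  simp only [sampleMean, Finset.sum_sub_distrib]
  ring

lemma sampleMean_mul_const (φ : U → ℝ) (c : ℝ) (n : ℕ) (ω : Ω) :
    sampleMean X (fun u => φ u * c) n ω = sampleMean X φ n ω * c := by
  simp only [sampleMean, ← Finset.sum_mul]
  ring

lemma sampleMean_sum {κ : Type*} (s : Finset κ) (φ : κ → U → ℝ) (n : ℕ) (ω : Ω) :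
    sampleMean X (fun u => ∑ k ∈ s, φ k u) n ω = ∑ k ∈ s, sampleMean X (φ k) n ω := by
  simp only [sampleMean]
  rw [Finset.sum_comm, Finset.mul_sum]

lemma abs_sampleMean_le (φ : U → ℝ) (n : ℕ) (ω : Ω) :
    |sampleMean X φ n ω| ≤ sampleMean X (fun u => |φ u|) n ω := by
  rw [sampleMean, abs_mul, abs_of_nonneg (by positivity : (0 : ℝ) ≤ 1 / n)]
  exact mul_le_mul_of_nonneg_left (Finset.abs_sum_le_sum_abs _ _) (by positivity)

lemma sampleMean_dotProduct (G : U → ι → ℝ) (δ : ι → ℝ) (n : ℕ) (ω : Ω) :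
    sampleMean X (fun u => G u ⬝ᵥ δ) n ω = (fun i => sampleMean X (fun u => G u i) n ω) ⬝ᵥ δ := by
  simp only [dotProduct]
  rw [sampleMean_sum]
  simp only [sampleMean_mul_const]

lemma sampleMean_quadratic (H : U → Matrix ι ι ℝ) (δ : ι → ℝ) (n : ℕ) (ω : Ω) :
    sampleMean X (fun u => δ ⬝ᵥ (H u *ᵥ δ)) n ω =
      δ ⬝ᵥ ((Matrix.of fun i j => sampleMean X (fun u => H u i j) n ω) *ᵥ δ) := by
  simp_rw [dotProduct_comm δ]
  rw [sampleMean_dotProduct (fun u => H u *ᵥ δ)]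
  congr 1
  ext i
  exact sampleMean_dotProduct (fun u => H u i) δ n ω

/-- Near a parameter of smaller mean log-density, the log-likelihood ratio has a majorant of
negative mean. -/
lemma Regular.exists_local_majorant (hR : Regular S βbar Q 2 g) [IsFiniteMeasure Q]
    (hg : ∀ β ∈ S, Measurable (g β)) {β : ι → ℝ} (hβ : β ∈ S)
    (hlt : ∫ u, Real.log (g β u) ∂Q < ∫ u, Real.log (g βbar u) ∂Q) :
    ∃ ε > 0, ∃ W : U → ℝ, Measurable W ∧ MemLp W 2 Q ∧ ∫ u, W u ∂Q < 0 ∧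
      ∀ u, ∀ b ∈ S ∩ Metric.ball β ε, Real.log (g b u) - Real.log (g βbar u) ≤ W u := by
  obtain ⟨m, lm, hm⟩ := hR.envelope
  set ρ : ℕ → ℝ := fun k => 1 / ((k : ℝ) + 1) with hρ
  have ρpos : ∀ k, 0 < ρ k := fun k => by positivity
  have ρlim : Tendsto ρ atTop (𝓝 0) := tendsto_one_div_add_atTop_nhds_zero_nat
  have hb : ∀ u, ∀ b ∈ S, |Real.log (g b u) - Real.log (g βbar u)| ≤ 2 * m u := by
    intro u b hb
    have h1 := hm u b hb
    have h2 := hm u βbar hR.mem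
    have h3 := abs_sub (Real.log (g b u)) (Real.log (g βbar u))
    linarith
  have hw : ∀ k, ∃ w : U → ℝ, Measurable w ∧
      (∀ u (t : ↑(S ∩ Metric.ball β (ρ k))), Real.log (g t u) - Real.log (g βbar u) ≤ w u) ∧
      ∀ u c, (∀ t : ↑(S ∩ Metric.ball β (ρ k)), Real.log (g t u) - Real.log (g βbar u) ≤ c) →
        w u ≤ c := by
    intro k
    have : Nonempty ↑(S ∩ Metric.ball β (ρ k)) := ⟨β, hβ, Metric.mem_ball_self (ρpos k)⟩
    refine exists_measurable_iSup (T := ↑(S ∩ Metric.ball β (ρ k)))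
      (f := fun t u => Real.log (g t u) - Real.log (g βbar u))
      (fun t => (hg t t.2.1).log.sub (hg βbar hR.mem).log) (fun u => ?_)
      fun u => ⟨2 * m u, fun t => (le_abs_self _).trans (hb u t t.2.1)⟩
    exact (continuousOn_iff_continuous_domRestrict.1
      ((hR.continuousOn u).mono Set.inter_subset_left)).sub continuous_const
  choose w mw wge wle using hw
  have wlo : ∀ k u, Real.log (g β u) - Real.log (g βbar u) ≤ w k u := fun k u =>
    wge k u ⟨β, hβ, Metric.mem_ball_self (ρpos k)⟩
  have wb : ∀ k u, |w k u| ≤ 2 * m u := fun k u => abs_le.2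
    ⟨(abs_le.1 (hb u β hβ)).1.trans (wlo k u),
      wle k u _ fun t => (le_abs_self _).trans (hb u t t.2.1)⟩
  have l2m : MemLp (fun u => 2 * m u) 2 Q := lm.const_mul 2
  -- By continuity at `β` the suprema over shrinking balls tend to the log-ratio at `β`, whose mean
  -- is negative by `hlt`; hence some ball already has a majorant of negative mean.
  have lim : Tendsto (fun k => ∫ u, w k u ∂Q) atTop
      (𝓝 (∫ u, (Real.log (g β u) - Real.log (g βbar u)) ∂Q)) := by
    refine tendsto_integral_of_dominated_convergence (fun u => 2 * m u)
      (fun k => (mw k).aestronglyMeasurable) (l2m.integrable (by norm_num))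
      (fun k => ae_of_all _ fun u => wb k u) (ae_of_all _ fun u => ?_)
    rw [Metric.tendsto_atTop]
    intro ε hε
    obtain ⟨d, hd, hfd⟩ := Metric.continuousWithinAt_iff.1 (hR.continuousOn u β hβ) (ε / 2)
      (by positivity)
    obtain ⟨K, hK⟩ := (ρlim.eventually (gt_mem_nhds hd)).exists_forall_of_atTop
    refine ⟨K, fun k hk => ?_⟩
    have h1 : w k u ≤ Real.log (g β u) - Real.log (g βbar u) + ε / 2 := by
      refine wle k u _ fun t => ?_
      have h1 := hfd t.2.1 ((Metric.mem_ball.1 t.2.2).trans (hK k hk))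
      rw [Real.dist_eq] at h1
      linarith [(abs_le.1 h1.le).2]
    have h2 := wlo k u
    rw [Real.dist_eq, abs_of_nonneg (by linarith)]
    linarith
  rw [integral_sub ((hR.memLp_log hg hβ).integrable (by norm_num))
    ((hR.memLp_log hg hR.mem).integrable (by norm_num))] at lim
  obtain ⟨k, hk⟩ := (lim.eventually (gt_mem_nhds (sub_neg.2 hlt))).exists
  exact ⟨ρ k, ρpos k, w k, mw k, l2m.mono (mw k).aestronglyMeasurable
    (ae_of_all _ fun u => (wb k u).trans (le_abs_self _)), hk, fun u b hb => wge k u ⟨b, hb⟩⟩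

/-- Consistency of the maximum likelihood estimator with rate `o(1/n)` for the probabilities. -/
lemma Regular.negligible_argmax (hR : Regular S βbar Q 2 g) (hX : IID P Q X)
    (hg : ∀ β ∈ S, Measurable (g β)) (hS : IsCompact S)
    (hlt : ∀ β ∈ S, β ≠ βbar → ∫ u, Real.log (g β u) ∂Q < ∫ u, Real.log (g βbar u) ∂Q)
    {βhat : ℕ → Ω → ι → ℝ} (hmem : ∀ n ω, βhat n ω ∈ S)
    (hmax : ∀ n ω, sampleMean X (fun u => Real.log (g βbar u)) n ω ≤
      sampleMean X (fun u => Real.log (g (βhat n ω) u)) n ω) {ε : ℝ} (hε : 0 < ε) :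
    Negligible P fun n => {ω | ε ≤ ‖βhat n ω - βbar‖} := by
  have := hX.isProbabilityMeasure
  have hK : IsCompact (S \ Metric.ball βbar ε) := hS.diff Metric.isOpen_ball
  have key : Negligible P fun n => {ω | βhat n ω ∈ S \ Metric.ball βbar ε} := by
    -- Wald's argument: negligibility is stable under subsets and finite unions, so by compactness
    -- it need only be shown near each point.
    refine hK.induction_on (p := fun s => Negligible P fun n => {ω | βhat n ω ∈ s}) ?_ ?_ ?_ ?_
    · simpa using Negligible.empty
    · exact fun s t hst ht => ht.mono fun n ω hω => hst hω
    · exact fun s t hs ht => hs.union ht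
    · intro β hβ
      have hne : β ≠ βbar := by
        rintro rfl
        exact hβ.2 (Metric.mem_ball_self hε)
      obtain ⟨d, hd, W, mW, lW, hW0, hW⟩ := hR.exists_local_majorant hg hβ.1 (hlt β hβ.1 hne)
      refine ⟨Metric.ball β d, mem_nhdsWithin_of_mem_nhds (Metric.ball_mem_nhds β hd), ?_⟩
      -- If the estimator lies in this ball, the sample mean of `W` is nonnegative while its
      -- expectation is negative, so it deviates by at least `-∫ W`.
      refine (hX.negligible_sampleMean mW lW
        (κ := -∫ u, W u ∂Q) (by linarith)).mono fun n ω hω => ?_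
      have h1 : sampleMean X (fun u => Real.log (g (βhat n ω) u) - Real.log (g βbar u)) n ω ≤
          sampleMean X W n ω := sampleMean_mono (fun u => hW u _ ⟨hmem n ω, hω⟩) n ω
      rw [sampleMean_sub] at h1
      have h2 := hmax n ω
      change -∫ u, W u ∂Q ≤ |sampleMean X W n ω - ∫ u, W u ∂Q|
      refine le_trans ?_ (le_abs_self _)
      linarith
  refine key.mono fun n ω hω => ⟨hmem n ω, fun h => ?_⟩
  rw [mem_ball_iff_norm] at h
  exact absurd hω (not_le.2 h)

/-- Up to events of probability `o(1/n)`, the log-likelihood has a uniform second order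
expansion. -/
lemma Regular.sampleMean_expansion (hR : Regular S βbar Q 2 g) (hX : IID P Q X)
    (hg : ∀ β ∈ S, Measurable (g β)) {η : ℝ} (hη : 0 < η) :
    ∃ ρ > 0, ∃ A : ℕ → Set Ω, Negligible P A ∧ ∀ n, ∀ ω ∉ A n, ∀ δ, ‖δ‖ < ρ →
      |sampleMean X (fun u => Real.log (g (βbar + δ) u)) n ω
        - sampleMean X (fun u => Real.log (g βbar u)) n ω
        - (fun i => sampleMean X (fun u => grad (fun β => Real.log (g β u)) βbar i) n ω) ⬝ᵥ δ
        + 1 / 2 * (δ ⬝ᵥ (info Q g βbar *ᵥ δ))| ≤ η * ‖δ‖ ^ 2 := by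
  have := hX.isProbabilityMeasure
  set c : ℝ := ∑ _i : ι, ∑ _j : ι, (1 : ℝ) with hc
  have hc0 : 0 ≤ c := by positivity
  -- The error budget: mean and deviation of `w` cost `κ` each, and the deviations of the Hessian
  -- entries cost at most `κ` apiece, `c` being their number.
  set κ : ℝ := η / (2 + c) with hκ
  have hκ0 : 0 < κ := by positivity
  obtain ⟨ρ, hρ, hsub, w, mw, lw, w0, hw, hexp⟩ := hR.exists_expansion hg (by norm_num) hκ0
  refine ⟨ρ, hρ, fun n => {ω | κ ≤ |sampleMean X w n ω - ∫ u, w u ∂Q|} ∪ ⋃ i, ⋃ j,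
    {ω | κ ≤ |sampleMean X (fun u => hess (fun β => Real.log (g β u)) βbar i j) n ω -
      ∫ u, hess (fun β => Real.log (g β u)) βbar i j ∂Q|}, ?_, ?_⟩
  · exact (hX.negligible_sampleMean mw lw hκ0).union (Negligible.iUnion fun i =>
      Negligible.iUnion fun j => hX.negligible_sampleMean (hR.measurable_hess hg i j)
        (hR.memLp_hess hg i j) hκ0)
  · intro n ω hω δ hδ
    simp only [Set.mem_union, Set.mem_iUnion, not_or, not_exists, Set.mem_ofPred_eq, not_le] at hω
    obtain ⟨hω1, hω2⟩ := hω
    set Hbar : Matrix ι ι ℝ := Matrix.of fun i j =>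
      sampleMean X (fun u => hess (fun β => Real.log (g β u)) βbar i j) n ω with hHbar
    have h1 : |sampleMean X (fun u => Real.log (g (βbar + δ) u)) n ω
        - sampleMean X (fun u => Real.log (g βbar u)) n ω
        - (fun i => sampleMean X (fun u => grad (fun β => Real.log (g β u)) βbar i) n ω) ⬝ᵥ δ
        - 1 / 2 * (δ ⬝ᵥ (Hbar *ᵥ δ))| ≤ sampleMean X w n ω * ‖δ‖ ^ 2 := by
      have e : sampleMean X (fun u => Real.log (g (βbar + δ) u)) n ω
          - sampleMean X (fun u => Real.log (g βbar u)) n ω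
          - (fun i => sampleMean X (fun u => grad (fun β => Real.log (g β u)) βbar i) n ω) ⬝ᵥ δ
          - 1 / 2 * (δ ⬝ᵥ (Hbar *ᵥ δ)) =
          sampleMean X (fun u => Real.log (g (βbar + δ) u) - Real.log (g βbar u)
            - grad (fun β => Real.log (g β u)) βbar ⬝ᵥ δ
            - (δ ⬝ᵥ (hess (fun β => Real.log (g β u)) βbar *ᵥ δ)) * (1 / 2)) n ω := by
        rw [sampleMean_sub, sampleMean_sub, sampleMean_sub, sampleMean_mul_const,
          sampleMean_dotProduct, sampleMean_quadratic, mul_comm (1 / 2 : ℝ)]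
      rw [e, ← sampleMean_mul_const]
      refine (abs_sampleMean_le _ n ω).trans (sampleMean_mono (fun u => ?_) n ω)
      rw [mul_comm _ (1 / 2 : ℝ)]
      exact hexp u δ hδ
    have h2 : |δ ⬝ᵥ ((Hbar + info Q g βbar) *ᵥ δ)| ≤ c * κ * ‖δ‖ ^ 2 := by
      refine (abs_dotProduct_mulVec_le _ δ).trans ?_
      refine mul_le_mul_of_nonneg_right ?_ (by positivity)
      rw [hc, Finset.sum_mul]
      refine Finset.sum_le_sum fun i _ => ?_
      rw [Finset.sum_mul]
      refine Finset.sum_le_sum fun j _ => ?_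
      rw [one_mul]
      have e : (Hbar + info Q g βbar) i j =
          sampleMean X (fun u => hess (fun β => Real.log (g β u)) βbar i j) n ω -
            ∫ u, hess (fun β => Real.log (g β u)) βbar i j ∂Q := by
        simp only [Matrix.add_apply, hHbar, info, Matrix.of_apply]
        ring
      rw [e]
      exact (hω2 i j).le
    rw [add_mulVec, dotProduct_add] at h2
    have h3 : sampleMean X w n ω * ‖δ‖ ^ 2 ≤ 2 * κ * ‖δ‖ ^ 2 := by
      refine mul_le_mul_of_nonneg_right ?_ (by positivity)
      linarith [(abs_lt.1 hω1).2]
    have h4 : η = 2 * κ + c * κ := by rw [hκ]; field_simp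
    have h5 : 0 ≤ c * κ * ‖δ‖ ^ 2 := mul_nonneg (mul_nonneg hc0 hκ0.le) (sq_nonneg _)
    rw [h4, add_mul]
    rw [abs_le] at h1 h2 ⊢
    constructor <;> linarith [h1.1, h1.2, h2.1, h2.2]

end Uniform

/-! ### Deterministic comparison of quadratic maximizers -/

section Quadratic

open Matrix

variable {ι : Type} [Fintype ι] [DecidableEq ι]

/-- A symmetric positive semidefinite nonsingular matrix is bounded below. -/
lemma exists_lower_bound {A : Matrix ι ι ℝ} (hA : A.IsSymm) (hpos : ∀ v, 0 ≤ v ⬝ᵥ (A *ᵥ v))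
    (hdet : IsUnit A.det) : ∃ l > 0, ∀ v, l * ‖v‖ ^ 2 ≤ v ⬝ᵥ (A *ᵥ v) := by
  have hpsd : A.PosSemidef := Matrix.PosSemidef.of_dotProduct_mulVec_nonneg
    (by rw [IsHermitian, conjTranspose_eq_transpose_of_trivial]; exact hA) (by simpa using hpos)
  have hpd : A.PosDef := hpsd.posDef_iff_isUnit.2 ((isUnit_iff_isUnit_det A).2 hdet)
  have hcont : Continuous fun v : ι → ℝ => v ⬝ᵥ (A *ᵥ v) := by
    simp only [dotProduct, mulVec]
    fun_prop
  -- The unit sphere is empty when there are no parameters; otherwise the minimum of the form on the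
  -- sphere is the constant.
  rcases (Metric.sphere (0 : ι → ℝ) 1).eq_empty_or_nonempty with he | hne
  · refine ⟨1, one_pos, fun v => ?_⟩
    have hv : v = 0 := by
      by_contra hv
      have : (‖v‖⁻¹ • v) ∈ Metric.sphere (0 : ι → ℝ) 1 := by
        rw [mem_sphere_zero_iff_norm, norm_smul, norm_inv, norm_norm,
          inv_mul_cancel₀ (norm_ne_zero_iff.2 hv)]
      rw [he] at this
      exact this
    simp [hv]
  · obtain ⟨x, hx, hmin⟩ := (isCompact_sphere (0 : ι → ℝ) 1).exists_isMinOn hne hcont.continuousOn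
    have hx0 : x ≠ 0 := by
      rintro rfl
      simp at hx
    refine ⟨x ⬝ᵥ (A *ᵥ x), by simpa using hpd.dotProduct_mulVec_pos hx0, fun v => ?_⟩
    rcases eq_or_ne v 0 with rfl | hv
    · simp
    · have hs : (‖v‖⁻¹ • v) ∈ Metric.sphere (0 : ι → ℝ) 1 := by
        rw [mem_sphere_zero_iff_norm, norm_smul, norm_inv, norm_norm,
          inv_mul_cancel₀ (norm_ne_zero_iff.2 hv)]
      have h1 : x ⬝ᵥ (A *ᵥ x) ≤ (‖v‖⁻¹ • v) ⬝ᵥ (A *ᵥ (‖v‖⁻¹ • v)) := hmin hs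
      rw [mulVec_smul, dotProduct_smul, smul_dotProduct, smul_eq_mul, smul_eq_mul] at h1
      have hv' : 0 < ‖v‖ := norm_pos_iff.2 hv
      calc x ⬝ᵥ (A *ᵥ x) * ‖v‖ ^ 2
          ≤ (‖v‖⁻¹ * (‖v‖⁻¹ * (v ⬝ᵥ (A *ᵥ v)))) * ‖v‖ ^ 2 := by gcongr
        _ = v ⬝ᵥ (A *ᵥ v) := by field_simp

lemma dotProduct_mulVec_comm {A : Matrix ι ι ℝ} (hA : A.IsSymm) (x y : ι → ℝ) :
    x ⬝ᵥ (A *ᵥ y) = y ⬝ᵥ (A *ᵥ x) := by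
  rw [dotProduct_mulVec, ← mulVec_transpose, hA.eq, dotProduct_comm]

lemma norm_sq_le_dotProduct (v : ι → ℝ) : ‖v‖ ^ 2 ≤ v ⬝ᵥ v := by
  have h0 : 0 ≤ v ⬝ᵥ v := Finset.sum_nonneg fun i _ => mul_self_nonneg _
  have : ‖v‖ ≤ Real.sqrt (v ⬝ᵥ v) := by
    refine (pi_norm_le_iff_of_nonneg (Real.sqrt_nonneg _)).2 fun i => ?_
    refine Real.le_sqrt_of_sq_le ?_
    rw [Real.norm_eq_abs, sq_abs, sq]
    exact Finset.single_le_sum (f := fun i => v i * v i) (fun i _ => mul_self_nonneg _)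
      (Finset.mem_univ i)
  calc ‖v‖ ^ 2 ≤ Real.sqrt (v ⬝ᵥ v) ^ 2 := by gcongr
    _ = v ⬝ᵥ v := Real.sq_sqrt h0

lemma abs_dotProduct_le (x y : ι → ℝ) : |x ⬝ᵥ y| ≤ Fintype.card ι * (‖x‖ * ‖y‖) := by
  simp only [dotProduct]
  refine (Finset.abs_sum_le_sum_abs _ _).trans ?_
  have : ∀ i ∈ Finset.univ, |x i * y i| ≤ ‖x‖ * ‖y‖ := fun i _ => by
    rw [abs_mul]
    exact mul_le_mul (norm_le_pi_norm x i) (norm_le_pi_norm y i) (abs_nonneg _) (norm_nonneg _)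
  refine (Finset.sum_le_sum this).trans_eq ?_
  simp

lemma exists_norm_mulVec_le (A : Matrix ι ι ℝ) : ∃ c > 0, ∀ v, ‖A *ᵥ v‖ ≤ c * ‖v‖ := by
  obtain ⟨c, hc, h⟩ := (LinearMap.toContinuousLinearMap (Matrix.mulVecLin A)).isBoundedLinearMap.bound
  exact ⟨c, hc, fun v => by simpa using h v⟩

/-- An approximate maximizer of a perturbed concave quadratic function is close to its exact
maximizer. -/
lemma norm_sub_argmax_sq_le {A : Matrix ι ι ℝ} (hA : A.IsSymm) {l : ℝ} (hl : 0 < l)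
    (hlow : ∀ v, l * ‖v‖ ^ 2 ≤ v ⬝ᵥ (A *ᵥ v)) {η : ℝ} (hη : 0 ≤ η) (hηl : η ≤ l / 8)
    {g h δ : ι → ℝ} (hg : A *ᵥ h = g)
    (hopt : g ⬝ᵥ h - 1 / 2 * (h ⬝ᵥ (A *ᵥ h)) - η * ‖h‖ ^ 2 ≤
      g ⬝ᵥ δ - 1 / 2 * (δ ⬝ᵥ (A *ᵥ δ)) + η * ‖δ‖ ^ 2) :
    ‖δ - h‖ ^ 2 ≤ 12 * η / l * ‖h‖ ^ 2 := by
  have e1 : g ⬝ᵥ h = h ⬝ᵥ (A *ᵥ h) := by rw [← hg, dotProduct_comm]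
  have e2 : g ⬝ᵥ δ = δ ⬝ᵥ (A *ᵥ h) := by rw [← hg, dotProduct_comm]
  have e3 := dotProduct_mulVec_comm hA h δ
  -- Completing the square, the objective at `δ` falls short of its maximum by half the form at `δ -
  -- h`. Near-optimality bounds this by `η (‖h‖ ^ 2 + ‖δ‖ ^ 2) ≤ η (3 ‖h‖ ^ 2 + 2 ‖δ - h‖ ^ 2)`, and
  -- `η ≤ l / 8` absorbs the last term.
  have h1 := hlow (δ - h)
  have e4 : (δ - h) ⬝ᵥ (A *ᵥ (δ - h)) =
      δ ⬝ᵥ (A *ᵥ δ) - 2 * (δ ⬝ᵥ (A *ᵥ h)) + h ⬝ᵥ (A *ᵥ h) := by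
    rw [mulVec_sub, dotProduct_sub, sub_dotProduct, sub_dotProduct, e3]
    ring
  have h2 : ‖δ‖ ^ 2 ≤ 2 * ‖δ - h‖ ^ 2 + 2 * ‖h‖ ^ 2 := by
    have h3 : ‖δ‖ ≤ ‖δ - h‖ + ‖h‖ := by simpa using norm_add_le (δ - h) h
    have h4 : ‖δ‖ ^ 2 ≤ (‖δ - h‖ + ‖h‖) ^ 2 := by gcongr
    nlinarith [sq_nonneg (‖δ - h‖ - ‖h‖)]
  have h5 : η * ‖δ‖ ^ 2 ≤ η * (2 * ‖δ - h‖ ^ 2 + 2 * ‖h‖ ^ 2) := by gcongr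
  have h6 : η * ‖δ - h‖ ^ 2 ≤ l / 8 * ‖δ - h‖ ^ 2 := by gcongr
  rw [div_mul_eq_mul_div, le_div_iff₀ hl]
  rw [e1, e2] at hopt
  nlinarith

/-- Every term of the difference contains a factor `δ - h`, whose norm is at most `s * a * x`; this
yields the overall factor `s`. -/
lemma abs_quadratic_sub_le (B : Matrix ι ι ℝ) {a b s x : ℝ} (ha : 0 < a) (hb : 0 < b)
    (hs0 : 0 < s) (hs1 : s ≤ 1) (hx : 0 ≤ x) (hB : ∀ v, ‖B *ᵥ v‖ ≤ b * ‖v‖) {g' δ h : ι → ℝ}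
    (hclose : ‖δ - h‖ ≤ s * ‖h‖) (hha : ‖h‖ ≤ a * x) :
    |(g' ⬝ᵥ δ + 1 / 2 * (δ ⬝ᵥ (B *ᵥ δ))) - (g' ⬝ᵥ h + 1 / 2 * (h ⬝ᵥ (B *ᵥ h)))| ≤
      s * (Fintype.card ι * a) * (‖g'‖ * x) + s * (2 * Fintype.card ι * b * a ^ 2) * x ^ 2 := by
  have hN0 : (0 : ℝ) ≤ Fintype.card ι := by positivity
  generalize hN : (Fintype.card ι : ℝ) = N at hN0 ⊢
  have hle : ∀ x y : ι → ℝ, |x ⬝ᵥ y| ≤ N * (‖x‖ * ‖y‖) := fun x y => by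
    rw [← hN]
    exact abs_dotProduct_le x y
  have hclose' : ‖δ - h‖ ≤ s * (a * x) := hclose.trans (by gcongr)
  have hδ : ‖δ‖ ≤ 2 * (a * x) := by
    have h1 : ‖δ‖ ≤ ‖δ - h‖ + ‖h‖ := by simpa using norm_add_le (δ - h) h
    have h2 : s * (a * x) ≤ a * x := mul_le_of_le_one_left (by positivity) hs1
    linarith
  have e : (g' ⬝ᵥ δ + 1 / 2 * (δ ⬝ᵥ (B *ᵥ δ))) - (g' ⬝ᵥ h + 1 / 2 * (h ⬝ᵥ (B *ᵥ h))) =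
      g' ⬝ᵥ (δ - h) + 1 / 2 * ((δ - h) ⬝ᵥ (B *ᵥ δ)) + 1 / 2 * (h ⬝ᵥ (B *ᵥ (δ - h))) := by
    rw [mulVec_sub, dotProduct_sub, dotProduct_sub, sub_dotProduct]
    ring
  have b2 : |g' ⬝ᵥ (δ - h)| ≤ s * (N * a) * (‖g'‖ * x) := by
    calc |g' ⬝ᵥ (δ - h)| ≤ N * (‖g'‖ * ‖δ - h‖) := hle _ _
      _ ≤ N * (‖g'‖ * (s * (a * x))) := by gcongr
      _ = _ := by ring
  have b3 : |(δ - h) ⬝ᵥ (B *ᵥ δ)| ≤ s * (2 * N * b * a ^ 2) * x ^ 2 := by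
    calc |(δ - h) ⬝ᵥ (B *ᵥ δ)| ≤ N * (‖δ - h‖ * ‖B *ᵥ δ‖) := hle _ _
      _ ≤ N * ((s * (a * x)) * (b * (2 * (a * x)))) := by
        gcongr
        exact (hB δ).trans (by gcongr)
      _ = _ := by ring
  have b4 : |h ⬝ᵥ (B *ᵥ (δ - h))| ≤ s * (2 * N * b * a ^ 2) * x ^ 2 := by
    calc |h ⬝ᵥ (B *ᵥ (δ - h))| ≤ N * (‖h‖ * ‖B *ᵥ (δ - h)‖) := hle _ _
      _ ≤ N * ((a * x) * (b * (s * (a * x)))) := by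
        gcongr
        exact (hB _).trans (by gcongr)
      _ = s * (N * b * a ^ 2) * x ^ 2 := by ring
      _ ≤ s * (2 * N * b * a ^ 2) * x ^ 2 := by
        have : 0 ≤ s * (N * b * a ^ 2) * x ^ 2 := by positivity
        linarith
  rw [e]
  have m2 := abs_le.1 b2
  have m3 := abs_le.1 b3
  have m4 := abs_le.1 b4
  rw [abs_le]
  constructor <;> linarith [m2.1, m2.2, m3.1, m3.2, m4.1, m4.2]

/-- Comparison of a quadratic function at an approximate and at an exact maximizer. -/
lemma exists_quadratic_comparison {A : Matrix ι ι ℝ} (hA : A.IsSymm)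
    (hpos : ∀ v, 0 ≤ v ⬝ᵥ (A *ᵥ v)) (hdet : IsUnit A.det) (B : Matrix ι ι ℝ) {ε : ℝ}
    (hε : 0 < ε) : ∃ η > 0, ∀ (g g' δ : ι → ℝ) (t : ℝ),
      g ⬝ᵥ (A⁻¹ *ᵥ g) - 1 / 2 * ((A⁻¹ *ᵥ g) ⬝ᵥ (A *ᵥ (A⁻¹ *ᵥ g))) - η * ‖A⁻¹ *ᵥ g‖ ^ 2 ≤
        g ⬝ᵥ δ - 1 / 2 * (δ ⬝ᵥ (A *ᵥ δ)) + η * ‖δ‖ ^ 2 →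
      |t - (g' ⬝ᵥ δ + 1 / 2 * (δ ⬝ᵥ (B *ᵥ δ)))| ≤ η * ‖δ‖ ^ 2 →
      |t - (g' ⬝ᵥ (A⁻¹ *ᵥ g) + 1 / 2 * ((A⁻¹ *ᵥ g) ⬝ᵥ (B *ᵥ (A⁻¹ *ᵥ g))))| ≤
        ε * (g ⬝ᵥ g + g' ⬝ᵥ g') := by
  obtain ⟨l, hl, hlow⟩ := exists_lower_bound hA hpos hdet
  obtain ⟨a, ha, hAinv⟩ := exists_norm_mulVec_le A⁻¹
  obtain ⟨b, hb, hB⟩ := exists_norm_mulVec_le B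
  set N : ℝ := ((Fintype.card ι : ℕ) : ℝ) with hN
  have hN0 : 0 ≤ N := by positivity
  set C : ℝ := N * a + 2 * N * b * a ^ 2 + 1 with hC
  have hC0 : 1 ≤ C := by
    have : 0 ≤ N * a + 2 * N * b * a ^ 2 := by positivity
    linarith
  set s : ℝ := min 1 (ε / (2 * C)) with hs
  have hs0 : 0 < s := by positivity
  have hs1 : s ≤ 1 := min_le_left _ _
  have hs2 : s * C ≤ ε / 2 := by
    calc s * C ≤ ε / (2 * C) * C := by gcongr; exact min_le_right _ _
      _ = ε / 2 := by field_simp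
  -- The three bounds serve in turn to apply `norm_sub_argmax_sq_le`, to turn its conclusion into
  -- `‖δ - h‖ ≤ s * ‖h‖`, and to make `η * ‖δ‖ ^ 2` at most `ε / 2 * ‖g‖ ^ 2`.
  set η : ℝ := min (l / 8) (min (l / 12 * s ^ 2) (ε / (8 * a ^ 2))) with hη
  have hη0 : 0 < η := by positivity
  have hη1 : η ≤ l / 8 := min_le_left _ _
  have hη2 : η ≤ l / 12 * s ^ 2 := (min_le_right _ _).trans (min_le_left _ _)
  have hη3 : η ≤ ε / (8 * a ^ 2) := (min_le_right _ _).trans (min_le_right _ _)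
  clear_value η s C
  refine ⟨η, hη0, fun g g' δ t hopt ht => ?_⟩
  set h := A⁻¹ *ᵥ g with hh
  have hgh : A *ᵥ h = g := by rw [hh, mulVec_mulVec, mul_nonsing_inv A hdet, one_mulVec]
  have hha : ‖h‖ ≤ a * ‖g‖ := hAinv g
  clear_value h
  have hclose := norm_sub_argmax_sq_le hA hl hlow hη0.le hη1 hgh hopt
  have hclose' : ‖δ - h‖ ≤ s * ‖h‖ := by
    have h1 : 12 * η / l ≤ s ^ 2 := by
      rw [div_le_iff₀ hl]
      nlinarith
    have h2 : ‖δ - h‖ ^ 2 ≤ (s * ‖h‖) ^ 2 := by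
      rw [mul_pow]
      exact hclose.trans (by gcongr)
    exact (sq_le_sq₀ (norm_nonneg _) (by positivity)).1 h2
  have hδ : ‖δ‖ ≤ 2 * (a * ‖g‖) := by
    have h1 : ‖δ‖ ≤ ‖δ - h‖ + ‖h‖ := by simpa using norm_add_le (δ - h) h
    have h2 : s * ‖h‖ ≤ ‖h‖ := mul_le_of_le_one_left (norm_nonneg _) hs1
    linarith
  have b2 := abs_quadratic_sub_le B ha hb hs0 hs1 (norm_nonneg g) hB (g' := g') hclose' hha
  rw [← hN] at b2
  have hg1 := norm_nonneg g
  have hg2 := norm_nonneg g'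
  have hh0 := norm_nonneg h
  have b1 : η * ‖δ‖ ^ 2 ≤ ε / 2 * ‖g‖ ^ 2 := by
    calc η * ‖δ‖ ^ 2 ≤ ε / (8 * a ^ 2) * (2 * (a * ‖g‖)) ^ 2 := by gcongr
      _ = ε / 2 * ‖g‖ ^ 2 := by field_simp; norm_num
  have b5 : s * (N * a) * (‖g'‖ * ‖g‖) + s * (2 * N * b * a ^ 2) * ‖g‖ ^ 2 ≤
      ε / 2 * (‖g‖ ^ 2 + ‖g'‖ ^ 2) := by
    have h1 : ‖g'‖ * ‖g‖ ≤ ‖g‖ ^ 2 + ‖g'‖ ^ 2 := by nlinarith [sq_nonneg (‖g‖ - ‖g'‖)]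
    have h2 : ‖g‖ ^ 2 ≤ ‖g‖ ^ 2 + ‖g'‖ ^ 2 := by nlinarith
    calc s * (N * a) * (‖g'‖ * ‖g‖) + s * (2 * N * b * a ^ 2) * ‖g‖ ^ 2
        ≤ s * (N * a) * (‖g‖ ^ 2 + ‖g'‖ ^ 2) + s * (2 * N * b * a ^ 2) * (‖g‖ ^ 2 + ‖g'‖ ^ 2) := by
          gcongr
      _ = s * (N * a + 2 * N * b * a ^ 2) * (‖g‖ ^ 2 + ‖g'‖ ^ 2) := by ring
      _ ≤ s * C * (‖g‖ ^ 2 + ‖g'‖ ^ 2) := by gcongr; linarith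
      _ ≤ _ := by gcongr
  have n1 := norm_sq_le_dotProduct g
  have n2 := norm_sq_le_dotProduct g'
  have n3 : ε * (‖g‖ ^ 2 + ‖g'‖ ^ 2) ≤ ε * (g ⬝ᵥ g + g' ⬝ᵥ g') := by gcongr
  have n4 : 0 ≤ ε * ‖g'‖ ^ 2 := by positivity
  refine le_trans ?_ n3
  have m1 := abs_le.1 (ht.trans b1)
  have m2 := abs_le.1 (b2.trans b5)
  rw [abs_le]
  constructor <;> linarith [m1.1, m1.2, m2.1, m2.2]

end Quadratic

/-! ### Expectation of the scaled increment at the estimator -/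

section Asymptotics

open Matrix

variable {ι : Type} [Fintype ι] [DecidableEq ι] {Ω U : Type*} [MeasurableSpace Ω]
  [MeasurableSpace U] {P : Measure Ω} [IsProbabilityMeasure P] {S : Set (ι → ℝ)} {βbar : ι → ℝ}
  {Q : Measure U} {X : ℕ → Ω → U}

/-- A function continuous in the parameter and measurable in the observation is jointly measurable,
so a random parameter may be inserted. -/
lemma measurable_eval_of_continuousOn {F : (ι → ℝ) → U → ℝ} (hF : ∀ β ∈ S, Measurable (F β))
    (hc : ∀ u, ContinuousOn (fun β => F β u) S) {b : Ω → ι → ℝ} (mb : Measurable b)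
    (hb : ∀ ω, b ω ∈ S) {Y : Ω → U} (mY : Measurable Y) : Measurable fun ω => F (b ω) (Y ω) := by
  have h := measurable_uncurry_of_continuous_of_measurable (u := fun (β : S) u => F β u)
    (fun u => continuousOn_iff_continuous_domRestrict.1 (hc u)) fun β => hF β β.2
  exact h.comp ((mb.subtype_mk (h := hb)).prodMk mY)

lemma mulVec_dotProduct_mulVec (A B : Matrix ι ι ℝ) (x : ι → ℝ) :
    (A *ᵥ x) ⬝ᵥ (B *ᵥ (A *ᵥ x)) = x ⬝ᵥ ((Aᵀ * B * A) *ᵥ x) := by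
  rw [← mulVec_mulVec, ← mulVec_mulVec, dotProduct_mulVec x, vecMul_transpose]

lemma IID.integral_bilinear (hX : IID P Q X) {φ ψ : ι → U → ℝ} (mφ : ∀ i, Measurable (φ i))
    (mψ : ∀ i, Measurable (ψ i)) (lφ : ∀ i, MemLp (φ i) 2 Q) (lψ : ∀ i, MemLp (ψ i) 2 Q)
    (h0 : ∀ i, ∫ u, φ i u ∂Q = 0) (C : Matrix ι ι ℝ) (n : ℕ) :
    Integrable (fun ω => (fun i => sampleMean X (φ i) n ω) ⬝ᵥ
      (C *ᵥ fun j => sampleMean X (ψ j) n ω)) P ∧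
    (n ≠ 0 → n * ∫ ω, (fun i => sampleMean X (φ i) n ω) ⬝ᵥ
      (C *ᵥ fun j => sampleMean X (ψ j) n ω) ∂P = ∑ i, ∑ j, C i j * ∫ u, φ i u * ψ j u ∂Q) := by
  have e : ∀ ω, (fun i => sampleMean X (φ i) n ω) ⬝ᵥ (C *ᵥ fun j => sampleMean X (ψ j) n ω) =
      ∑ i, ∑ j, C i j * (sampleMean X (φ i) n ω * sampleMean X (ψ j) n ω) := by
    intro ω
    simp only [dotProduct, mulVec, Finset.mul_sum]
    exact Finset.sum_congr rfl fun i _ => Finset.sum_congr rfl fun j _ => by ring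
  have hint : ∀ i j, Integrable
      (fun ω => C i j * (sampleMean X (φ i) n ω * sampleMean X (ψ j) n ω)) P := fun i j =>
    ((hX.memLp_sampleMean (lφ i) n).integrable_mul (hX.memLp_sampleMean (lψ j) n)).const_mul _
  simp only [e]
  refine ⟨integrable_finsetSum _ fun i _ => integrable_finsetSum _ fun j _ => hint i j,
    fun hn => ?_⟩
  rw [integral_finsetSum _ fun i _ => integrable_finsetSum _ fun j _ => hint i j, Finset.mul_sum]
  refine Finset.sum_congr rfl fun i _ => ?_
  rw [integral_finsetSum _ fun j _ => hint i j, Finset.mul_sum]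
  refine Finset.sum_congr rfl fun j _ => ?_
  rw [integral_const_mul, mul_left_comm,
    hX.integral_sampleMean_mul (mφ i) (mψ j) (lφ i) (lψ j) (h0 i) hn]

lemma IID.tendsto_setIntegral_dotProduct (hX : IID P Q X) {φ : ι → U → ℝ}
    (mφ : ∀ i, Measurable (φ i)) (lφ : ∀ i, MemLp (φ i) 2 Q) (h0 : ∀ i, ∫ u, φ i u ∂Q = 0)
    {A : ℕ → Set Ω} (mA : ∀ n, MeasurableSet (A n)) (hA : Negligible P A) :
    Tendsto (fun n : ℕ => n * ∫ ω in A n, (fun i => sampleMean X (φ i) n ω) ⬝ᵥ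
      (fun i => sampleMean X (φ i) n ω) ∂P) atTop (𝓝 0) := by
  have h1 := tendsto_finsetSum Finset.univ fun i _ =>
    hX.tendsto_setIntegral_sq (mφ i) (lφ i) (h0 i) mA hA.tendsto_zero
  rw [Finset.sum_const_zero] at h1
  refine h1.congr fun n => ?_
  rw [← Finset.mul_sum]
  congr 1
  simp only [dotProduct, ← sq]
  rw [integral_finsetSum _ fun i _ => ((hX.memLp_sampleMean (lφ i) n).integrable_sq).integrableOn]

lemma exists_abs_quadratic_le (A B : Matrix ι ι ℝ) : ∃ c, 0 ≤ c ∧ ∀ g g' : ι → ℝ,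
    |g' ⬝ᵥ (A *ᵥ g) + 1 / 2 * (g ⬝ᵥ (B *ᵥ g))| ≤ c * (g ⬝ᵥ g + g' ⬝ᵥ g') := by
  obtain ⟨a, ha, hA⟩ := exists_norm_mulVec_le A
  set b := ∑ i, ∑ j, |B i j| with hb
  have hb0 : 0 ≤ b := Finset.sum_nonneg fun i _ => Finset.sum_nonneg fun j _ => abs_nonneg _
  have hN0 : (0 : ℝ) ≤ Fintype.card ι := by positivity
  generalize hN : (Fintype.card ι : ℝ) = N at hN0
  refine ⟨N * a + b, by positivity, fun g g' => ?_⟩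
  have h1 : |g' ⬝ᵥ (A *ᵥ g)| ≤ N * a * (‖g'‖ * ‖g‖) := by
    calc |g' ⬝ᵥ (A *ᵥ g)| ≤ N * (‖g'‖ * ‖A *ᵥ g‖) := by rw [← hN]; exact abs_dotProduct_le _ _
      _ ≤ N * (‖g'‖ * (a * ‖g‖)) := by gcongr; exact hA g
      _ = _ := by ring
  have h2 := abs_dotProduct_mulVec_le B g
  have h3 : ‖g'‖ * ‖g‖ ≤ ‖g‖ ^ 2 + ‖g'‖ ^ 2 := by nlinarith [sq_nonneg (‖g‖ - ‖g'‖)]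
  have h4 : N * a * (‖g'‖ * ‖g‖) ≤ N * a * (‖g‖ ^ 2 + ‖g'‖ ^ 2) := by gcongr
  have h5 : (N * a + b) * (‖g‖ ^ 2 + ‖g'‖ ^ 2) ≤ (N * a + b) * (g ⬝ᵥ g + g' ⬝ᵥ g') := by
    gcongr
    · exact norm_sq_le_dotProduct g
    · exact norm_sq_le_dotProduct g'
  have h6 : 0 ≤ b * ‖g‖ ^ 2 := by positivity
  have h7 : 0 ≤ b * ‖g'‖ ^ 2 := by positivity
  refine (abs_add_le _ _).trans ?_
  rw [abs_mul, abs_of_nonneg (by norm_num : (0 : ℝ) ≤ 1 / 2)]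
  linarith

/-- A random sequence `R n` that is close to `T n` off negligible events, up to an arbitrarily
small multiple of `a n`, has asymptotically the same scaled mean. -/
lemma tendsto_mul_integral_of_close {R T a : ℕ → Ω → ℝ} {c ca C : ℝ}
    (iR : ∀ n, Integrable (R n) P) (iT : ∀ n, Integrable (T n) P) (ia : ∀ n, Integrable (a n) P)
    (a0 : ∀ n ω, 0 ≤ a n ω) (hT : ∀ n, n ≠ 0 → n * ∫ ω, T n ω ∂P = c)
    (ha : ∀ n, n ≠ 0 → n * ∫ ω, a n ω ∂P = ca) (hTa : ∀ n ω, |T n ω| ≤ C * a n ω)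
    (hR : ∀ A : ℕ → Set Ω, (∀ n, MeasurableSet (A n)) → Negligible P A →
      Tendsto (fun n : ℕ => n * ∫ ω in A n, |R n ω| ∂P) atTop (𝓝 0))
    (haA : ∀ A : ℕ → Set Ω, (∀ n, MeasurableSet (A n)) → Negligible P A →
      Tendsto (fun n : ℕ => n * ∫ ω in A n, a n ω ∂P) atTop (𝓝 0))
    (hclose : ∀ ε > 0, ∃ A : ℕ → Set Ω, Negligible P A ∧
      ∀ n, ∀ ω ∉ A n, |R n ω - T n ω| ≤ ε * a n ω) :
    Tendsto (fun n : ℕ => n * ∫ ω, R n ω ∂P) atTop (𝓝 c) := by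
  have hca : 0 ≤ ca := by
    rw [← ha 1 one_ne_zero]
    exact mul_nonneg (Nat.cast_nonneg _) (integral_nonneg (a0 1))
  rw [Metric.tendsto_atTop]
  intro ε hε
  -- As `n` times the mean of `a n` is `ca`, the relative error contributes at most `ε / 2`; adding
  -- 1 avoids division by zero.
  obtain ⟨A₀, hA₀, hcl⟩ := hclose (ε / (2 * (ca + 1))) (by positivity)
  obtain ⟨A, mA, hAA, hA⟩ := hA₀.exists_measurable
  have lim := (hR A mA hA).add ((haA A mA hA).const_mul C)
  rw [mul_zero, add_zero] at lim
  obtain ⟨K, hK⟩ := (lim.eventually (gt_mem_nhds (half_pos hε))).exists_forall_of_atTop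
  refine ⟨max K 1, fun n hn => ?_⟩
  have hn0 : n ≠ 0 := by have := le_of_max_le_right hn; omega
  have h1 := hK n (le_of_max_le_left hn)
  have hpt : ∀ ω, |R n ω - T n ω| ≤ (A n).indicator (fun ω => |R n ω|) ω
      + C * (A n).indicator (a n) ω + ε / (2 * (ca + 1)) * a n ω := by
    intro ω
    have hea : 0 ≤ ε / (2 * (ca + 1)) * a n ω := mul_nonneg (by positivity) (a0 n ω)
    by_cases hω : ω ∈ A n
    · simp only [hω, Set.indicator_of_mem]
      linarith [abs_sub (R n ω) (T n ω), hTa n ω]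
    · simp only [hω, not_false_eq_true, Set.indicator_of_notMem, mul_zero, zero_add]
      exact hcl n ω fun h => hω (hAA n h)
  have i1 : Integrable ((A n).indicator fun ω => |R n ω|) P := (iR n).abs.indicator (mA n)
  have i2 : Integrable (fun ω => C * (A n).indicator (a n) ω) P :=
    ((ia n).indicator (mA n)).const_mul C
  have i3 : Integrable (fun ω => ε / (2 * (ca + 1)) * a n ω) P := (ia n).const_mul _
  have h2 : ∫ ω, |R n ω - T n ω| ∂P ≤ ∫ ω, ((A n).indicator (fun ω => |R n ω|) ω
      + C * (A n).indicator (a n) ω + ε / (2 * (ca + 1)) * a n ω) ∂P :=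
    integral_mono ((iR n).sub (iT n)).abs ((i1.add i2).add i3) hpt
  rw [integral_add (f := fun ω => (A n).indicator (fun ω => |R n ω|) ω
      + C * (A n).indicator (a n) ω) (i1.add i2) i3, integral_add i1 i2, integral_const_mul,
    integral_const_mul, integral_indicator (mA n), integral_indicator (mA n)] at h2
  have h3 : |∫ ω, R n ω ∂P - ∫ ω, T n ω ∂P| ≤ ∫ ω, |R n ω - T n ω| ∂P := by
    rw [← integral_sub (iR n) (iT n)]
    exact abs_integral_le_integral_abs
  have h4 : n * |∫ ω, R n ω ∂P - ∫ ω, T n ω ∂P| ≤ n * (∫ ω in A n, |R n ω| ∂P +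
      C * ∫ ω in A n, a n ω ∂P + ε / (2 * (ca + 1)) * ∫ ω, a n ω ∂P) :=
    mul_le_mul_of_nonneg_left (h3.trans h2) (Nat.cast_nonneg n)
  have h5 : ε / (2 * (ca + 1)) * (n * ∫ ω, a n ω ∂P) ≤ ε / 2 := by
    rw [ha n hn0, div_mul_eq_mul_div, div_le_div_iff₀ (by positivity) (by norm_num)]
    nlinarith
  rw [Real.dist_eq, ← hT n hn0, ← mul_sub, abs_mul, Nat.abs_cast]
  linarith

/-- The scaled mean of the increments of the `y`-log-likelihood and of a smooth loss between `β̄`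
and the maximum likelihood estimator. -/
theorem tendsto_mul_integral_increment {gb gy : (ι → ℝ) → U → ℝ} (hX : IID P Q X)
    (hS : IsCompact S) (hRb : Regular S βbar Q 2 gb) (hRy : Regular S βbar Q 2 gy)
    (mgb : ∀ β ∈ S, Measurable (gb β)) (mgy : ∀ β ∈ S, Measurable (gy β))
    (hlt : ∀ β ∈ S, β ≠ βbar →
      ∫ u, Real.log (gb β u) ∂Q < ∫ u, Real.log (gb βbar u) ∂Q)
    (hy0 : meanGrad Q gy βbar = 0) (hdet : IsUnit (info Q gb βbar).det)
    {L : (ι → ℝ) → ℝ} {B : Matrix ι ι ℝ} (hLc : ContinuousOn L S)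
    (hL : ∀ η > 0, ∃ ρ > 0, ∀ δ, ‖δ‖ < ρ →
      |L (βbar + δ) - L βbar - 1 / 2 * (δ ⬝ᵥ (B *ᵥ δ))| ≤ η * ‖δ‖ ^ 2)
    {βhat : ℕ → Ω → ι → ℝ} (mβ : ∀ n, Measurable (βhat n)) (hmem : ∀ n ω, βhat n ω ∈ S)
    (hmax : ∀ n ω, ∀ β ∈ S, sampleMean X (fun u => Real.log (gb β u)) n ω ≤
      sampleMean X (fun u => Real.log (gb (βhat n ω) u)) n ω) :
    (∀ n, Integrable (fun ω => sampleMean X (fun u => Real.log (gy (βhat n ω) u)) n ω) P) ∧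
    (∀ n, Integrable (fun ω => L (βhat n ω)) P) ∧
    Tendsto (fun n : ℕ => n * ∫ ω, (sampleMean X (fun u => Real.log (gy (βhat n ω) u)) n ω
        - sampleMean X (fun u => Real.log (gy βbar u)) n ω + (L (βhat n ω) - L βbar)) ∂P) atTop
      (𝓝 (∑ i, ∑ j, (info Q gb βbar)⁻¹ i j *
          ∫ u, grad (fun β => Real.log (gy β u)) βbar i *
            grad (fun β => Real.log (gb β u)) βbar j ∂Q
        + 1 / 2 * ∑ i, ∑ j, (((info Q gb βbar)⁻¹)ᵀ * (B - info Q gy βbar) *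
            (info Q gb βbar)⁻¹) i j * ∫ u, grad (fun β => Real.log (gb β u)) βbar i *
              grad (fun β => Real.log (gb β u)) βbar j ∂Q)) := by
  have := hX.isProbabilityMeasure
  set A := info Q gb βbar with hA
  set D := B - info Q gy βbar with hD
  set Gb : ι → U → ℝ := fun i u => grad (fun β => Real.log (gb β u)) βbar i with hGb
  set Gy : ι → U → ℝ := fun i u => grad (fun β => Real.log (gy β u)) βbar i with hGy
  have mGb : ∀ i, Measurable (Gb i) := hRb.measurable_grad mgb
  have mGy : ∀ i, Measurable (Gy i) := hRy.measurable_grad mgy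
  have lGb : ∀ i, MemLp (Gb i) 2 Q := hRb.memLp_grad mgb
  have lGy : ∀ i, MemLp (Gy i) 2 Q := hRy.memLp_grad mgy
  have hbar := hRb.mem
  obtain ⟨hb0, hpos⟩ := hRb.stationary mgb (by norm_num) fun β hβ => by
    rcases eq_or_ne β βbar with rfl | h
    · exact le_rfl
    · exact (hlt β hβ h).le
  have Gb0 : ∀ i, ∫ u, Gb i u ∂Q = 0 := fun i => congrFun hb0 i
  have Gy0 : ∀ i, ∫ u, Gy i u ∂Q = 0 := fun i => congrFun hy0 i
  have hsymm : A.IsSymm := info_isSymm hRb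
  obtain ⟨m, lm, hm⟩ := hRy.envelope
  obtain ⟨M, hM⟩ := hS.exists_bound_of_continuousOn hLc
  -- The envelope is only almost everywhere measurable, whereas the moment lemmas require a
  -- measurable function.
  set m' : U → ℝ := lm.1.mk m with hm'
  have mm' : Measurable m' := lm.1.stronglyMeasurable_mk.measurable
  have hmm' : m =ᵐ[Q] m' := lm.1.ae_eq_mk
  have lm' : MemLp m' 2 Q := lm.ae_eq hmm'
  have hLb : ∀ n ω, ∀ β ∈ S, |sampleMean X (fun u => Real.log (gy β u)) n ω| ≤
      sampleMean X m n ω := fun n ω β hβ =>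
    (abs_sampleMean_le _ n ω).trans (sampleMean_mono (fun u => hm u β hβ) n ω)
  have hae : ∀ n, ∀ᵐ ω ∂P, ∀ β ∈ S, |sampleMean X (fun u => Real.log (gy β u)) n ω| ≤
      |sampleMean X m' n ω| := by
    intro n
    filter_upwards [hX.sampleMean_congr hmm' n] with ω hω β hβ
    rw [← hω]
    exact (hLb n ω β hβ).trans (le_abs_self _)
  have iY : ∀ n, Integrable
      (fun ω => sampleMean X (fun u => Real.log (gy (βhat n ω) u)) n ω) P := by
    intro n
    have mY : Measurable fun ω => sampleMean X (fun u => Real.log (gy (βhat n ω) u)) n ω :=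
      (Finset.measurable_fun_sum _ fun i _ => measurable_eval_of_continuousOn
        (F := fun β u => Real.log (gy β u)) (fun β hβ => (mgy β hβ).log) hRy.continuousOn
        (mβ n) (hmem n) (hX.measurable i)).const_mul _
    refine ((hX.memLp_sampleMean lm' n).integrable (by norm_num)).abs.mono
      mY.aestronglyMeasurable ?_
    filter_upwards [hae n] with ω hω
    rw [Real.norm_eq_abs, Real.norm_eq_abs, abs_abs]
    exact hω _ (hmem n ω)
  have iL : ∀ n, Integrable (fun ω => L (βhat n ω)) P := by
    intro n
    have mL : Measurable fun ω => L (βhat n ω) := measurable_eval_of_continuousOn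
      (F := fun β (_ : Unit) => L β) (fun _ _ => measurable_const) (fun _ => hLc) (mβ n) (hmem n)
      (Y := fun _ => ()) measurable_const
    exact Integrable.of_bound mL.aestronglyMeasurable M (ae_of_all _ fun ω => hM _ (hmem n ω))
  refine ⟨iY, iL, ?_⟩
  have iY0 : ∀ n, Integrable (fun ω => sampleMean X (fun u => Real.log (gy βbar u)) n ω) P :=
    fun n => (hX.memLp_sampleMean (hRy.memLp_log mgy hbar) n).integrable (by norm_num)
  set R : ℕ → Ω → ℝ := fun n ω => sampleMean X (fun u => Real.log (gy (βhat n ω) u)) n ω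
        - sampleMean X (fun u => Real.log (gy βbar u)) n ω + (L (βhat n ω) - L βbar) with hR
  have iR : ∀ n, Integrable (R n) P := fun n =>
    ((iY n).sub (iY0 n)).add ((iL n).sub (integrable_const _))
  set sb : ℕ → Ω → ι → ℝ := fun n ω i => sampleMean X (Gb i) n ω with hsb
  set sy : ℕ → Ω → ι → ℝ := fun n ω i => sampleMean X (Gy i) n ω with hsy
  obtain ⟨C, hC0, hC⟩ := exists_abs_quadratic_le A⁻¹ ((A⁻¹)ᵀ * D * A⁻¹)
  have bil1 := fun n => hX.integral_bilinear mGy mGb lGy lGb Gy0 A⁻¹ n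
  have bil2 := fun n => hX.integral_bilinear mGb mGb lGb lGb Gb0 ((A⁻¹)ᵀ * D * A⁻¹) n
  have bil3 := fun n => hX.integral_bilinear mGb mGb lGb lGb Gb0 1 n
  have bil4 := fun n => hX.integral_bilinear mGy mGy lGy lGy Gy0 1 n
  simp only [one_mulVec] at bil3 bil4
  -- `T` is the quadratic approximation of the increment at `A⁻¹ *ᵥ sb n ω` instead of at the
  -- estimator; `a`, the sum of the squared mean scores, measures the admissible error.
  refine tendsto_mul_integral_of_close (R := R)
    (T := fun n ω => sy n ω ⬝ᵥ (A⁻¹ *ᵥ sb n ω) +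
      1 / 2 * (sb n ω ⬝ᵥ (((A⁻¹)ᵀ * D * A⁻¹) *ᵥ sb n ω)))
    (a := fun n ω => sb n ω ⬝ᵥ sb n ω + sy n ω ⬝ᵥ sy n ω) (C := C)
    (ca := ∑ i, ∑ j, (1 : Matrix ι ι ℝ) i j * ∫ u, Gb i u * Gb j u ∂Q +
      ∑ i, ∑ j, (1 : Matrix ι ι ℝ) i j * ∫ u, Gy i u * Gy j u ∂Q) iR
    (fun n => (bil1 n).1.add ((bil2 n).1.const_mul _)) (fun n => (bil3 n).1.add (bil4 n).1)
    (fun n ω => add_nonneg (Finset.sum_nonneg fun i _ => mul_self_nonneg _)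
      (Finset.sum_nonneg fun i _ => mul_self_nonneg _)) (fun n hn => ?_) (fun n hn => ?_)
    (fun n ω => hC _ _) (fun E mE hE => ?_) (fun E mE hE => ?_) (fun ε hε => ?_)
  · rw [integral_add (bil1 n).1 ((bil2 n).1.const_mul _), integral_const_mul, mul_add,
      mul_left_comm, (bil1 n).2 hn, (bil2 n).2 hn]
  · rw [integral_add (bil3 n).1 (bil4 n).1, mul_add, (bil3 n).2 hn, (bil4 n).2 hn]
  -- On exceptional events the increment is bounded crudely, by twice the mean envelope plus twice
  -- the bound of the loss on the compact set.
  · have l1 := ((hX.tendsto_setIntegral_abs mm' lm' mE hE).const_mul 2).add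
      (hE.const_mul (2 * M))
    rw [mul_zero, mul_zero, add_zero] at l1
    refine squeeze_zero (fun n => by positivity) (fun n => ?_) l1
    have i1 : Integrable (fun ω => |sampleMean X m' n ω|) P :=
      ((hX.memLp_sampleMean lm' n).integrable (by norm_num)).abs
    have h1 : ∫ ω in E n, |R n ω| ∂P ≤ ∫ ω in E n, (2 * |sampleMean X m' n ω| + 2 * M) ∂P := by
      refine integral_mono_ae (iR n).abs.integrableOn
        ((i1.const_mul 2).add (integrable_const _)).integrableOn ?_
      filter_upwards [ae_restrict_of_ae (hae n)] with ω hω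
      have h1 := abs_le.1 (hω _ (hmem n ω))
      have h2 := abs_le.1 (hω _ hbar)
      have h3 := abs_le.1 (hM _ (hmem n ω))
      have h4 := abs_le.1 (hM _ hbar)
      rw [abs_le]
      constructor <;> simp only [hR] <;>
        linarith [h1.1, h1.2, h2.1, h2.2, h3.1, h3.2, h4.1, h4.2]
    rw [integral_add (i1.const_mul 2).integrableOn (integrable_const _), integral_const_mul,
      setIntegral_const, smul_eq_mul] at h1
    have := mul_le_mul_of_nonneg_left h1 (Nat.cast_nonneg (α := ℝ) n)
    linarith
  · have l1 := (hX.tendsto_setIntegral_dotProduct mGb lGb Gb0 mE hE).add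
      (hX.tendsto_setIntegral_dotProduct mGy lGy Gy0 mE hE)
    rw [add_zero] at l1
    refine l1.congr fun n => ?_
    rw [← mul_add, integral_add (bil3 n).1.integrableOn (bil4 n).1.integrableOn]
  · obtain ⟨η, hη, hcomp⟩ := exists_quadratic_comparison hsymm hpos hdet D hε
    obtain ⟨ρb, hρb, Eb, nEb, hEb⟩ := hRb.sampleMean_expansion hX mgb hη
    -- Half of `η`, since the errors of the log-likelihood of `y` and of the loss are added.
    obtain ⟨ρy, hρy, Ey, nEy, hEy⟩ := hRy.sampleMean_expansion hX mgy (half_pos hη)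
    obtain ⟨ρx, hρx, hLx⟩ := hL (η / 2) (half_pos hη)
    obtain ⟨N, -, hβN, hNS, -⟩ := hRb.smooth
    obtain ⟨ρS, hρS, hball⟩ : ∃ ρS > 0, Metric.ball βbar ρS ⊆ S := by
      obtain ⟨N, hN, hβN, hNS, -⟩ := hRb.smooth
      obtain ⟨ρS, h1, h2⟩ := Metric.isOpen_iff.1 hN βbar hβN
      exact ⟨ρS, h1, h2.trans hNS⟩
    obtain ⟨c, hc, hAinv⟩ := exists_norm_mulVec_le A⁻¹
    set ρ := min (min ρb ρy) (min ρx ρS) with hρ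
    have hρ0 : 0 < ρ := lt_min (lt_min hρb hρy) (lt_min hρx hρS)
    have κ0 : 0 < ρ / (2 * c) := by positivity
    have neg1 := hRb.negligible_argmax hX mgb hS hlt hmem (fun n ω => hmax n ω βbar hbar) hρ0
    -- Off this event the quadratic maximizer `h` lies in the ball where the expansion holds, so
    -- `βbar + h` is an admissible competitor of the estimator.
    have neg2 : Negligible P fun n => ⋃ i, {ω | ρ / (2 * c) ≤
        |sampleMean X (Gb i) n ω - ∫ u, Gb i u ∂Q|} :=
      Negligible.iUnion fun i => hX.negligible_sampleMean (mGb i) (lGb i) κ0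
    refine ⟨_, ((nEb.union nEy).union neg1).union neg2, fun n ω hω => ?_⟩
    simp only [Set.mem_union, Set.mem_iUnion, not_or, not_exists, Set.mem_ofPred_eq, not_le,
      Gb0, sub_zero] at hω
    obtain ⟨⟨⟨ωb, ωy⟩, ω1⟩, ω2⟩ := hω
    have hsbn : ‖sb n ω‖ ≤ ρ / (2 * c) :=
      (pi_norm_le_iff_of_nonneg κ0.le).2 fun i => (ω2 i).le
    set h := A⁻¹ *ᵥ sb n ω with hh
    have hhρ : ‖h‖ < ρ := by
      calc ‖h‖ ≤ c * (ρ / (2 * c)) := (hAinv _).trans (by gcongr)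
        _ = ρ / 2 := by field_simp
        _ < ρ := half_lt_self hρ0
    set δ := βhat n ω - βbar with hδ
    have eδ : βbar + δ = βhat n ω := by simp [hδ]
    have lb : ρ ≤ ρb := (min_le_left _ _).trans (min_le_left _ _)
    have ly : ρ ≤ ρy := (min_le_left _ _).trans (min_le_right _ _)
    have lx : ρ ≤ ρx := (min_le_right _ _).trans (min_le_left _ _)
    have lS : ρ ≤ ρS := (min_le_right _ _).trans (min_le_right _ _)
    have hhS : βbar + h ∈ S := hball (by
      simpa [mem_ball_iff_norm] using hhρ.trans_le lS)
    have b1 := abs_le.1 (hEb n ω ωb δ (ω1.trans_le lb))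
    have b2 := abs_le.1 (hEb n ω ωb h (hhρ.trans_le lb))
    -- Maximality of the likelihood is used only against this competitor; with the two expansions it
    -- gives the near-optimality of `δ`.
    have b3 := hmax n ω _ hhS
    have y1 := abs_le.1 (hEy n ω ωy δ (ω1.trans_le ly))
    have x1 := abs_le.1 (hLx δ (ω1.trans_le lx))
    rw [eδ] at b1 y1 x1
    have hfin := hcomp (sb n ω) (sy n ω) δ (R n ω) (by
      rw [← hh]
      linarith [b1.1, b1.2, b2.1, b2.2]) (by
      simp only [hD, sub_mulVec, dotProduct_sub, hR]
      rw [abs_le]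
      constructor <;> linarith [y1.1, y1.2, x1.1, x1.2])
    rw [mulVec_dotProduct_mulVec] at hfin
    exact hfin

end Asymptotics

/-! ### Transfer of regularity along measurable maps -/

section Transfer

variable {ι : Type} [Fintype ι] [DecidableEq ι] {U V : Type*} [MeasurableSpace U]
  [MeasurableSpace V] {S : Set (ι → ℝ)} {βbar : ι → ℝ} {r : ENNReal}

lemma Regular.comp {Q : Measure V} {g : (ι → ℝ) → U → ℝ} {π : V → U} (hπ : Measurable π)
    (hR : Regular S βbar (Q.map π) r g) : Regular S βbar Q r fun β v => g β (π v) where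
  support v := hR.support (π v)
  continuousOn v := hR.continuousOn (π v)
  envelope := by
    obtain ⟨m, lm, hm⟩ := hR.envelope
    exact ⟨fun v => m (π v), lm.comp_measurePreserving ⟨hπ, rfl⟩, fun v => hm (π v)⟩
  smooth := by
    obtain ⟨N, hN, hβN, hNS, hs, ⟨m, lm, hm⟩, ⟨m', lm', hm'⟩⟩ := hR.smooth
    exact ⟨N, hN, hβN, hNS, fun v => hs (π v),
      ⟨fun v => m (π v), lm.comp_measurePreserving ⟨hπ, rfl⟩, fun v => hm (π v)⟩,
      ⟨fun v => m' (π v), lm'.comp_measurePreserving ⟨hπ, rfl⟩, fun v => hm' (π v)⟩⟩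

lemma info_map {Q : Measure V} {g : (ι → ℝ) → U → ℝ} {π : V → U} (hπ : Measurable π)
    (hR : Regular S βbar (Q.map π) r g) (hg : ∀ β ∈ S, Measurable (g β)) :
    info (Q.map π) g βbar = info Q (fun β v => g β (π v)) βbar := by
  ext i j
  simp only [info, Matrix.of_apply]
  rw [integral_map hπ.aemeasurable (hR.measurable_hess hg i j).aestronglyMeasurable]

lemma meanGrad_map {Q : Measure V} {g : (ι → ℝ) → U → ℝ} {π : V → U} (hπ : Measurable π)
    (hR : Regular S βbar (Q.map π) r g) (hg : ∀ β ∈ S, Measurable (g β)) :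
    meanGrad (Q.map π) g βbar = meanGrad Q (fun β v => g β (π v)) βbar := by
  ext i
  simp only [meanGrad]
  rw [integral_map hπ.aemeasurable (hR.measurable_grad hg i).aestronglyMeasurable]

lemma hess_congr {F G : (ι → ℝ) → ℝ} {β : ι → ℝ} (h : F =ᶠ[𝓝 β] G) : hess F β = hess G β := by
  ext i j
  have h1 : (fun b => grad F b j) =ᶠ[𝓝 β] fun b => grad G b j :=
    (h.fderiv (𝕜 := ℝ)).mono fun b hb => by simp only [grad, hb]
  simp only [hess, Matrix.of_apply, h1.fderiv_eq]

lemma hess_sub {F G : (ι → ℝ) → ℝ} {N : Set (ι → ℝ)} (hN : IsOpen N) (hF : ContDiffOn ℝ 2 F N)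
    (hG : ContDiffOn ℝ 2 G N) {β : ι → ℝ} (hβ : β ∈ N) (i j : ι) :
    hess (fun b => F b - G b) β i j = hess F β i j - hess G β i j := by
  have h1 : (fun b => grad (fun b => F b - G b) b j) =ᶠ[𝓝 β] fun b => grad F b j - grad G b j := by
    filter_upwards [hN.mem_nhds hβ] with b hb
    simp only [grad]
    rw [fderiv_fun_sub (differentiableAt_of_contDiffOn_two hN hF hb)
      (differentiableAt_of_contDiffOn_two hN hG hb)]
    rfl
  have hd : ∀ {H : (ι → ℝ) → ℝ}, ContDiffOn ℝ 2 H N →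
      DifferentiableAt ℝ (fun b => grad H b j) β := fun hH =>
    ((contDiffOn_grad hN hH j).contDiffAt (hN.mem_nhds hβ)).differentiableAt (by norm_num)
  simp only [hess, Matrix.of_apply]
  rw [h1.fderiv_eq, fderiv_fun_sub (hd hF) (hd hG)]
  rfl

lemma Regular.continuousOn_mean {Q : Measure U} {g : (ι → ℝ) → U → ℝ} [IsFiniteMeasure Q]
    (hR : Regular S βbar Q r g) (hr : 1 ≤ r) (hg : ∀ β ∈ S, Measurable (g β)) :
    ContinuousOn (fun β => ∫ u, Real.log (g β u) ∂Q) S := by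
  obtain ⟨m, lm, hm⟩ := hR.envelope
  exact continuousOn_of_dominated (fun β hβ => (hg β hβ).log.aestronglyMeasurable)
    (fun β hβ => ae_of_all _ fun u => hm u β hβ) (lm.integrable hr)
    (ae_of_all _ fun u => hR.continuousOn u)

end Transfer

/-! ### Marginal laws and densities of X, B and Y -/

section Marginals

variable {Y Z A : Type*} [MeasurableSpace Y] [MeasurableSpace Z] [MeasurableSpace A]
  {μY : Measure Y} {μZ : Measure Z} {μA : Measure A} [SigmaFinite μY] [SigmaFinite μZ]
  [SigmaFinite μA] {q : Y × Z × A → ℝ}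

lemma measurable_obs : Measurable (obs : Y × Z × A → Y × A) :=
  measurable_fst.prodMk measurable_snd.snd

lemma measurable_prim : Measurable (prim : Y × Z × A → Y × Z) :=
  measurable_fst.prodMk measurable_snd.fst

lemma law_eq_densMeasure : law μY μZ μA q = densMeasure (μY.prod (μZ.prod μA)) q := rfl

lemma IsDensity.margX (hq : IsDensity (μY.prod (μZ.prod μA)) q) :
    IsDensity (μY.prod μZ) (margX μA q) ∧
      (law μY μZ μA q).map prim = densMeasure (μY.prod μZ) (margX μA q) := by
  obtain ⟨h1, h2⟩ := hq.comp_measurePreserving MeasurableEquiv.prodAssoc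
    (measurePreserving_prodAssoc μY μZ μA)
  refine ⟨h1.marginal, ?_⟩
  rw [law_eq_densMeasure, ← h2, Measure.map_map measurable_prim (MeasurableEquiv.measurable _)]
  exact h1.map_fst

lemma IsDensity.margB (hq : IsDensity (μY.prod (μZ.prod μA)) q) :
    IsDensity (μY.prod μA) (margB μZ q) ∧
      (law μY μZ μA q).map obs = densMeasure (μY.prod μA) (margB μZ q) := by
  let e : (Y × A) × Z ≃ᵐ Y × Z × A := MeasurableEquiv.prodAssoc.trans
    ((MeasurableEquiv.refl Y).prodCongr MeasurableEquiv.prodComm)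
  have he : MeasurePreserving e ((μY.prod μA).prod μZ) (μY.prod (μZ.prod μA)) :=
    ((MeasurePreserving.id μY).prod Measure.measurePreserving_swap).comp
      (measurePreserving_prodAssoc μY μA μZ)
  obtain ⟨h1, h2⟩ := hq.comp_measurePreserving e he
  refine ⟨h1.marginal, ?_⟩
  rw [law_eq_densMeasure, ← h2, Measure.map_map measurable_obs (MeasurableEquiv.measurable _)]
  exact h1.map_fst

lemma IsDensity.margY {s : Y × Z → ℝ} (hs : IsDensity (μY.prod μZ) s) :
    IsDensity μY (margY μZ s) ∧
      (densMeasure (μY.prod μZ) s).map Prod.fst = densMeasure μY (margY μZ s) :=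
  ⟨hs.marginal, hs.map_fst⟩

lemma law_map_fst (hq : IsDensity (μY.prod (μZ.prod μA)) q) :
    (law μY μZ μA q).map Prod.fst = densMeasure μY (margY μZ (margX μA q)) := by
  rw [← hq.margX.1.margY.2, ← hq.margX.2, Measure.map_map measurable_fst measurable_prim]
  rfl

/-- Fubini on sections. Sections of a density are integrable only almost everywhere, so the two
routes to the marginal of `Y` may differ on a null set. -/
lemma margY_margX_ae (hq : IsDensity (μY.prod (μZ.prod μA)) q) :
    ∀ᵐ y ∂μY, margY μZ (margX μA q) y = ∫ a, margB μZ q (y, a) ∂μA := by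
  filter_upwards [hq.integrable.prod_right_ae] with y hy
  exact integral_integral_swap (f := fun z a => q (y, z, a)) hy

lemma margX_congr_ae {q' : Y × Z × A → ℝ} (h : q =ᵐ[μY.prod (μZ.prod μA)] q') :
    margX μA q =ᵐ[μY.prod μZ] margX μA q' := by
  have h1 := (measurePreserving_prodAssoc μY μZ μA).quasiMeasurePreserving.ae h
  filter_upwards [Measure.ae_ae_of_ae_prod h1] with x hx
  exact integral_congr_ae hx

lemma margY_congr_ae {s s' : Y × Z → ℝ} (h : s =ᵐ[μY.prod μZ] s') :
    margY μZ s =ᵐ[μY] margY μZ s' := by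
  filter_upwards [Measure.ae_ae_of_ae_prod h] with y hy
  exact integral_congr_ae hy

end Marginals

/-! ### Information matrices and entropy under correct specification -/

namespace Model

open Matrix

variable {Y Z A : Type*} [MeasurableSpace Y] [MeasurableSpace Z] [MeasurableSpace A]
  {μY : Measure Y} {μZ : Measure Z} {μA : Measure A} [SigmaFinite μY] [SigmaFinite μZ]
  [SigmaFinite μA] {d f : ℕ} {M : Model μY μZ μA d f} {q : Y × Z × A → ℝ}
  {βbar : Fin d ⊕ Fin f → ℝ}

lemma px_theta {β : Fin d ⊕ Fin f → ℝ} (hβ : β ∈ M.space) :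
    M.px (theta β) = margX μA (M.pc β) := funext fun x => M.px_eq β hβ x

lemma isDensity_pb {β : Fin d ⊕ Fin f → ℝ} (hβ : β ∈ M.space) :
    IsDensity (μY.prod μA) (M.pb β) := (M.isDensity β hβ).margB.1

lemma isDensity_px {β : Fin d ⊕ Fin f → ℝ} (hβ : β ∈ M.space) :
    IsDensity (μY.prod μZ) (M.px (theta β)) := by
  rw [px_theta hβ]
  exact (M.isDensity β hβ).margX.1

lemma isDensity_py {β : Fin d ⊕ Fin f → ℝ} (hβ : β ∈ M.space) :
    IsDensity μY (M.py (theta β)) := (isDensity_px hβ).margY.1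

lemma py_ae_eq {β : Fin d ⊕ Fin f → ℝ} (hβ : β ∈ M.space) :
    ∀ᵐ y ∂μY, M.py (theta β) y = ∫ a, M.pb β (y, a) ∂μA := by
  unfold py
  rw [px_theta hβ]
  exact margY_margX_ae (M.isDensity β hβ)

lemma map_obs_of_ae_eq {β : Fin d ⊕ Fin f → ℝ} (hβ : β ∈ M.space)
    (h : q =ᵐ[μY.prod (μZ.prod μA)] M.pc β) :
    (law μY μZ μA q).map obs = densMeasure (μY.prod μA) (M.pb β) := by
  rw [law_eq_densMeasure, densMeasure_congr h]
  exact (M.isDensity β hβ).margB.2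

lemma map_prim_of_ae_eq {β : Fin d ⊕ Fin f → ℝ} (hβ : β ∈ M.space)
    (h : q =ᵐ[μY.prod (μZ.prod μA)] M.pc β) :
    (law μY μZ μA q).map prim = densMeasure (μY.prod μZ) (M.px (theta β)) := by
  rw [law_eq_densMeasure, densMeasure_congr h, px_theta hβ]
  exact (M.isDensity β hβ).margX.2

lemma map_fst_of_ae_eq {β : Fin d ⊕ Fin f → ℝ} (hβ : β ∈ M.space)
    (h : q =ᵐ[μY.prod (μZ.prod μA)] M.pc β) :
    (law μY μZ μA q).map Prod.fst = densMeasure μY (M.py (theta β)) := by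
  rw [law_eq_densMeasure, densMeasure_congr h]
  unfold py
  rw [px_theta hβ]
  exact law_map_fst (M.isDensity β hβ)

lemma IsOptimal.integral_lt (hq : IsDensity (μY.prod (μZ.prod μA)) q)
    (hβ : M.IsOptimal q βbar) {β : Fin d ⊕ Fin f → ℝ} (h : β ∈ M.space) (hne : β ≠ βbar) :
    ∫ b, Real.log (M.pb β b) ∂((law μY μZ μA q).map obs) <
      ∫ b, Real.log (M.pb βbar b) ∂((law μY μZ μA q).map obs) := by
  rw [hq.margB.2, hq.margB.1.integral_densMeasure, hq.margB.1.integral_densMeasure]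
  exact hβ.2 β h hne

/-- Under correct specification the true density is the one at the optimal parameter. -/
lemma IsOptimal.ae_eq (hq : IsDensity (μY.prod (μZ.prod μA)) q) (hβ : M.IsOptimal q βbar)
    (hM : M.IsRegular q βbar)
    (hspec : ∃ β₀ ∈ M.space, q =ᵐ[μY.prod (μZ.prod μA)] M.pc β₀) :
    q =ᵐ[μY.prod (μZ.prod μA)] M.pc βbar := by
  obtain ⟨β₀, h₀, hq₀⟩ := hspec
  rcases eq_or_ne β₀ βbar with rfl | hne
  · exact hq₀
  · exfalso
    -- Strict optimality of `βbar` would make its mean log-density exceed that of the true density,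
    -- against Gibbs' inequality.
    have h1 := hβ.integral_lt hq h₀ hne
    have hR := hM.regularB
    rw [map_obs_of_ae_eq h₀ hq₀] at h1 hR
    have hg : ∀ β ∈ M.space, Measurable (M.pb β) := fun β h => (isDensity_pb h).measurable
    have := (isDensity_pb h₀).isProbabilityMeasure
    exact absurd h1 (not_lt.2 (gibbs (isDensity_pb h₀) (isDensity_pb hβ.1)
      (fun u => hR.support u βbar hβ.1 β₀ h₀) ((hR.memLp_log hg h₀).integrable (by norm_num))
      ((hR.memLp_log hg hβ.1).integrable (by norm_num))))

lemma Ib_eq_info (hM : M.IsRegular q βbar) :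
    M.Ib q βbar = info ((law μY μZ μA q).map obs) M.pb βbar :=
  (info_map measurable_obs hM.regularB fun _ h => (isDensity_pb h).measurable).symm

lemma Ix_eq_info (hM : M.IsRegular q βbar) :
    M.Ix q βbar = info ((law μY μZ μA q).map prim) (fun β => M.px (theta β)) βbar :=
  (info_map measurable_prim hM.regularX fun _ h => (isDensity_px h).measurable).symm

lemma Iy_eq_info (hM : M.IsRegular q βbar) :
    M.Iy q βbar = info ((law μY μZ μA q).map Prod.fst) (fun β => M.py (theta β)) βbar :=
  (info_map measurable_fst hM.regularY fun _ h => (isDensity_py h).measurable).symm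

lemma map_obs_map_fst :
    ((law μY μZ μA q).map obs).map Prod.fst = (law μY μZ μA q).map Prod.fst := by
  rw [Measure.map_map measurable_fst measurable_obs]
  rfl

/-- Regarding `p_y` as a family on the space of `b` lets both likelihoods be expanded along the same
sample. -/
lemma regularY_obs (hM : M.IsRegular q βbar) :
    Regular M.space βbar ((law μY μZ μA q).map obs) 2 fun β b => M.py (theta β) b.1 :=
  Regular.comp measurable_fst (by rw [map_obs_map_fst]; exact hM.regularY)

lemma Iy_eq_info_obs (hM : M.IsRegular q βbar) : M.Iy q βbar =
    info ((law μY μZ μA q).map obs) (fun β b => M.py (theta β) b.1) βbar := by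
  rw [Iy_eq_info hM, ← map_obs_map_fst]
  exact info_map measurable_fst (by rw [map_obs_map_fst]; exact hM.regularY)
    fun _ h => (isDensity_py h).measurable

lemma space_mem_nhds (hM : M.IsRegular q βbar) : M.space ∈ 𝓝 βbar := by
  obtain ⟨N, hN, hβN, hNS, -⟩ := hM.regularB.smooth
  exact mem_of_superset (hN.mem_nhds hβN) hNS

lemma Jb_apply (hM : M.IsRegular q βbar) (i j : Fin d ⊕ Fin f) : M.Jb q βbar i j =
    ∫ b, grad (fun β => Real.log (M.pb β b)) βbar i *
      grad (fun β => Real.log (M.pb β b)) βbar j ∂((law μY μZ μA q).map obs) := by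
  have hm := hM.regularB.measurable_grad fun _ h => (isDensity_pb h).measurable
  exact (integral_map measurable_obs.aemeasurable
    ((hm i).mul (hm j)).aestronglyMeasurable).symm

lemma Kby_apply (hM : M.IsRegular q βbar) (i j : Fin d ⊕ Fin f) : M.Kby q βbar i j =
    ∫ b, grad (fun β => Real.log (M.pb β b)) βbar i *
      grad (fun β => Real.log (M.py (theta β) b.1)) βbar j ∂((law μY μZ μA q).map obs) := by
  have hm := hM.regularB.measurable_grad fun _ h => (isDensity_pb h).measurable
  have hm' := (regularY_obs hM).measurable_grad fun _ h =>
    (isDensity_py h).measurable.comp measurable_fst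
  exact (integral_map measurable_obs.aemeasurable
    ((hm i).mul (hm' j)).aestronglyMeasurable).symm

lemma dominatedDiff_pb (hM : M.IsRegular q βbar) :
    DominatedDiff βbar (μY.prod μA) M.pb :=
  hM.dominated.dominatedDiff (fun _ h => (isDensity_pb h).nonneg) hM.regularB

theorem Jb_eq_Ib (hM : M.IsRegular q βbar) (h : q =ᵐ[μY.prod (μZ.prod μA)] M.pc βbar) :
    M.Jb q βbar = M.Ib q βbar := by
  ext i j
  have hR := hM.regularB
  rw [Jb_apply hM, Ib_eq_info hM]
  rw [map_obs_of_ae_eq hR.mem h] at hR ⊢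
  exact hR.info_eq (fun _ h => isDensity_pb h) (by norm_num) (dominatedDiff_pb hM) i j

/-- Conditioning on `Y` replaces the score of `B` by that of `Y`; the information identity for `p_y`
then applies, its domination being inherited from `p_b`. -/
theorem Kby_eq_Iy (hM : M.IsRegular q βbar) (h : q =ᵐ[μY.prod (μZ.prod μA)] M.pc βbar) :
    M.Kby q βbar = M.Iy q βbar := by
  ext i j
  have hR := hM.regularB
  have hRy := hM.regularY
  rw [Kby_apply hM, Iy_eq_info hM]
  rw [map_fst_of_ae_eq hR.mem h] at hRy ⊢
  rw [map_obs_of_ae_eq hR.mem h] at hR ⊢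
  rw [integral_score_mul_score (fun _ h => isDensity_pb h) (fun _ h => isDensity_py h)
    (fun _ h => py_ae_eq h) hR hRy hM.dominated i j]
  exact hRy.info_eq (fun _ h => isDensity_py h) (by norm_num)
    ((dominatedDiff_pb hM).marginal (space_mem_nhds hM) (fun _ h => isDensity_pb h)
      fun _ h => py_ae_eq h) i j

lemma Ib_isSymm (hM : M.IsRegular q βbar) : (M.Ib q βbar).IsSymm := by
  rw [Ib_eq_info hM]
  exact info_isSymm hM.regularB

/-- Almost surely, the densities of `X` and of `Y` at `β̄` are positive. -/
lemma ae_px_py_pos (hM : M.IsRegular q βbar) (h : q =ᵐ[μY.prod (μZ.prod μA)] M.pc βbar) :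
    ∀ᵐ x ∂((law μY μZ μA q).map prim),
      0 < M.px (theta βbar) x ∧ 0 < M.py (theta βbar) x.1 := by
  have hbar := hM.regularB.mem
  rw [map_prim_of_ae_eq hbar h]
  have h1 := (isDensity_px hbar).ae_pos
  have h2 := (isDensity_py hbar).ae_pos
  have h3 := (isDensity_px hbar).margY.2
  have h4 : ∀ᵐ x ∂(densMeasure (μY.prod μZ) (M.px (theta βbar))), 0 < M.py (theta βbar) x.1 :=
    (MeasurePreserving.mk measurable_fst h3).quasiMeasurePreserving.ae h2
  filter_upwards [h1, h4] with x hx hx'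
  exact ⟨hx, hx'⟩

/-- Almost surely both densities are positive at `βbar`, hence on the whole parameter space by
common support, and there the logarithm of the quotient splits. -/
theorem Izy_eq_sub (hM : M.IsRegular q βbar) (h : q =ᵐ[μY.prod (μZ.prod μA)] M.pc βbar) :
    M.Izy q βbar = M.Ix q βbar - M.Iy q βbar := by
  have hbar := hM.regularB.mem
  have hRx := Regular.comp measurable_prim hM.regularX
  have hRy := Regular.comp measurable_fst hM.regularY
  have hgx : ∀ β ∈ M.space, Measurable fun c : Y × Z × A => M.px (theta β) (prim c) :=
    fun β hβ => (isDensity_px hβ).measurable.comp measurable_prim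
  have hgy : ∀ β ∈ M.space, Measurable fun c : Y × Z × A => M.py (theta β) c.1 :=
    fun β hβ => (isDensity_py hβ).measurable.comp measurable_fst
  ext i j
  have : IsFiniteMeasure (law μY μZ μA q) := by
    have := (M.isDensity βbar hbar).isProbabilityMeasure
    rw [law_eq_densMeasure, densMeasure_congr h]
    infer_instance
  have ix := (hRx.memLp_hess hgx i j).integrable le_rfl
  have iy := (hRy.memLp_hess hgy i j).integrable (by norm_num)
  simp only [Izy, Ix, Iy, Matrix.of_apply, Matrix.sub_apply]
  rw [sub_neg_eq_add, neg_add_eq_sub, ← neg_sub, ← integral_sub ix iy]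
  congr 1
  refine integral_congr_ae ?_
  filter_upwards [ae_of_ae_map measurable_prim.aemeasurable (ae_px_py_pos hM h)] with c hc
  obtain ⟨N, hN, hβN, hNS, hs, -⟩ := hRx.smooth
  obtain ⟨N', hN', hβN', hNS', hs', -⟩ := hRy.smooth
  rw [← hess_sub (hN.inter hN') ((hs c).mono Set.inter_subset_left)
    ((hs' c).mono Set.inter_subset_right) ⟨hβN, hβN'⟩]
  refine congrFun (congrFun (hess_congr ?_) i) j
  filter_upwards [space_mem_nhds hM] with β hβ
  have h1 : M.px (theta β) (prim c) ≠ 0 := fun h0 =>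
    hc.1.ne' (hRx.support c β hβ βbar hbar h0)
  have h2 : M.py (theta β) c.1 ≠ 0 := fun h0 => hc.2.ne' (hRy.support c β hβ βbar hbar h0)
  exact Real.log_div h1 h2

/-- The last trace reduces to that of `(I_x - I_y) I_b⁻¹`, and one of the two copies of the trace of
`I_y I_b⁻¹` cancels. -/
theorem riskHat_eq_aicXB (hM : M.IsRegular q βbar)
    (h : q =ᵐ[μY.prod (μZ.prod μA)] M.pc βbar) {n : ℕ} (bs : Fin n → Y × A) (θ : Fin d → ℝ) :
    M.riskHat q βbar bs θ = M.aicXB q βbar bs θ := by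
  unfold riskHat aicXB
  rw [Jb_eq_Ib hM h, Kby_eq_Iy hM h, Izy_eq_sub hM h,
    nonsing_inv_mul_cancel_right _ _ hM.nonsingular, sub_mul, trace_sub, trace_mul_comm (M.Ib q βbar)⁻¹]
  ring

/-- The conditional log-density integrates to a difference of entropies. -/
lemma integral_log_condZ {p : Y × Z → ℝ} (hp : IsDensity (μY.prod μZ) p)
    (ix : Integrable (fun x => Real.log (p x)) (densMeasure (μY.prod μZ) p))
    (iy : Integrable (fun y => Real.log (margY μZ p y)) (densMeasure μY (margY μZ p))) :
    Integrable (fun x => p x * Real.log (condZ μZ p x)) (μY.prod μZ) ∧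
      ∫ x, p x * Real.log (condZ μZ p x) ∂(μY.prod μZ) =
        ∫ x, Real.log (p x) ∂(densMeasure (μY.prod μZ) p) -
          ∫ y, Real.log (margY μZ p y) ∂(densMeasure μY (margY μZ p)) := by
  have hfst : MeasurePreserving Prod.fst (densMeasure (μY.prod μZ) p)
      (densMeasure μY (margY μZ p)) := ⟨measurable_fst, hp.margY.2⟩
  have iy' : Integrable (fun x : Y × Z => Real.log (margY μZ p x.1))
      (densMeasure (μY.prod μZ) p) :=
    (hfst.integrable_comp iy.aestronglyMeasurable).2 iy
  have e : ∫ y, Real.log (margY μZ p y) ∂(densMeasure μY (margY μZ p)) =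
      ∫ x : Y × Z, Real.log (margY μZ p x.1) ∂(densMeasure (μY.prod μZ) p) := by
    rw [← hp.margY.2]
    exact integral_map measurable_fst.aemeasurable hp.margY.1.measurable.log.aestronglyMeasurable
  have hae : (fun x => Real.log (condZ μZ p x)) =ᵐ[densMeasure (μY.prod μZ) p]
      fun x => Real.log (p x) - Real.log (margY μZ p x.1) := by
    filter_upwards [hp.ae_pos, hfst.quasiMeasurePreserving.ae hp.margY.1.ae_pos] with x h1 h2
    exact Real.log_div h1.ne' h2.ne'
  rw [e, ← integral_sub ix iy', ← integral_congr_ae hae, hp.integral_densMeasure]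
  exact ⟨hp.integrable_densMeasure_iff.1 ((ix.sub iy').congr hae.symm), rfl⟩

lemma constIntegrand_ae_eq (hβ : βbar ∈ M.space)
    (h : q =ᵐ[μY.prod (μZ.prod μA)] M.pc βbar) :
    constIntegrand μZ μA q =ᵐ[μY.prod μZ] fun x => M.px (theta βbar) x *
      Real.log (condZ μZ (M.px (theta βbar)) x) := by
  have hx : margX μA q =ᵐ[μY.prod μZ] M.px (theta βbar) := by
    rw [px_theta hβ]
    exact margX_congr_ae h
  have hy : ∀ᵐ x ∂(μY.prod μZ), margY μZ (margX μA q) x.1 = margY μZ (M.px (theta βbar)) x.1 :=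
    Measure.quasiMeasurePreserving_fst.ae (margY_congr_ae hx)
  filter_upwards [hx, hy] with x h1 h2
  simp only [constIntegrand, condZ, h1, h2]

/-- The integrand of `C(q_x)` is integrable, and `C(q_x)` is a difference of entropies. -/
theorem constC_eq (hM : M.IsRegular q βbar) (h : q =ᵐ[μY.prod (μZ.prod μA)] M.pc βbar) :
    Integrable (constIntegrand μZ μA q) (μY.prod μZ) ∧ constC μY μZ μA q =
      ∫ x, Real.log (M.px (theta βbar) x) ∂((law μY μZ μA q).map prim) -
        ∫ b, Real.log (M.py (theta βbar) b.1) ∂((law μY μZ μA q).map obs) := by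
  have hbar := hM.regularB.mem
  have hRx := hM.regularX
  have hRy := hM.regularY
  have mpy := (isDensity_py hbar).measurable.log
  have e1 : ∫ b, Real.log (M.py (theta βbar) b.1) ∂((law μY μZ μA q).map obs) =
      ∫ y, Real.log (M.py (theta βbar) y) ∂((law μY μZ μA q).map Prod.fst) := by
    rw [← map_obs_map_fst]
    exact (integral_map measurable_fst.aemeasurable mpy.aestronglyMeasurable).symm
  rw [e1]
  rw [map_fst_of_ae_eq hbar h] at hRy ⊢
  rw [map_prim_of_ae_eq hbar h] at hRx ⊢
  have := (isDensity_px hbar).isProbabilityMeasure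
  have := (isDensity_py hbar).isProbabilityMeasure
  have ix := (hRx.memLp_log (fun _ h => (isDensity_px h).measurable) hbar).integrable le_rfl
  have iy := (hRy.memLp_log (fun _ h => (isDensity_py h).measurable) hbar).integrable
    (by norm_num)
  have key := integral_log_condZ (isDensity_px hbar) ix iy
  have hae := constIntegrand_ae_eq hbar h
  exact ⟨key.1.congr hae.symm, (integral_congr_ae hae).trans key.2⟩

lemma lossX_eq (hq : IsDensity (μY.prod (μZ.prod μA)) q) (θ : Fin d → ℝ) :
    M.lossX q θ = -∫ x, Real.log (M.px θ x) ∂((law μY μZ μA q).map prim) := by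
  rw [hq.margX.2, hq.margX.1.integral_densMeasure, lossX]

/-- Correct specification is essential: `βbar` is defined through `p_b`, and it maximizes the mean
of `log p_x` only because the true density of `X` is `p_x` at `βbar`, by Gibbs' inequality. -/
lemma meanGrad_px (hM : M.IsRegular q βbar) (h : q =ᵐ[μY.prod (μZ.prod μA)] M.pc βbar) :
    meanGrad ((law μY μZ μA q).map prim) (fun β => M.px (theta β)) βbar = 0 := by
  have hbar := hM.regularB.mem
  have hR := hM.regularX
  have hg : ∀ β ∈ M.space, Measurable (M.px (theta β)) := fun β h => (isDensity_px h).measurable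
  have hp := isDensity_px hbar
  rw [map_prim_of_ae_eq hbar h] at hR ⊢
  have := hp.isProbabilityMeasure
  exact (hR.stationary hg le_rfl fun β hβ => gibbs hp (isDensity_px hβ)
    (fun u => hR.support u β hβ βbar hbar) ((hR.memLp_log hg hbar).integrable le_rfl)
    ((hR.memLp_log hg hβ).integrable le_rfl)).1

lemma meanGrad_py (hM : M.IsRegular q βbar) (h : q =ᵐ[μY.prod (μZ.prod μA)] M.pc βbar) :
    meanGrad ((law μY μZ μA q).map obs) (fun β b => M.py (theta β) b.1) βbar = 0 := by
  have hbar := hM.regularB.mem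
  have hR := hM.regularY
  have hg : ∀ β ∈ M.space, Measurable (M.py (theta β)) := fun β h => (isDensity_py h).measurable
  have hp := isDensity_py hbar
  rw [← meanGrad_map (g := fun β => M.py (theta β)) measurable_fst
    (by rw [map_obs_map_fst]; exact hR) hg, map_obs_map_fst]
  rw [map_fst_of_ae_eq hbar h] at hR ⊢
  have := hp.isProbabilityMeasure
  exact (hR.stationary hg (by norm_num) fun β hβ => gibbs hp (isDensity_py hβ)
    (fun u => hR.support u β hβ βbar hbar)
    ((hR.memLp_log hg hbar).integrable (by norm_num))
    ((hR.memLp_log hg hβ).integrable (by norm_num))).1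

lemma isProbabilityMeasure_law (hq : IsDensity (μY.prod (μZ.prod μA)) q) :
    IsProbabilityMeasure (law μY μZ μA q) := hq.isProbabilityMeasure

lemma continuousOn_lossX (hq : IsDensity (μY.prod (μZ.prod μA)) q) (hM : M.IsRegular q βbar) :
    ContinuousOn (fun β => M.lossX q (theta β)) M.space := by
  have := isProbabilityMeasure_law hq
  have := Measure.isProbabilityMeasure_map (μ := law μY μZ μA q) measurable_prim.aemeasurable
  simp_rw [lossX_eq hq]
  exact (hM.regularX.continuousOn_mean le_rfl fun β h => (isDensity_px h).measurable).neg

/-- The loss is minus the mean log-density, so its Hessian is `+I_x`; the linear term vanishes by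
`meanGrad_px`. -/
lemma lossX_expansion (hq : IsDensity (μY.prod (μZ.prod μA)) q) (hM : M.IsRegular q βbar)
    (h : q =ᵐ[μY.prod (μZ.prod μA)] M.pc βbar) {η : ℝ} (hη : 0 < η) :
    ∃ ρ > 0, ∀ δ, ‖δ‖ < ρ → |M.lossX q (theta (βbar + δ)) - M.lossX q (theta βbar)
      - 1 / 2 * (δ ⬝ᵥ (M.Ix q βbar *ᵥ δ))| ≤ η * ‖δ‖ ^ 2 := by
  have := isProbabilityMeasure_law hq
  have := Measure.isProbabilityMeasure_map (μ := law μY μZ μA q) measurable_prim.aemeasurable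
  obtain ⟨ρ, hρ, -, hexp⟩ := hM.regularX.mean_expansion
    (fun β h => (isDensity_px h).measurable) le_rfl hη
  refine ⟨ρ, hρ, fun δ hδ => le_trans (le_of_eq ?_) (hexp δ hδ)⟩
  rw [meanGrad_px hM h, Ix_eq_info hM, lossX_eq hq, lossX_eq hq, zero_dotProduct, ← abs_neg]
  congr 1
  ring

lemma trace_mul_eq_sum {ι : Type} [Fintype ι] (A B : Matrix ι ι ℝ) :
    (A * B).trace = ∑ i, ∑ j, A i j * B j i := by
  simp [Matrix.trace, Matrix.mul_apply]

/-! ### Asymptotic unbiasedness of the criterion -/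

section Asymptotics

variable {Ω : Type*} [MeasurableSpace Ω] {P : Measure Ω} [IsProbabilityMeasure P]
  {C : ℕ → Ω → Y × Z × A} {βhat : (n : ℕ) → (Fin n → Y × A) → (Fin d ⊕ Fin f → ℝ)}

lemma iid_obs (hCmeas : ∀ i, Measurable (C i)) (hCindep : iIndepFun C P)
    (hClaw : ∀ i, P.map (C i) = law μY μZ μA q) :
    IID P ((law μY μZ μA q).map obs) fun i ω => obs (C i ω) where
  measurable i := measurable_obs.comp (hCmeas i)
  indep := hCindep.comp (fun _ => obs) fun _ => measurable_obs
  law i := by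
    rw [← hClaw i, Measure.map_map measurable_obs (hCmeas i)]
    rfl

lemma ellY_eq_sampleMean (θ : Fin d → ℝ) (n : ℕ) (ω : Ω) :
    M.ellY (fun i : Fin n => obs (C i ω)) θ =
      sampleMean (fun i ω => obs (C i ω)) (fun b => Real.log (M.py θ b.1)) n ω := by
  simp only [ellY, sampleMean, Finset.sum_range]

lemma ellB_eq_sampleMean (β : Fin d ⊕ Fin f → ℝ) (n : ℕ) (ω : Ω) :
    M.ellB (fun i : Fin n => obs (C i ω)) β =
      sampleMean (fun i ω => obs (C i ω)) (fun b => Real.log (M.pb β b)) n ω := by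
  simp only [ellB, sampleMean, Finset.sum_range]

/-- The mean sum of the excess log-likelihood of `Y` and the excess loss of `X`. -/
theorem tendsto_mul_integral_excess (hq : IsDensity (μY.prod (μZ.prod μA)) q)
    (hβbar : M.IsOptimal q βbar) (hM : M.IsRegular q βbar)
    (h : q =ᵐ[μY.prod (μZ.prod μA)] M.pc βbar)
    (hCmeas : ∀ i, Measurable (C i)) (hCindep : iIndepFun C P)
    (hClaw : ∀ i, P.map (C i) = law μY μZ μA q) (hβhat : M.IsMLE βhat) :
    (∀ n : ℕ, Integrable (fun ω => M.ellY (fun i : Fin n => obs (C i ω))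
      (theta (βhat n fun i => obs (C i ω)))) P) ∧
    (∀ n : ℕ, Integrable (fun ω => M.lossX q (theta (βhat n fun i => obs (C i ω)))) P) ∧
    Tendsto (fun n : ℕ => n * ∫ ω, (M.ellY (fun i : Fin n => obs (C i ω))
        (theta (βhat n fun i => obs (C i ω)))
        - M.ellY (fun i : Fin n => obs (C i ω)) (theta βbar)
        + (M.lossX q (theta (βhat n fun i => obs (C i ω))) - M.lossX q (theta βbar))) ∂P) atTop
      (𝓝 (1 / 2 * ((M.Ix q βbar * (M.Ib q βbar)⁻¹).trace
        + (M.Iy q βbar * (M.Ib q βbar)⁻¹).trace))) := by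
  have key := tendsto_mul_integral_increment (iid_obs hCmeas hCindep hClaw) hM.isCompact
    hM.regularB (regularY_obs hM) (fun β h => (isDensity_pb h).measurable)
    (fun β h => (isDensity_py h).measurable.comp measurable_fst)
    (fun β h hne => hβbar.integral_lt hq h hne) (meanGrad_py hM h)
    (by rw [← Ib_eq_info hM]; exact hM.nonsingular)
    (continuousOn_lossX hq hM) (fun η hη => lossX_expansion hq hM h hη)
    (βhat := fun n ω => βhat n fun i : Fin n => obs (C i ω))
    (fun n => (hβhat n).1.comp (measurable_pi_lambda _ fun i =>
      measurable_obs.comp (hCmeas i)))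
    (fun n ω => ((hβhat n).2 _).1)
    (fun n ω β hβ => by
      rw [← ellB_eq_sampleMean, ← ellB_eq_sampleMean]
      exact ((hβhat n).2 _).2 β hβ)
  rw [← Ib_eq_info hM, ← Iy_eq_info_obs hM] at key
  simp only [← ellY_eq_sampleMean] at key
  refine ⟨key.1, key.2.1, ?_⟩
  convert key.2.2 using 2
  -- The factors stand in the order opposite to that in `Kby`, hence the indices `j i`, which is the
  -- pattern of the trace of a product.
  have hK : ∀ i j, ∫ u, grad (fun β => Real.log (M.py (theta β) u.1)) βbar i *
      grad (fun β => Real.log (M.pb β u)) βbar j ∂((law μY μZ μA q).map obs) =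
      M.Iy q βbar j i := fun i j => by
    rw [← Kby_eq_Iy hM h, Kby_apply hM]
    simp only [mul_comm]
  have hJ : ∀ i j, ∫ u, grad (fun β => Real.log (M.pb β u)) βbar i *
      grad (fun β => Real.log (M.pb β u)) βbar j ∂((law μY μZ μA q).map obs) =
      M.Ib q βbar j i := fun i j => by
    rw [← Jb_apply hM, Jb_eq_Ib hM h, (Ib_isSymm hM).apply]
  simp only [hK, hJ]
  rw [← trace_mul_eq_sum, ← trace_mul_eq_sum, transpose_nonsing_inv, (Ib_isSymm hM).eq,
    nonsing_inv_mul_cancel_right _ _ hM.nonsingular, mul_sub, trace_sub,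
    trace_mul_comm _ (M.Ix q βbar), trace_mul_comm _ (M.Iy q βbar)]
  ring

lemma integrable_aicXB {n : ℕ} (hY : Integrable (fun ω => M.ellY (fun i : Fin n => obs (C i ω))
      (theta (βhat n fun i => obs (C i ω)))) P) :
    Integrable (fun ω => M.aicXB q βbar (fun i : Fin n => obs (C i ω))
      (theta (βhat n fun i => obs (C i ω)))) P :=
  ((hY.const_mul _).add (integrable_const _)).add (integrable_const _)

/-- `AIC_{x;b}` is asymptotically unbiased. -/
theorem tendsto_integral_aicXB_sub (hq : IsDensity (μY.prod (μZ.prod μA)) q)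
    (hβbar : M.IsOptimal q βbar) (hM : M.IsRegular q βbar)
    (h : q =ᵐ[μY.prod (μZ.prod μA)] M.pc βbar)
    (hCmeas : ∀ i, Measurable (C i)) (hCindep : iIndepFun C P)
    (hClaw : ∀ i, P.map (C i) = law μY μZ μA q) (hβhat : M.IsMLE βhat) :
    Tendsto (fun n : ℕ =>
      (∫ ω, M.aicXB q βbar (fun i : Fin n => obs (C i ω))
        (theta (βhat n fun i => obs (C i ω))) ∂P)
      - (2 * n * (∫ ω, M.lossX q (theta (βhat n fun i => obs (C i ω))) ∂P)
        + 2 * n * constC μY μZ μA q)) atTop (𝓝 0) := by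
  obtain ⟨hY, hL, hlim⟩ :=
    tendsto_mul_integral_excess hq hβbar hM h hCmeas hCindep hClaw hβhat
  have := isProbabilityMeasure_law hq
  have := Measure.isProbabilityMeasure_map (μ := law μY μZ μA q) measurable_obs.aemeasurable
  have hX : IID P ((law μY μZ μA q).map obs) fun i ω => obs (C i ω) := iid_obs hCmeas hCindep hClaw
  have lY : MemLp (fun b : Y × A => Real.log (M.py (theta βbar) b.1)) 2
      ((law μY μZ μA q).map obs) := (regularY_obs hM).memLp_log
    (fun β h => (isDensity_py h).measurable.comp measurable_fst) hM.regularB.mem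
  have iY := lY.integrable (by norm_num)
  -- Minus twice the limiting excess cancels the two penalty traces. The terms at `βbar` subtracted
  -- in the excess add up to `C(q_x)`, up to sign.
  have hlim' := (hlim.const_mul (-2)).add_const
    ((M.Ix q βbar * (M.Ib q βbar)⁻¹).trace + (M.Iy q βbar * (M.Ib q βbar)⁻¹).trace)
  refine (hlim'.congr' ?_).trans (by ring_nf; exact le_rfl)
  -- For the empty sample the log-likelihood is 0 and need not have the right expectation.
  filter_upwards [eventually_ne_atTop 0] with n hn
  have iM : Integrable (fun ω => M.ellY (fun i : Fin n => obs (C i ω)) (theta βbar)) P := by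
    simp only [ellY_eq_sampleMean]
    exact (hX.memLp_sampleMean lY n).integrable (by norm_num)
  have eM : ∫ ω, M.ellY (fun i : Fin n => obs (C i ω)) (theta βbar) ∂P =
      ∫ b, Real.log (M.py (theta βbar) b.1) ∂((law μY μZ μA q).map obs) := by
    simp only [ellY_eq_sampleMean]
    exact hX.integral_sampleMean iY hn
  have e1 := integral_add ((hY n).sub iM) ((hL n).sub (integrable_const (M.lossX q (theta βbar))))
  have e2 := integral_sub (hY n) iM
  have e3 := integral_sub (hL n) (integrable_const (M.lossX q (theta βbar)))
  have e4 : ∫ ω, M.aicXB q βbar (fun i : Fin n => obs (C i ω))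
      (theta (βhat n fun i => obs (C i ω))) ∂P = -2 * n * ∫ ω, M.ellY (fun i : Fin n => obs (C i ω))
        (theta (βhat n fun i => obs (C i ω))) ∂P + (M.Ix q βbar * (M.Ib q βbar)⁻¹).trace
        + (M.Iy q βbar * (M.Ib q βbar)⁻¹).trace := by
    simp only [aicXB, add_assoc]
    rw [integral_add ((hY n).const_mul _) (integrable_const _), integral_const_mul]
    simp
  simp only [Pi.sub_apply] at e1
  rw [e1, e2, e3, e4, eM, (constC_eq hM h).2, lossX_eq hq (theta βbar)]
  simp only [integral_const, probReal_univ, one_smul]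
  ring

end Asymptotics

/-! ### Special cases: no auxiliary data, no missing data -/

section SpecialCases

lemma trace_Ib_mul_inv (hM : M.IsRegular q βbar) :
    (M.Ib q βbar * (M.Ib q βbar)⁻¹).trace = d + f := by
  rw [mul_nonsing_inv _ hM.nonsingular, trace_one]
  simp

/-- Without auxiliary data, the densities of `B` are those of `Y`. -/
lemma pb_eq_py [Subsingleton A] (hA : μA Set.univ = 1) {β : Fin d ⊕ Fin f → ℝ}
    (hβ : β ∈ M.space) (b : Y × A) : M.pb β b = M.py (theta β) b.1 := by
  have : IsProbabilityMeasure μA := ⟨hA⟩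
  unfold pb py margB margY
  rw [px_theta hβ]
  unfold margX
  refine integral_congr_ae (ae_of_all _ fun z => ?_)
  have : ∀ a, M.pc β (b.1, z, a) = M.pc β (b.1, z, b.2) := fun a => by
    rw [Subsingleton.elim a b.2]
  simp [this]

lemma Ib_eq_Iy [Subsingleton A] (hA : μA Set.univ = 1) (hM : M.IsRegular q βbar) :
    M.Ib q βbar = M.Iy q βbar := by
  ext i j
  simp only [Ib, Iy, of_apply]
  congr 2
  ext c
  refine congrFun (congrFun (hess_congr ?_) i) j
  filter_upwards [space_mem_nhds hM] with β hβ
  rw [pb_eq_py hA hβ, obs]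

/-- If there are no missing data, the densities of `X` are those of `Y`. -/
lemma px_eq_py [Subsingleton Z] (hZ : μZ Set.univ = 1) (θ : Fin d → ℝ) (x : Y × Z) :
    M.px θ x = M.py θ x.1 := by
  have : IsProbabilityMeasure μZ := ⟨hZ⟩
  have : ∀ z, M.px θ (x.1, z) = M.px θ x := fun z => by
    rw [Subsingleton.elim z x.2]
  simp [py, margY, this]

lemma Ix_eq_Iy [Subsingleton Z] (hZ : μZ Set.univ = 1) : M.Ix q βbar = M.Iy q βbar := by
  simp only [Ix, Iy, px_eq_py hZ, prim]

lemma ellB_eq_ellY [Subsingleton A] (hA : μA Set.univ = 1) {β : Fin d ⊕ Fin f → ℝ}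
    (hβ : β ∈ M.space) {n : ℕ} (bs : Fin n → Y × A) : M.ellB bs β = M.ellY bs (theta β) := by
  simp only [ellB, ellY, pb_eq_py hA hβ]

/-- With trivial auxiliary data the likelihood of `B` at any admissible `β` is that of `Y` at `theta
β`, so maximizing over the parameter space maximizes over its projection. -/
lemma IsMLE.theta_isMax [Subsingleton A] (hA : μA Set.univ = 1)
    {βhat : (n : ℕ) → (Fin n → Y × A) → (Fin d ⊕ Fin f → ℝ)} (hβhat : M.IsMLE βhat) (n : ℕ)
    (bs : Fin n → Y × A) : theta (βhat n bs) ∈ M.thetaSpace ∧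
      ∀ θ ∈ M.thetaSpace, M.ellY bs θ ≤ M.ellY bs (theta (βhat n bs)) := by
  obtain ⟨h1, h2⟩ := (hβhat n).2 bs
  refine ⟨⟨_, h1, rfl⟩, ?_⟩
  rintro _ ⟨β, hβ, rfl⟩
  rw [← ellB_eq_ellY hA hβ, ← ellB_eq_ellY hA h1]
  exact h2 β hβ

end SpecialCases

end Model

end AuxIC

end

open AuxIC in
theorem mainTheorem2
    {Y Z A Ω : Type*} [MeasurableSpace Y] [MeasurableSpace Z] [MeasurableSpace A]
    [MeasurableSpace Ω]
    (μY : Measure Y) (μZ : Measure Z) (μA : Measure A)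
    [SigmaFinite μY] [SigmaFinite μZ] [SigmaFinite μA]
    (d f : ℕ) (M : Model μY μZ μA d f)
    -- the true density of `C = (Y, Z, A)`
    (q : Y × Z × A → ℝ) (hq : IsDensity (μY.prod (μZ.prod μA)) q)
    -- the optimal parameter and the regularity conditions
    (βbar : Fin d ⊕ Fin f → ℝ) (hβbar : M.IsOptimal q βbar) (hM : M.IsRegular q βbar)
    -- independent copies of `C`
    (P : Measure Ω) [IsProbabilityMeasure P] (C : ℕ → Ω → Y × Z × A)
    (hCmeas : ∀ i, Measurable (C i)) (hCindep : iIndepFun C P)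
    (hClaw : ∀ i, P.map (C i) = law μY μZ μA q)
    -- the maximum likelihood estimator computed from `B = (Y, A)`
    (βhat : (n : ℕ) → (Fin n → Y × A) → (Fin d ⊕ Fin f → ℝ)) (hβhat : M.IsMLE βhat)
    -- correct specification
    (hspec : ∃ β₀ ∈ M.space, q =ᵐ[μY.prod (μZ.prod μA)] M.pc β₀) :
    M.Jb q βbar = M.Ib q βbar ∧
    M.Kby q βbar = M.Iy q βbar ∧
    (∀ (n : ℕ) (bs : Fin n → Y × A),
      M.riskHat q βbar bs (theta (βhat n bs)) = M.aicXB q βbar bs (theta (βhat n bs))) ∧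
    -- asymptotic unbiasedness, with finite expectations
    Integrable (constIntegrand μZ μA q) (μY.prod μZ) ∧
    (∀ n : ℕ, Integrable (fun ω => M.aicXB q βbar (fun i : Fin n => obs (C i ω))
      (theta (βhat n fun i => obs (C i ω)))) P) ∧
    (∀ n : ℕ, Integrable (fun ω => M.lossX q (theta (βhat n fun i => obs (C i ω)))) P) ∧
    Tendsto (fun n : ℕ =>
      (∫ ω, M.aicXB q βbar (fun i : Fin n => obs (C i ω))
        (theta (βhat n fun i => obs (C i ω))) ∂P)
      - (2 * n * (∫ ω, M.lossX q (theta (βhat n fun i => obs (C i ω))) ∂P)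
        + 2 * n * constC μY μZ μA q)) atTop (𝓝 0) ∧
    -- the case `B = Y`: `θ̂_b` is the maximum likelihood estimator from `Y`, and `AIC_{x;y}`
    (f = 0 → Subsingleton A → μA Set.univ = 1 → ∀ (n : ℕ) (bs : Fin n → Y × A),
      (theta (βhat n bs) ∈ M.thetaSpace ∧
        ∀ θ ∈ M.thetaSpace, M.ellY bs θ ≤ M.ellY bs (theta (βhat n bs))) ∧
      M.aicXB q βbar bs (theta (βhat n bs)) =
        -2 * n * M.ellY bs (theta (βhat n bs))
          + (M.Ix q βbar * (M.Iy q βbar)⁻¹).trace + d) ∧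
    -- the case `X = Y`: `AIC_{y;b}`
    (Subsingleton Z → μZ Set.univ = 1 → ∀ (n : ℕ) (bs : Fin n → Y × A),
      M.aicXB q βbar bs (theta (βhat n bs)) =
        -2 * n * M.ellY bs (theta (βhat n bs))
          + 2 * (M.Iy q βbar * (M.Ib q βbar)⁻¹).trace) ∧
    -- the case `X = Y = B`: the original AIC
    (f = 0 → Subsingleton A → μA Set.univ = 1 → Subsingleton Z → μZ Set.univ = 1 →
      ∀ (n : ℕ) (bs : Fin n → Y × A),
      M.aicXB q βbar bs (theta (βhat n bs)) =
        -2 * n * M.ellY bs (theta (βhat n bs)) + 2 * d) := by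
  have h := hβbar.ae_eq hq hM hspec
  obtain ⟨hY, hL, -⟩ :=
    Model.tendsto_mul_integral_excess hq hβbar hM h hCmeas hCindep hClaw hβhat
  refine ⟨Model.Jb_eq_Ib hM h, Model.Kby_eq_Iy hM h, fun n bs => Model.riskHat_eq_aicXB hM h bs _,
    (Model.constC_eq hM h).1, fun n => Model.integrable_aicXB (hY n), hL,
    Model.tendsto_integral_aicXB_sub hq hβbar hM h hCmeas hCindep hClaw hβhat, ?_, ?_, ?_⟩
  · intro hf _ hA n bs
    refine ⟨hβhat.theta_isMax hA n bs, ?_⟩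
    have htr := Model.trace_Ib_mul_inv hM
    rw [Model.Ib_eq_Iy hA hM, show (f : ℝ) = 0 from mod_cast hf, add_zero] at htr
    rw [Model.aicXB, Model.Ib_eq_Iy hA hM, htr]
  · intro _ hZ n bs
    rw [Model.aicXB, Model.Ix_eq_Iy hZ]
    ring
  · intro hf _ hA _ hZ n bs
    have htr := Model.trace_Ib_mul_inv hM
    rw [Model.Ib_eq_Iy hA hM, show (f : ℝ) = 0 from mod_cast hf, add_zero] at htr
    rw [Model.aicXB, Model.Ix_eq_Iy hZ, Model.Ib_eq_Iy hA hM, htr]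
    ring
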